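/- **Model.** Let $n,l_t,l_r\ge 1$, let $S=[s_{t,k}]_{k,t}\in\mathbb C^{n\times l_t}$ be an orthogonal pilot, $S^\dagger S=\frac{n\rho}{l_t}I$ (so $\rho=\frac1n\mathrm{Tr}(S^\dagger S)$), and put $F(f)=\mathrm{diag}(e^{j2\pi f(k-1)})_{k=1}^{n}$ and $X_f=I_{l_r}\otimes F(f)S$. The received signal is $$y=X_{f_\delta}h+w,\qquad\text{i.e.}\qquad y_{r,k}=e^{j2\pi f_\delta(k-1)}\sum_{t=1}^{l_t}s_{t,k}h_{r,t}+w_{r,k},$$ where the carrier frequency offset (CFO) $f_\delta\sim\mathcal N(\mu_f,\sigma_f^2)$ with $\sigma_f^2>0$, the channel $h=(h_{r,t})\sim\mathcal{CN}(\mu,\Sigma)$ with $\Sigma$ positive definite, and the noise $w\sim\mathcal{CN}(0,I)$ are mutually independent. Here $\mathcal{CN}(m,C)$ has density $\det(\pi C)^{-1}e^{-(x-m)^\dagger C^{-1}(x-m)}$. Write $p_\pi$ for the density of $f_\delta$, $p(y|f)$ for the density of $\mathcal{CN}(X_f\mu,\,X_f\Sigma X_f^\dagger+I)$, and let $\mathbb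 E[\,\cdot\,|f]$ denote expectation when $f_\delta$ is replaced by $f$, i.e. $y=X_fh+w$. Let $$A=[a_{r_1,t_1,r_2,t_2}]=\Big(\Sigma^{-1}+\tfrac{n\rho}{l_t}I\Big)^{-1},\qquad b=[b_{r,t}]=\Big(I-\tfrac{n\rho}{l_t}A\Big)\mu,$$ write $c_{(r_1,t_1),(r_2,t_2)}$ for the entries of $\Sigma$, and set $$\beta=8\pi^2\,\Re\Big[\sum_{k=1}^{n-1}k^2\Big(\sum_{r,t,t'}s_{t,k+1}s_{t',k+1}^*\mu_{r,t'}^*b_{r,t}+\sum_{k_1=k+1}^{n}\ \sum_{r_1,t_1,r_2,t_2}a_{r_1,t_1,r_2,t_2}\,s_{t_1,k_1}s_{t_2,k_1-k}^*\sum_{t_2'}s_{t_2',k_1-k}\sum_{t_1'}s_{t_1',k_1}^*\big(c^*_{(r_1,t_1'),(r_2,t_2')}+\mu_{r_2,t_2'}\mu^*_{r_1,t_1'}\big)\Big)\Big].$$ An estimator is a measurable real function $\hat f=\hat f(y)$ of the received signal. Mean square errors take values in $[0,\infty]$. **Theorem.** 0. For every $f$, $p(\cdot|f)$ is the density of the law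 of $y$ given $f_\delta=f$. It is positive and, for every $y$, twice continuously differentiable in $f$. Moreover $\beta\ge 0$. 1. (Bayesian CRLB) $\frac{\partial^2}{\partial f^2}\ln\big(p(y|f)p_\pi(f)\big)\big|_{f=f_\delta}$ is integrable and $$-\mathbb E\Big[\frac{\partial^2\ln(p(y|f_\delta)p_\pi(f_\delta))}{\partial f_\delta^2}\Big]=\beta+\sigma_f^{-2}.$$ Every estimator with $\lim_{f\to\pm\infty}\mathbb E[\hat f-f\,|\,f]\,p_\pi(f)=0$ satisfies $$\mathbb E\big[(\hat f-f_\delta)^2\big]\ \ge\ \frac1{\beta+\sigma_f^{-2}}.$$ 2. (CRLB) For every $f\in\mathbb R$, $\frac{\partial^2}{\partial f^2}\ln p(y|f)$ is integrable under the law of $y$ given $f_\delta=f$ and $$-\mathbb E\Big[\frac{\partial^2\ln p(y|f)}{\partial f^2}\,\Big|\,f\Big]=\beta.$$ Every estimator that is locally unbiased at $f$, in the sense that $u\mapsto\mathbb E[\hat f-u\,|\,u]$ has derivative $0$ at $u=f$, satisfies $$\mathbb E\big[(\hat f-f)^2\,\big|\,f\big]\ \ge\ \frac1\beta,$$ with $1/\beta=\infty$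 if $\beta=0$. 3. (I.i.d. channel) If $\mu=0$ and $\Sigma=\sigma_h^2I$, then, with $\ddot s_{k_1,k_2}=\sum_t s_{t,k_1}s_{t,k_2}^*$, $$\beta=8\pi^2l_r\Big(\sigma_h^{-2}+\frac{n\rho}{l_t}\Big)^{-1}\sigma_h^2\sum_{k=1}^{n-1}k^2\sum_{k_1=k+1}^{n}|\ddot s_{k_1,k_1-k}|^2 .$$ Suppose in addition that $\rho>0$ and $n=ml_t$ with $m\geq 1$ an integer, and let $C$ be diagonal with diagonal entries of modulus $1$. - If $S=\sqrt\rho\,C\,[O;\dots;O]$ is a periodic pilot ($m$ stacked copies of a unitary $O\in\mathbb C^{l_t\times l_t}$), then $$\beta=\beta_P=\tfrac23\pi^2l_rl_t\Big(1+\big(\tfrac{n\rho}{l_t}\sigma_h^2\big)^{-1}\Big)^{-1}\Big(\tfrac{n\rho}{l_t}\sigma_h^2\Big)\Big(n^2\big(1-\tfrac{l_t^2}{n^2}\big)\Big).$$ - If $S=\sqrt\rho\,C\,\mathrm{diag}(\mathbf 1_m,\dots,\mathbf 1_m)$ is a time-division pilot ($l_t$ diagonal blocks, each the all-ones column of length $m$),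 then $\beta=\beta_T=l_t^{-2}\beta_P$. -/

import Mathlib

open MeasureTheory ProbabilityTheory Filter Topology
open scoped Matrix Kronecker ComplexOrder NNReal ENNReal

noncomputable section

namespace CFO

/-- Circularly symmetric complex Gaussian density with mean `m` and covariance `C`:
`det(π C)⁻¹ exp(-(x - m)† C⁻¹ (x - m))` (both `det` and the quadratic form are real for a positive
definite `C`). -/
def cnDensity {ι : Type*} [Fintype ι] [DecidableEq ι] (m : ι → ℂ) (C : Matrix ι ι ℂ)
    (x : ι → ℂ) : ℝ :=
  (((Real.pi : ℂ) • C).det.re)⁻¹ * Real.exp (-(star (x - m) ⬝ᵥ (C⁻¹ *ᵥ (x - m))).re)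

/-- The distribution `𝒞𝒩(m, C)` on `ι → ℂ`, for positive definite `C`. -/
def cnMeasure {ι : Type*} [Fintype ι] [DecidableEq ι] (m : ι → ℂ) (C : Matrix ι ι ℂ) :
    Measure (ι → ℂ) :=
  (volume : Measure (ι → ℂ)).withDensity (fun x => ENNReal.ofReal (cnDensity m C x))

/-- `F(f)`: the diagonal matrix of the phases `e^{j 2π f (k-1)}`, `k = 1, …, n`
(the index `k : Fin n` starts at `0`). -/
def phaseMatrix (n : ℕ) (f : ℝ) : Matrix (Fin n) (Fin n) ℂ :=
  Matrix.diagonal fun k => Complex.exp (2 * Real.pi * Complex.I * f * ((k : ℕ) : ℂ))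

/-- The block diagonal matrix with `lr` copies of `F(f) S` on its diagonal. -/
def bigX {n lt : ℕ} (lr : ℕ) (S : Matrix (Fin n) (Fin lt) ℂ) (f : ℝ) :
    Matrix (Fin lr × Fin n) (Fin lr × Fin lt) ℂ :=
  (1 : Matrix (Fin lr) (Fin lr) ℂ) ⊗ₖ (phaseMatrix n f * S)

/-- The received signal for offset `f`, channel `h` and noise `w`:
`y_{r,k} = e^{j 2π f (k-1)} ∑_t s_{t,k} h_{r,t} + w_{r,k}`. -/
def received {n lt lr : ℕ} (S : Matrix (Fin n) (Fin lt) ℂ) (f : ℝ)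
    (h : Fin lr × Fin lt → ℂ) (w : Fin lr × Fin n → ℂ) : Fin lr × Fin n → ℂ :=
  bigX lr S f *ᵥ h + w

/-- The conditional density of `y` given the offset `f`: complex Gaussian with mean `X μ` and
covariance `X Σ X† + I`. -/
def likelihood {n lt lr : ℕ} (S : Matrix (Fin n) (Fin lt) ℂ) (μ : Fin lr × Fin lt → ℂ)
    (Sig : Matrix (Fin lr × Fin lt) (Fin lr × Fin lt) ℂ) (y : Fin lr × Fin n → ℂ) (f : ℝ) : ℝ :=
  cnDensity (bigX lr S f *ᵥ μ) (bigX lr S f * Sig * (bigX lr S f)ᴴ + 1) y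

/-- `A = (Σ⁻¹ + (nρ/l_t) I)⁻¹`. -/
def matA {lt lr : ℕ} (n : ℕ) (ρ : ℝ) (Sig : Matrix (Fin lr × Fin lt) (Fin lr × Fin lt) ℂ) :
    Matrix (Fin lr × Fin lt) (Fin lr × Fin lt) ℂ :=
  (Sig⁻¹ + ((n * ρ / lt : ℝ) : ℂ) • (1 : Matrix (Fin lr × Fin lt) (Fin lr × Fin lt) ℂ))⁻¹

/-- `b = (I - (nρ/l_t) A) μ`. -/
def vecB {lt lr : ℕ} (n : ℕ) (ρ : ℝ) (μ : Fin lr × Fin lt → ℂ)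
    (Sig : Matrix (Fin lr × Fin lt) (Fin lr × Fin lt) ℂ) : Fin lr × Fin lt → ℂ :=
  (1 - ((n * ρ / lt : ℝ) : ℂ) • matA n ρ Sig) *ᵥ μ

/-- The pilot symbol `s_{t,k}` with the time index `k = 1, …, n` starting at `1`
(the sums below only use indices in this range). -/
def sym {n lt : ℕ} (S : Matrix (Fin n) (Fin lt) ℂ) (t : Fin lt) (k : ℕ) : ℂ :=
  if hk : 1 ≤ k ∧ k ≤ n then S ⟨k - 1, by omega⟩ t else 0

/-- `s̈_{k₁,k₂} = ∑_t s_{t,k₁} s_{t,k₂}^*`. -/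
def sDD {n lt : ℕ} (S : Matrix (Fin n) (Fin lt) ℂ) (k₁ k₂ : ℕ) : ℂ :=
  ∑ t, sym S t k₁ * star (sym S t k₂)

/-- The closed form `β`. -/
def beta {n lt lr : ℕ} (S : Matrix (Fin n) (Fin lt) ℂ) (ρ : ℝ) (μ : Fin lr × Fin lt → ℂ)
    (Sig : Matrix (Fin lr × Fin lt) (Fin lr × Fin lt) ℂ) : ℝ :=
  8 * Real.pi ^ 2 *
    (∑ k ∈ Finset.Icc 1 (n - 1), (k : ℂ) ^ 2 *
      ((∑ r : Fin lr, ∑ t : Fin lt, ∑ t' : Fin lt,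
          sym S t (k + 1) * star (sym S t' (k + 1)) * star (μ (r, t')) * vecB n ρ μ Sig (r, t)) +
        ∑ k₁ ∈ Finset.Icc (k + 1) n,
          ∑ r₁ : Fin lr, ∑ t₁ : Fin lt, ∑ r₂ : Fin lr, ∑ t₂ : Fin lt,
            matA n ρ Sig (r₁, t₁) (r₂, t₂) * sym S t₁ k₁ * star (sym S t₂ (k₁ - k)) *
              ∑ t₂' : Fin lt, sym S t₂' (k₁ - k) *
                ∑ t₁' : Fin lt, star (sym S t₁' k₁) *
                  (star (Sig (r₁, t₁') (r₂, t₂')) + μ (r₂, t₂') * star (μ (r₁, t₁'))))).re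

/-- The closed form `β_P`, where `σh2 = σ_h²`. -/
def betaP (n lt lr : ℕ) (ρ σh2 : ℝ) : ℝ :=
  2 / 3 * Real.pi ^ 2 * lr * lt * (1 + (n * ρ / lt * σh2)⁻¹)⁻¹ * (n * ρ / lt * σh2) *
    ((n : ℝ) ^ 2 * (1 - (lt : ℝ) ^ 2 / (n : ℝ) ^ 2))

/-- Scrambled periodic pilot: `n = m l_t` and `S = √ρ C [O; …; O]` with `m` stacked copies of a
unitary matrix `O` and a diagonal matrix `C` of unit-modulus scrambling symbols. -/
def IsPeriodicPilot {n lt : ℕ} (S : Matrix (Fin n) (Fin lt) ℂ) (ρ : ℝ) : Prop :=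
  ∃ m : ℕ, 0 < m ∧ n = m * lt ∧
    ∃ c : Fin n → ℂ, (∀ k, ‖c k‖ = 1) ∧
      ∃ O ∈ Matrix.unitaryGroup (Fin lt) ℂ,
        ∀ (k : Fin n) (i t : Fin lt), (i : ℕ) = (k : ℕ) % lt →
          S k t = (Real.sqrt ρ : ℂ) * c k * O i t

/-- Scrambled time division pilot: `n = m l_t` and `S = √ρ C diag(1_m, …, 1_m)` with all-ones
columns `1_m` of length `m` and a diagonal matrix `C` of unit-modulus scrambling symbols. -/
def IsTimeDivisionPilot {n lt : ℕ} (S : Matrix (Fin n) (Fin lt) ℂ) (ρ : ℝ) : Prop :=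
  ∃ m : ℕ, 0 < m ∧ n = m * lt ∧
    ∃ c : Fin n → ℂ, (∀ k, ‖c k‖ = 1) ∧
      ∀ (k : Fin n) (t : Fin lt),
        S k t = (Real.sqrt ρ : ℂ) * c k * (if (k : ℕ) / m = (t : ℕ) then 1 else 0)

/-- The conditional bias `E[f̂ - f | f_δ = f]` of the estimator `f̂ = est(y)`: given `f_δ = f`, the
received signal is `received S f h w`, since `f_δ` is independent of `(h, w)`. -/
def condBias {Ω : Type*} [MeasurableSpace Ω] (P : Measure Ω) {n lt lr : ℕ}
    (S : Matrix (Fin n) (Fin lt) ℂ) (h : Ω → Fin lr × Fin lt → ℂ) (w : Ω → Fin lr × Fin n → ℂ)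
    (est : (Fin lr × Fin n → ℂ) → ℝ) (f : ℝ) : ℝ :=
  ∫ ω, (est (received S f (h ω) (w ω)) - f) ∂P

/-- The conditional mean square error `E[(f̂ - f)² | f_δ = f] ∈ [0, ∞]`. -/
def condMSE {Ω : Type*} [MeasurableSpace Ω] (P : Measure Ω) {n lt lr : ℕ}
    (S : Matrix (Fin n) (Fin lt) ℂ) (h : Ω → Fin lr × Fin lt → ℂ) (w : Ω → Fin lr × Fin n → ℂ)
    (est : (Fin lr × Fin n → ℂ) → ℝ) (f : ℝ) : ℝ≥0∞ :=
  ∫⁻ ω, ENNReal.ofReal ((est (received S f (h ω) (w ω)) - f) ^ 2) ∂P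

/-- The mean square error `E[(f̂ - f_δ)²] ∈ [0, ∞]`. -/
def bayesMSE {Ω : Type*} [MeasurableSpace Ω] (P : Measure Ω) {n lt lr : ℕ}
    (S : Matrix (Fin n) (Fin lt) ℂ) (fδ : Ω → ℝ)
    (h : Ω → Fin lr × Fin lt → ℂ) (w : Ω → Fin lr × Fin n → ℂ)
    (est : (Fin lr × Fin n → ℂ) → ℝ) : ℝ≥0∞ :=
  ∫⁻ ω, ENNReal.ofReal ((est (received S (fδ ω) (h ω) (w ω)) - fδ ω) ^ 2) ∂P

/-- `∂²/∂f² ln( f_{y|f}(y|f) f_{f_δ}(f) )` for the prior `N(μf, vf)`. -/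
def jointLogD2 {n lt lr : ℕ} (S : Matrix (Fin n) (Fin lt) ℂ) (μ : Fin lr × Fin lt → ℂ)
    (Sig : Matrix (Fin lr × Fin lt) (Fin lr × Fin lt) ℂ) (μf : ℝ) (vf : ℝ≥0)
    (y : Fin lr × Fin n → ℂ) (f : ℝ) : ℝ :=
  iteratedDeriv 2 (fun u => Real.log (likelihood S μ Sig y u * gaussianPDFReal μf vf u)) f

/-- `∂²/∂f² ln f_{y|f}(y|f)`. -/
def condLogD2 {n lt lr : ℕ} (S : Matrix (Fin n) (Fin lt) ℂ) (μ : Fin lr × Fin lt → ℂ)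
    (Sig : Matrix (Fin lr × Fin lt) (Fin lr × Fin lt) ℂ)
    (y : Fin lr × Fin n → ℂ) (f : ℝ) : ℝ :=
  iteratedDeriv 2 (fun u => Real.log (likelihood S μ Sig y u)) f

end CFO

end

/-! Both bounds are Cauchy–Schwarz between the estimation error and a score
(`inv_ofReal_le_lintegral_sq`). The model has to supply a smooth family with well-controlled score
whose Fisher information equals β at every offset.

The structural fact is that the offset acts by a diagonal unitary, X_f = R(f) X_0, so X_f†X_f =
(nρ/l_t) I is free of f. With K = X_f Σ X_f† + I, Woodbury gives K⁻¹ = I - X_f A X_f† and K⁻¹ X_f μ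
= X_f b, and Sylvester's identity makes det K constant. Hence, up to terms free of f, ln p(y|f) is
y†X_f A X_f†y + 2 Re y†X_f b, a trigonometric polynomial in f (`exists_likelihood_eq`). Its
derivatives are O(1 + |y|²) uniformly in f, while p(y|f) has a Gaussian tail uniform in f
(`exists_likelihood_le`). These facts form a `RegularFamily`.

Such a family can be differentiated under the integral: the score has mean zero and E[s²] = -E[s'].
Estimators need only be measurable: an infinite error makes the bound trivial, and a finite error at
f makes the mean differentiable on a ball around f of a radius independent of f (`hasDerivAt_mean`).
Cramér–Rao follows at once. For the Bayesian bound, Fubini gives a finite second moment at almost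
every f, the balls around these f cover the line, and integrating the derivative of bias times prior
shows that error and joint score have correlation 1.

The expected second derivative involves only first and second moments of y. Their phases cancel
those of the trigonometric polynomial, so f disappears, and grouping sample pairs by time difference
gives β (`beta_eq`). That p(y|f) is the conditional density is Bayes' rule for Gaussians
(`cnDensity_mul_cnDensity`). For the two pilots, |s̈| is ρ on pairs with the same residue,
respectively in the same block, and 0 otherwise. -/

set_option linter.unusedSectionVars false

/-! ### Cramér–Rao inequality for an abstract regular family -/

/-- Cauchy–Schwarz in the form used by information inequalities. -/
theorem inv_ofReal_le_lintegral_sq {α : Type*} [MeasurableSpace α] {m : Measure α}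
    {A B : α → ℝ} {J : ℝ} (hA : AEStronglyMeasurable A m) (hB : MemLp B 2 m)
    (hJ : ∫ x, B x ^ 2 ∂m = J) (hAB : MemLp A 2 m → ∫ x, A x * B x ∂m = 1) :
    (ENNReal.ofReal J)⁻¹ ≤ ∫⁻ x, ENNReal.ofReal (A x ^ 2) ∂m := by
  -- If `A` is not square integrable the bound is trivial; the correlation hypothesis is only
  -- available in the other case.
  by_cases hfin : ∫⁻ x, ENNReal.ofReal (A x ^ 2) ∂m = ∞
  · simp [hfin]
  have hA2 : Integrable (fun x => A x ^ 2) m := by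
    refine ⟨hA.pow 2, ?_⟩
    rw [hasFiniteIntegral_iff_ofReal (ae_of_all _ fun x => sq_nonneg _)]
    exact lt_top_iff_ne_top.mpr hfin
  have hAL : MemLp A 2 m := (memLp_two_iff_integrable_sq hA).mpr hA2
  have hB2 : Integrable (fun x => B x ^ 2) m := (memLp_two_iff_integrable_sq hB.1).mp hB
  have h1 := hAB hAL
  have hABi : Integrable (fun x => A x * B x) m := hAL.integrable_mul hB
  -- This is `∫ (t A - B)²` as a polynomial in `t`, with linear coefficient `-2` because the
  -- correlation is 1. Its discriminant is nonpositive.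
  have hquad : ∀ t : ℝ, 0 ≤ (∫ x, A x ^ 2 ∂m) * (t * t) + (-2) * t + J := by
    intro t
    have h0 : 0 ≤ ∫ x, (t * A x - B x) ^ 2 ∂m := integral_nonneg fun x => sq_nonneg _
    have : ∫ x, (t * A x - B x) ^ 2 ∂m
        = ∫ x, ((t ^ 2 * A x ^ 2 - 2 * t * (A x * B x)) + B x ^ 2) ∂m := by
      congr 1; ext x; ring
    have h3 := hA2.const_mul (t ^ 2)
    have h4 := hABi.const_mul (2 * t)
    rw [this, integral_add (by exact h3.sub h4) hB2, integral_sub h3 h4, integral_const_mul,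
      integral_const_mul, h1, hJ] at h0
    linarith
  have hd := discrim_le_zero hquad
  rw [discrim] at hd
  have hmul : 1 ≤ J * ∫ x, A x ^ 2 ∂m := by linarith
  have hJ0 : 0 ≤ J := hJ ▸ integral_nonneg fun x => sq_nonneg _
  -- `J = 0` contradicts `hmul`, so here the extended inverse is a real inverse. The bound `∞` for
  -- `J = 0` arises only in the trivial branch.
  have hJp : 0 < J := lt_of_le_of_ne hJ0 fun h => by rw [← h] at hmul; norm_num at hmul
  rw [← ofReal_integral_eq_lintegral_ofReal hA2 (ae_of_all _ fun x => sq_nonneg _),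
    ← ENNReal.ofReal_inv_of_pos hJp]
  exact ENNReal.ofReal_le_ofReal (by rwa [inv_le_iff_one_le_mul₀' hJp])

/-- A positive smooth density `p y u` with score `s`, derivative `s'` of the score, and uniform
control of all of them by an envelope `N`. -/
structure RegularFamily {E : Type*} [MeasurableSpace E] (ν : Measure E) (p s s' : E → ℝ → ℝ)
    (N : E → ℝ) (C M lam : ℝ) : Prop where
  pos : ∀ y u, 0 < p y u
  one_le : ∀ y, 1 ≤ N y
  measN : Measurable N
  meas_p : Measurable (fun x : ℝ × E => p x.2 x.1)
  meas_s : Measurable (fun x : ℝ × E => s x.2 x.1)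
  meas_s' : Measurable (fun x : ℝ × E => s' x.2 x.1)
  deriv_p : ∀ y u, HasDerivAt (p y) (p y u * s y u) u
  deriv_s : ∀ y u, HasDerivAt (s y) (s' y u) u
  C_pos : 0 < C
  bound_s : ∀ y u, |s y u| ≤ C * N y
  bound_s' : ∀ y u, |s' y u| ≤ C * N y
  lam_pos : 0 < lam
  bound_p : ∀ y u, p y u ≤ M * Real.exp (-lam * N y)
  int_exp : ∀ ε : ℝ, 0 < ε → Integrable (fun y => Real.exp (-ε * N y)) ν
  mass : ∀ u, ∫ y, p y u ∂ν = 1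

namespace RegularFamily

variable {E : Type*} [MeasurableSpace E] {ν : Measure E} {p s s' : E → ℝ → ℝ}
    {N : E → ℝ} {C M lam : ℝ}

theorem measurable_p (R : RegularFamily ν p s s' N C M lam) (u : ℝ) :
    Measurable fun y => p y u := R.meas_p.comp measurable_prodMk_left

theorem measurable_s (R : RegularFamily ν p s s' N C M lam) (u : ℝ) :
    Measurable fun y => s y u := R.meas_s.comp measurable_prodMk_left

theorem measurable_s' (R : RegularFamily ν p s s' N C M lam) (u : ℝ) :
    Measurable fun y => s' y u := R.meas_s'.comp measurable_prodMk_left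

/-- Half of the exponential rate absorbs the power, by comparing with a single term of the
exponential series. -/
theorem integrable_pow_mul_exp (R : RegularFamily ν p s s' N C M lam) (k : ℕ) {ε : ℝ}
    (hε : 0 < ε) : Integrable (fun y => N y ^ k * Real.exp (-ε * N y)) ν := by
  have h2 : 0 < ε / 2 := by linarith
  refine ((R.int_exp (ε / 2) h2).const_mul (k.factorial / (ε / 2) ^ k)).mono'
    (((R.measN.pow_const k).mul (R.measN.const_mul _).exp).aestronglyMeasurable)
    (ae_of_all _ fun y => ?_)
  have hN : 0 ≤ N y := zero_le_one.trans (R.one_le y)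
  have hf : (0 : ℝ) < k.factorial := by positivity
  rw [Real.norm_of_nonneg (by positivity)]
  have h3 := Real.pow_div_factorial_le_exp (ε / 2 * N y) (by positivity) k
  rw [mul_pow, div_le_iff₀ hf] at h3
  have h4 : N y ^ k ≤ k.factorial / (ε / 2) ^ k * Real.exp (ε / 2 * N y) := by
    rw [div_mul_eq_mul_div, le_div_iff₀ (by positivity)]
    linarith
  calc N y ^ k * Real.exp (-ε * N y)
      ≤ k.factorial / (ε / 2) ^ k * Real.exp (ε / 2 * N y) * Real.exp (-ε * N y) := by gcongr
    _ = _ := by rw [mul_assoc, ← Real.exp_add]; ring_nf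

/-- The tail rate `lam` leaves room for an exponential factor of any smaller rate. This room pays
for moving the parameter in `hasDerivAt_mean`. -/
theorem integrable_pow_mul (R : RegularFamily ν p s s' N C M lam) (k : ℕ) {c : ℝ}
    (hc : c < lam) (u : ℝ) :
    Integrable (fun y => N y ^ k * Real.exp (c * N y) * p y u) ν := by
  refine ((R.integrable_pow_mul_exp k (sub_pos.mpr hc)).const_mul M).mono'
    ((((R.measN.pow_const k).mul (R.measN.const_mul _).exp).mul
      (R.measurable_p u)).aestronglyMeasurable) (ae_of_all _ fun y => ?_)
  have hN : 0 ≤ N y := zero_le_one.trans (R.one_le y)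
  have hp := (R.pos y u).le
  rw [Real.norm_of_nonneg (by positivity)]
  calc N y ^ k * Real.exp (c * N y) * p y u
      ≤ N y ^ k * Real.exp (c * N y) * (M * Real.exp (-lam * N y)) := by
        gcongr; exact R.bound_p y u
    _ = M * (N y ^ k * (Real.exp (c * N y) * Real.exp (-lam * N y))) := by ring
    _ = _ := by rw [← Real.exp_add]; ring_nf

theorem integrable_mul_of_le (R : RegularFamily ν p s s' N C M lam) {g : E → ℝ}
    (hg : Measurable g) {K : ℝ} (k : ℕ) (hK : ∀ y, |g y| ≤ K * N y ^ k) (u : ℝ) :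
    Integrable (fun y => g y * p y u) ν := by
  refine ((R.integrable_pow_mul k R.lam_pos u).const_mul K).mono'
    ((hg.mul (R.measurable_p u)).aestronglyMeasurable) (ae_of_all _ fun y => ?_)
  rw [zero_mul, Real.exp_zero, mul_one, norm_mul, Real.norm_eq_abs, Real.norm_eq_abs,
    abs_of_pos (R.pos y u), ← mul_assoc]
  exact mul_le_mul_of_nonneg_right (hK y) (R.pos y u).le

theorem integrable_p (R : RegularFamily ν p s s' N C M lam) (u : ℝ) :
    Integrable (fun y => p y u) ν := by
  simpa using R.integrable_mul_of_le (g := fun _ => 1) measurable_const (K := 1) 0 (by simp) u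

theorem integrable_s_mul (R : RegularFamily ν p s s' N C M lam) (u : ℝ) :
    Integrable (fun y => s y u * p y u) ν :=
  R.integrable_mul_of_le (R.measurable_s u) 1 (by simpa using fun y => R.bound_s y u) u

theorem integrable_s'_mul (R : RegularFamily ν p s s' N C M lam) (u : ℝ) :
    Integrable (fun y => s' y u * p y u) ν :=
  R.integrable_mul_of_le (R.measurable_s' u) 1 (by simpa using fun y => R.bound_s' y u) u

theorem sq_le (R : RegularFamily ν p s s' N C M lam) (y : E) (u : ℝ) :
    s y u ^ 2 ≤ C ^ 2 * N y ^ 2 := by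
  rw [← mul_pow, ← sq_abs]
  exact pow_le_pow_left₀ (abs_nonneg _) (R.bound_s y u) 2

theorem integrable_sq_mul (R : RegularFamily ν p s s' N C M lam) (u : ℝ) :
    Integrable (fun y => s y u ^ 2 * p y u) ν :=
  R.integrable_mul_of_le ((R.measurable_s u).pow_const 2) (K := C ^ 2) 2
    (fun y => by rw [abs_of_nonneg (sq_nonneg _)]; exact R.sq_le y u) u

/-- The score is the derivative of `log p`, so its bound makes `log p` Lipschitz with constant `C *
N y`. Moments at one parameter then control nearby parameters. -/
theorem le_mul_exp (R : RegularFamily ν p s s' N C M lam) (y : E) (u f : ℝ) :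
    p y u ≤ p y f * Real.exp (C * |u - f| * N y) := by
  have hd : ∀ x ∈ (Set.univ : Set ℝ),
      HasDerivWithinAt (fun u => Real.log (p y u)) (s y x) Set.univ x := by
    intro x _
    have := (R.deriv_p y x).log (R.pos y x).ne'
    rw [mul_div_cancel_left₀ _ (R.pos y x).ne'] at this
    exact this.hasDerivWithinAt
  have h := convex_univ.norm_image_sub_le_of_norm_hasDerivWithin_le hd
    (fun x _ => R.bound_s y x) (Set.mem_univ f) (Set.mem_univ u)
  have h' := (le_abs_self _).trans h
  rw [Real.norm_eq_abs] at h'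
  rw [← Real.exp_log (R.pos y u), ← Real.exp_log (R.pos y f), ← Real.exp_add, Real.exp_le_exp]
  linarith [mul_right_comm C (N y) |u - f|]

/-- An estimator with finite second moment at `f` has a differentiable mean near `f`. -/
theorem hasDerivAt_mean (R : RegularFamily ν p s s' N C M lam) {est : E → ℝ}
    (he : Measurable est) {f : ℝ} (h2 : Integrable (fun y => est y ^ 2 * p y f) ν) {u : ℝ}
    (hu : |u - f| < lam / (4 * C)) :
    Integrable (fun y => est y * p y u) ν ∧ Integrable (fun y => est y * s y u * p y u) ν ∧
      HasDerivAt (fun v => ∫ y, est y * p y v ∂ν) (∫ y, est y * s y u * p y u ∂ν) u := by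
  have hC := R.C_pos
  have hδ : 0 < lam / (4 * C) := div_pos R.lam_pos (by linarith)
  have hCδ : C * (lam / (4 * C)) = lam / 4 := by field_simp
  -- Moving the parameter by less than `lam / (4 * C)` costs a factor of rate `lam / 4`. Bounding
  -- `|a| X` by `a² + X²` doubles the rate to `lam / 2`, still below `lam`.
  have hdom : ∀ k : ℕ, Integrable
      (fun y => |est y| * (N y ^ k * Real.exp (lam / 4 * N y)) * p y f) ν := by
    intro k
    have h3 := R.integrable_pow_mul (2 * k) (c := lam / 2) (by linarith [R.lam_pos]) f
    refine (h2.add h3).mono' ((((continuous_abs.measurable.comp he).mul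
      ((R.measN.pow_const k).mul (R.measN.const_mul _).exp)).mul
        (R.measurable_p f)).aestronglyMeasurable) (ae_of_all _ fun y => ?_)
    have hN : 0 ≤ N y := zero_le_one.trans (R.one_le y)
    have hp := (R.pos y f).le
    have hX : (N y ^ k * Real.exp (lam / 4 * N y)) ^ 2
        = N y ^ (2 * k) * Real.exp (lam / 2 * N y) := by
      rw [mul_pow, ← pow_mul, mul_comm k, ← Real.exp_nat_mul]; congr 2; push_cast; ring
    have hX0 : 0 ≤ N y ^ k * Real.exp (lam / 4 * N y) := by positivity
    rw [Real.norm_of_nonneg (by positivity)]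
    simp only [Pi.add_apply]
    rw [← hX, ← add_mul, ← sq_abs (est y)]
    refine mul_le_mul_of_nonneg_right ?_ hp
    nlinarith [sq_nonneg (|est y| - N y ^ k * Real.exp (lam / 4 * N y)), abs_nonneg (est y)]
  have hp : ∀ y v, |v - f| < lam / (4 * C) → p y v ≤ p y f * Real.exp (lam / 4 * N y) := by
    intro y v hv
    refine (R.le_mul_exp y v f).trans ?_
    have hN : 0 ≤ N y := zero_le_one.trans (R.one_le y)
    have := (R.pos y f).le
    rw [← hCδ]
    gcongr
  have hint : ∀ v, |v - f| < lam / (4 * C) → Integrable (fun y => est y * p y v) ν := by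
    intro v hv
    refine (hdom 0).mono' (he.mul (R.measurable_p v)).aestronglyMeasurable
      (ae_of_all _ fun y => ?_)
    rw [pow_zero, one_mul, norm_mul, Real.norm_eq_abs, Real.norm_eq_abs, abs_of_pos (R.pos y v),
      mul_assoc, mul_comm (Real.exp _)]
    exact mul_le_mul_of_nonneg_left (hp y v hv) (abs_nonneg _)
  have hs : {v | |v - f| < lam / (4 * C)} ∈ 𝓝 u :=
    (isOpen_lt (by fun_prop) continuous_const).mem_nhds hu
  refine ⟨hint u hu, hasDerivAt_integral_of_dominated_loc_of_deriv_le hs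
    (F := fun v y => est y * p y v) (F' := fun v y => est y * s y v * p y v)
    (bound := fun y => C * (|est y| * (N y ^ 1 * Real.exp (lam / 4 * N y)) * p y f))
    (Eventually.of_forall fun v => (he.mul (R.measurable_p v)).aestronglyMeasurable)
    (hint u hu) (((he.mul (R.measurable_s u)).mul (R.measurable_p u)).aestronglyMeasurable)
    (ae_of_all _ fun y v hv => ?_) ((hdom 1).const_mul C) (ae_of_all _ fun y v hv => ?_)⟩
  · have hN : 0 ≤ N y := zero_le_one.trans (R.one_le y)
    rw [norm_mul, norm_mul, Real.norm_eq_abs, Real.norm_eq_abs, Real.norm_eq_abs,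
      abs_of_pos (R.pos y v), pow_one]
    calc |est y| * |s y v| * p y v
        ≤ |est y| * (C * N y) * (p y f * Real.exp (lam / 4 * N y)) := by
          have := (R.pos y v).le
          have := R.bound_s y v
          have := hp y v hv
          gcongr
      _ = _ := by ring
  · refine ((R.deriv_p y v).const_mul (est y)).congr_deriv ?_
    ring

/-- The constant estimator `1` has constant mean, so the derivative given by `hasDerivAt_mean` is
zero. -/
theorem integral_s_mul (R : RegularFamily ν p s s' N C M lam) (u : ℝ) :
    ∫ y, s y u * p y u ∂ν = 0 := by
  have h := (R.hasDerivAt_mean (est := fun _ => 1) measurable_const (f := u) (u := u)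
    (by simpa using R.integrable_p u)
    (by simpa using div_pos R.lam_pos (mul_pos four_pos R.C_pos))).2.2
  simp only [one_mul, R.mass] at h
  exact h.unique (hasDerivAt_const u (1 : ℝ))

/-- The two expressions of the Fisher information agree. -/
theorem integral_sq_mul (R : RegularFamily ν p s s' N C M lam) (u : ℝ) :
    ∫ y, s y u ^ 2 * p y u ∂ν = -∫ y, s' y u * p y u ∂ν := by
  -- Without an estimator the global envelope dominates for all parameters at once, and the identity
  -- is the derivative of `∫ s p = 0`.
  have hb := ((R.integrable_pow_mul_exp 1 R.lam_pos).const_mul (C * M)).add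
    ((R.integrable_pow_mul_exp 2 R.lam_pos).const_mul (C ^ 2 * M))
  have h := (hasDerivAt_integral_of_dominated_loc_of_deriv_le (x₀ := u) (univ_mem)
    (F := fun v y => s y v * p y v) (F' := fun v y => s' y v * p y v + s y v ^ 2 * p y v)
    (Eventually.of_forall fun v =>
      ((R.measurable_s v).mul (R.measurable_p v)).aestronglyMeasurable)
    (R.integrable_s_mul u) (((R.integrable_s'_mul u).add (R.integrable_sq_mul u)).1)
    (ae_of_all _ fun y v _ => ?_) hb (ae_of_all _ fun y v _ => ?_)).2
  · simp only [R.integral_s_mul] at h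
    have h0 := h.unique (hasDerivAt_const u (0 : ℝ))
    rw [integral_add (R.integrable_s'_mul u) (R.integrable_sq_mul u)] at h0
    linarith
  · have hN : 0 ≤ N y := zero_le_one.trans (R.one_le y)
    have hC := R.C_pos
    have hM : 0 ≤ M * Real.exp (-lam * N y) := (R.pos y v).le.trans (R.bound_p y v)
    rw [← add_mul, norm_mul, Real.norm_eq_abs, Real.norm_eq_abs, abs_of_pos (R.pos y v)]
    have h1 : |s' y v + s y v ^ 2| ≤ C * N y + C ^ 2 * N y ^ 2 := by
      refine (abs_add_le _ _).trans (add_le_add (R.bound_s' y v) ?_)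
      rw [abs_of_nonneg (sq_nonneg _)]
      exact R.sq_le y v
    calc |s' y v + s y v ^ 2| * p y v
        ≤ (C * N y + C ^ 2 * N y ^ 2) * (M * Real.exp (-lam * N y)) :=
          mul_le_mul h1 (R.bound_p y v) (R.pos y v).le (by positivity)
      _ = _ := by simp only [Pi.add_apply]; ring
  · refine ((R.deriv_s y v).mul (R.deriv_p y v)).congr_deriv ?_
    ring

/-- The law with density `p · u`. -/
noncomputable def law (ν : Measure E) (p : E → ℝ → ℝ) (u : ℝ) : Measure E :=
  ν.withDensity fun y => ENNReal.ofReal (p y u)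

theorem integrable_law_iff (R : RegularFamily ν p s s' N C M lam) (u : ℝ) {g : E → ℝ} :
    Integrable g (law ν p u) ↔ Integrable (fun y => g y * p y u) ν := by
  rw [law, integrable_withDensity_iff (R.measurable_p u).ennreal_ofReal (by simp)]
  simp [ENNReal.toReal_ofReal (R.pos _ u).le]

theorem integral_law (R : RegularFamily ν p s s' N C M lam) (u : ℝ) (g : E → ℝ) :
    ∫ y, g y ∂(law ν p u) = ∫ y, g y * p y u ∂ν := by
  rw [law, integral_withDensity_eq_integral_toReal_smul (R.measurable_p u).ennreal_ofReal
    (by simp)]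
  simp [ENNReal.toReal_ofReal (R.pos _ u).le, mul_comm]

theorem integrable_sq_of_sub {est : E → ℝ} (R : RegularFamily ν p s s' N C M lam)
    (he : Measurable est) {f : ℝ} (h : Integrable (fun y => (est y - f) ^ 2 * p y f) ν) :
    Integrable (fun y => est y ^ 2 * p y f) ν := by
  refine ((h.const_mul 2).add ((R.integrable_p f).const_mul (2 * f ^ 2))).mono'
    ((he.pow_const 2).mul (R.measurable_p f)).aestronglyMeasurable (ae_of_all _ fun y => ?_)
  have hp := (R.pos y f).le
  rw [Real.norm_of_nonneg (by positivity)]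
  simp only [Pi.add_apply]
  rw [← mul_assoc, ← add_mul]
  refine mul_le_mul_of_nonneg_right ?_ hp
  -- `2 (a - f)² + 2 f² - a²` is the square of `a - 2 f`.
  nlinarith [sq_nonneg (est y - 2 * f)]

/-- Derivative of the bias near a point where the estimator has finite second moment. -/
theorem hasDerivAt_bias (R : RegularFamily ν p s s' N C M lam) {est : E → ℝ}
    (he : Measurable est) {f : ℝ} (h2 : Integrable (fun y => est y ^ 2 * p y f) ν) {u : ℝ}
    (hu : |u - f| < lam / (4 * C)) :
    Integrable (fun y => (est y - u) * p y u) ν ∧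
    Integrable (fun y => (est y - u) * s y u * p y u) ν ∧
    HasDerivAt (fun v => ∫ y, (est y - v) * p y v ∂ν)
      (∫ y, (est y - u) * s y u * p y u ∂ν - 1) u := by
  obtain ⟨h1, h3, hd⟩ := R.hasDerivAt_mean he h2 hu
  -- Splitting the bias as mean minus `v` needs integrability of the estimator at `v`, which is
  -- known on the open ball and hence near `u`.
  have hev : (fun v => ∫ y, (est y - v) * p y v ∂ν) =ᶠ[𝓝 u]
      fun v => ∫ y, est y * p y v ∂ν - v := by
    filter_upwards [(isOpen_lt (f := fun v => |v - f|) (by fun_prop) continuous_const).mem_nhds hu]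
      with v hv
    simp only [sub_mul]
    rw [integral_sub (R.hasDerivAt_mean he h2 hv).1 ((R.integrable_p v).const_mul v),
      integral_const_mul, R.mass, mul_one]
  have i1 : Integrable (fun y => (est y - u) * p y u) ν := by
    simpa only [sub_mul] using! h1.sub ((R.integrable_p u).const_mul u)
  have i2 : Integrable (fun y => (est y - u) * s y u * p y u) ν := by
    simpa only [sub_mul, mul_assoc] using! h3.sub ((R.integrable_s_mul u).const_mul u)
  refine ⟨i1, i2, ((hd.sub (hasDerivAt_id u)).congr_of_eventuallyEq hev).congr_deriv ?_⟩
  simp only [sub_mul, mul_assoc] at h3 ⊢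
  rw [integral_sub h3 ((R.integrable_s_mul u).const_mul u), integral_const_mul, R.integral_s_mul,
    mul_zero, sub_zero]

/-- Cramér–Rao bound for estimators whose bias has zero derivative at `f`. -/
theorem cramerRao (R : RegularFamily ν p s s' N C M lam) {est : E → ℝ}
    (he : Measurable est) {f : ℝ} (hb : HasDerivAt (fun u => ∫ y, est y - u ∂(law ν p u)) 0 f) :
    (ENNReal.ofReal (-∫ y, s' y f ∂(law ν p f)))⁻¹ ≤
      ∫⁻ y, ENNReal.ofReal ((est y - f) ^ 2) ∂(law ν p f) := by
  simp only [R.integral_law] at hb ⊢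
  have hA : AEStronglyMeasurable (fun y => est y - f) (law ν p f) :=
    (he.sub_const f).aestronglyMeasurable
  have hs : AEStronglyMeasurable (fun y => s y f) (law ν p f) :=
    (R.measurable_s f).aestronglyMeasurable
  refine inv_ofReal_le_lintegral_sq (B := fun y => s y f) hA
    ((memLp_two_iff_integrable_sq hs).mpr ?_) ?_ fun hL => ?_
  · exact (R.integrable_law_iff f).mpr (R.integrable_sq_mul f)
  · rw [R.integral_law, R.integral_sq_mul]
  -- Finite error at `f` makes the derivative of the bias the correlation of error and score, minus
  -- 1; a zero derivative is therefore correlation 1.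
  · have h2 := R.integrable_sq_of_sub he
      ((R.integrable_law_iff f).mp ((memLp_two_iff_integrable_sq hA).mp hL))
    have hd := (R.hasDerivAt_bias he h2 (u := f)
      (by simpa using div_pos R.lam_pos (mul_pos four_pos R.C_pos))).2.2
    rw [R.integral_law]
    linarith [hb.unique hd]

end RegularFamily

/-! ### Bayesian Cramér–Rao inequality with a prior -/

namespace RegularFamily

variable {E : Type*} [MeasurableSpace E] {ν : Measure E} {p s s' : E → ℝ → ℝ}
    {N : E → ℝ} {C M lam : ℝ}

/-- The joint law of parameter and observation for the prior density `g`. -/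
noncomputable def jointLaw (ν : Measure E) (p : E → ℝ → ℝ) (g : ℝ → ℝ) : Measure (ℝ × E) :=
  ((volume : Measure ℝ).prod ν).withDensity fun x => ENNReal.ofReal (p x.2 x.1 * g x.1)

/-- A positive prior density `g` with score `t` and information `I`. -/
structure RegularPrior (g t : ℝ → ℝ) (I : ℝ) : Prop where
  pos : ∀ u, 0 < g u
  meas_g : Measurable g
  meas_t : Measurable t
  deriv_g : ∀ u, HasDerivAt g (g u * t u) u
  int_g : Integrable g
  mass : ∫ u, g u = 1
  int_sq : Integrable fun u => t u ^ 2 * g u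
  info : ∫ u, t u ^ 2 * g u = I

variable {g t : ℝ → ℝ} {I : ℝ}

theorem measurable_joint (R : RegularFamily ν p s s' N C M lam) (G : RegularPrior g t I) :
    Measurable fun x : ℝ × E => p x.2 x.1 * g x.1 :=
  R.meas_p.mul (G.meas_g.comp measurable_fst)

theorem joint_pos (R : RegularFamily ν p s s' N C M lam) (G : RegularPrior g t I) (x : ℝ × E) :
    0 < p x.2 x.1 * g x.1 := mul_pos (R.pos _ _) (G.pos _)

theorem integrable_jointLaw_iff (R : RegularFamily ν p s s' N C M lam) (G : RegularPrior g t I)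
    {F : ℝ × E → ℝ} : Integrable F (jointLaw ν p g) ↔
      Integrable (fun x : ℝ × E => F x * (p x.2 x.1 * g x.1)) ((volume : Measure ℝ).prod ν) := by
  rw [jointLaw, integrable_withDensity_iff (R.measurable_joint G).ennreal_ofReal (by simp)]
  simp [ENNReal.toReal_ofReal (R.joint_pos G _).le]

theorem integral_jointLaw [SFinite ν] (R : RegularFamily ν p s s' N C M lam)
    (G : RegularPrior g t I) {F : ℝ × E → ℝ} (hF : Integrable F (jointLaw ν p g)) :
    ∫ x, F x ∂(jointLaw ν p g) = ∫ u, (∫ y, F (u, y) * p y u ∂ν) * g u := by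
  rw [jointLaw, integral_withDensity_eq_integral_toReal_smul
    (R.measurable_joint G).ennreal_ofReal (by simp)]
  simp only [ENNReal.toReal_ofReal (R.joint_pos G _).le, smul_eq_mul]
  have h := (R.integrable_jointLaw_iff G).mp hF
  simp only [mul_comm (F _)] at h
  rw [integral_prod _ h]
  congr 1; ext u
  rw [← integral_mul_const]
  congr 1; ext y; ring

/-- The envelope is uniform in the parameter, so the integrand is dominated by a function of `u`
times a function of `y`. -/
theorem integrable_joint_of_le [SFinite ν] (R : RegularFamily ν p s s' N C M lam)
    (G : RegularPrior g t I) {F : ℝ × E → ℝ} (hF : Measurable F) {K : ℝ} (k : ℕ) {q : ℝ → ℝ}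
    (hq : Integrable fun u => q u * g u) (hK : ∀ u y, |F (u, y)| ≤ q u * (K * N y ^ k)) :
    Integrable F (jointLaw ν p g) := by
  rw [R.integrable_jointLaw_iff G]
  have h := hq.mul_prod ((R.integrable_pow_mul_exp k R.lam_pos).const_mul (K * M))
  refine h.mono' (hF.mul (R.measurable_joint G)).aestronglyMeasurable
    (ae_of_all _ fun x => ?_)
  have hp := (R.pos x.2 x.1).le
  have hg := (G.pos x.1).le
  rw [norm_mul, Real.norm_eq_abs, Real.norm_eq_abs, abs_of_pos (R.joint_pos G x)]
  calc |F x| * (p x.2 x.1 * g x.1)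
      ≤ q x.1 * (K * N x.2 ^ k) * (M * Real.exp (-lam * N x.2) * g x.1) :=
        mul_le_mul (hK x.1 x.2) (mul_le_mul_of_nonneg_right (R.bound_p _ _) hg)
          (by positivity) ((abs_nonneg _).trans (hK x.1 x.2))
    _ = _ := by ring

theorem integrable_joint_s' [SFinite ν] (R : RegularFamily ν p s s' N C M lam)
    (G : RegularPrior g t I) : Integrable (fun x : ℝ × E => s' x.2 x.1) (jointLaw ν p g) :=
  R.integrable_joint_of_le G R.meas_s' (q := fun _ => 1) (K := C) 1 (by simpa using G.int_g)
    fun u y => by simpa using R.bound_s' y u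

theorem integral_joint_s' [SFinite ν] (R : RegularFamily ν p s s' N C M lam)
    (G : RegularPrior g t I) {J : ℝ} (hJ : ∀ u, ∫ y, s' y u * p y u ∂ν = -J) :
    ∫ x, s' x.2 x.1 ∂(jointLaw ν p g) = -J := by
  rw [R.integral_jointLaw G (R.integrable_joint_s' G)]
  simp only [hJ, integral_const_mul, G.mass, mul_one]

/-- Bayesian Cramér–Rao (van Trees) bound. -/
theorem bayesianCramerRao [SFinite ν] (R : RegularFamily ν p s s' N C M lam)
    (G : RegularPrior g t I) {J : ℝ} (hJ : ∀ u, ∫ y, s' y u * p y u ∂ν = -J)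
    {est : E → ℝ} (he : Measurable est)
    (htop : Tendsto (fun u => (∫ y, est y - u ∂(law ν p u)) * g u) atTop (𝓝 0))
    (hbot : Tendsto (fun u => (∫ y, est y - u ∂(law ν p u)) * g u) atBot (𝓝 0)) :
    (ENNReal.ofReal (J + I))⁻¹ ≤
      ∫⁻ x, ENNReal.ofReal ((est x.2 - x.1) ^ 2) ∂(jointLaw ν p g) := by
  simp only [R.integral_law] at htop hbot
  have hAm : Measurable fun x : ℝ × E => est x.2 - x.1 :=
    (he.comp measurable_snd).sub measurable_fst
  have hBm : Measurable fun x : ℝ × E => s x.2 x.1 + t x.1 :=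
    R.meas_s.add (G.meas_t.comp measurable_fst)
  have iS : Integrable (fun x : ℝ × E => s x.2 x.1 ^ 2) (jointLaw ν p g) :=
    R.integrable_joint_of_le G (R.meas_s.pow_const 2) (q := fun _ => 1) (K := C ^ 2) 2
      (by simpa using G.int_g)
      fun u y => by simpa using R.sq_le y u
  have iT : Integrable (fun x : ℝ × E => t x.1 ^ 2) (jointLaw ν p g) :=
    R.integrable_joint_of_le G ((G.meas_t.comp measurable_fst).pow_const 2)
      (q := fun u => t u ^ 2) (K := 1) 0 G.int_sq fun u y => by simp
  have hBL : MemLp (fun x : ℝ × E => s x.2 x.1 + t x.1) 2 (jointLaw ν p g) :=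
    ((memLp_two_iff_integrable_sq R.meas_s.aestronglyMeasurable).mpr iS).add
      ((memLp_two_iff_integrable_sq
        (G.meas_t.comp measurable_fst).aestronglyMeasurable).mpr iT)
  refine inv_ofReal_le_lintegral_sq (A := fun x : ℝ × E => est x.2 - x.1)
    (B := fun x => s x.2 x.1 + t x.1) hAm.aestronglyMeasurable hBL ?_ fun hL => ?_
  · rw [R.integral_jointLaw G ((memLp_two_iff_integrable_sq hBm.aestronglyMeasurable).mp hBL)]
    -- The cross term vanishes because the score has conditional mean zero, so the informations of
    -- likelihood and prior add up.
    have hin : ∀ u, (∫ y, (s y u + t u) ^ 2 * p y u ∂ν) * g u = J * g u + t u ^ 2 * g u := by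
      intro u
      have h1 := R.integrable_sq_mul u
      have h2 := (R.integrable_s_mul u).const_mul (2 * t u)
      have h3 := (R.integrable_p u).const_mul (t u ^ 2)
      have : (fun y => (s y u + t u) ^ 2 * p y u) =
          fun y => (s y u ^ 2 * p y u + 2 * t u * (s y u * p y u)) + t u ^ 2 * p y u := by
        ext y; ring
      rw [this, integral_add (by exact h1.add h2) h3, integral_add h1 h2, integral_const_mul,
        integral_const_mul, R.integral_s_mul, R.mass, R.integral_sq_mul, hJ]
      ring
    simp only [hin]
    rw [integral_add (G.int_g.const_mul J) G.int_sq, integral_const_mul, G.mass, G.info, mul_one]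
  · have hAB : Integrable (fun x : ℝ × E => (est x.2 - x.1) * (s x.2 x.1 + t x.1))
      (jointLaw ν p g) := hL.integrable_mul hBL
    have hA2 := (R.integrable_jointLaw_iff G).mp
      ((memLp_two_iff_integrable_sq hAm.aestronglyMeasurable).mp hL)
    -- Fubini gives a finite error for almost every parameter, after division by the positive prior
    -- density.
    have hgood : ∀ᵐ f : ℝ, Integrable (fun y => est y ^ 2 * p y f) ν := by
      filter_upwards [hA2.prod_right_ae] with f hf
      refine R.integrable_sq_of_sub he ?_
      have := hf.mul_const (g f)⁻¹
      refine this.congr (ae_of_all _ fun y => ?_)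
      have := (G.pos f).ne'
      simp only
      field_simp
    have hδ : 0 < lam / (4 * C) := div_pos R.lam_pos (mul_pos four_pos R.C_pos)
    -- A set of full measure is dense, and the radius does not depend on the centre, so
    -- differentiability of the bias extends from almost every parameter to every parameter.
    have hnear : ∀ u : ℝ, ∃ f, |u - f| < lam / (4 * C) ∧
        Integrable (fun y => est y ^ 2 * p y f) ν := by
      intro u
      obtain ⟨f, hf, hd⟩ := (Metric.dense_iff.mp (Measure.dense_of_ae hgood)) u _ hδ
      exact ⟨f, by rw [abs_sub_comm]; simpa [Real.dist_eq] using hf, hd⟩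
    have hder : ∀ u, HasDerivAt (fun v => (∫ y, (est y - v) * p y v ∂ν) * g v)
        ((∫ y, (est y - u) * (s y u + t u) * p y u ∂ν) * g u - g u) u := by
      intro u
      obtain ⟨f, hf, hd⟩ := hnear u
      obtain ⟨h1, h2, h3⟩ := R.hasDerivAt_bias he hd hf
      refine (h3.mul (G.deriv_g u)).congr_deriv ?_
      have : (fun y => (est y - u) * (s y u + t u) * p y u) =
          fun y => (est y - u) * s y u * p y u + t u * ((est y - u) * p y u) := by
        ext y; ring
      rw [this, integral_add h2 (h1.const_mul _), integral_const_mul]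
      ring
    have hint : Integrable fun u => (∫ y, (est y - u) * (s y u + t u) * p y u ∂ν) * g u := by
      have := ((R.integrable_jointLaw_iff G).mp hAB).integral_prod_left
      refine this.congr (ae_of_all _ fun u => ?_)
      simp only
      rw [← integral_mul_const]
      congr 1; ext y; ring
    -- The total derivative of bias times prior integrates to zero by the boundary conditions, which
    -- is correlation 1 with the joint score.
    have h0 := integral_of_hasDerivAt_of_tendsto hder (hint.sub G.int_g) hbot htop
    rw [integral_sub hint G.int_g, G.mass] at h0
    rw [R.integral_jointLaw G hAB]
    linarith

/-- The score of the prior is affine, so its second moment is the variance divided by `v ^ 2`. -/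
theorem regularPrior_gaussian (m : ℝ) {v : ℝ≥0} (hv : v ≠ 0) :
    RegularPrior (gaussianPDFReal m v) (fun u => -(u - m) / v) (v : ℝ)⁻¹ := by
  have hv' : (v : ℝ) ≠ 0 := by exact_mod_cast hv
  have hvar : ∫ u, (u - m) ^ 2 ∂(gaussianReal m v) = v := by
    have := variance_fun_id_gaussianReal (μ := m) (v := v)
    rw [variance_eq_integral measurable_id'.aemeasurable] at this
    simpa using this
  have hint : Integrable (fun u => (u - m) ^ 2) (gaussianReal m v) := by
    have : MemLp (fun u => u - m) 2 (gaussianReal m v) :=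
      (memLp_id_gaussianReal 2).sub (memLp_const m)
    exact this.integrable_sq
  have hmul : ∀ u, gaussianPDFReal m v u = (gaussianPDF m v u).toReal := fun u =>
    (toReal_gaussianPDF u).symm
  rw [gaussianReal_of_var_ne_zero _ hv,
    integral_withDensity_eq_integral_toReal_smul (measurable_gaussianPDF m v) (by simp [gaussianPDF])] at hvar
  rw [gaussianReal_of_var_ne_zero _ hv,
    integrable_withDensity_iff (measurable_gaussianPDF m v) (by simp [gaussianPDF])] at hint
  simp only [toReal_gaussianPDF, smul_eq_mul] at hvar hint
  refine ⟨fun u => gaussianPDFReal_pos m v u hv, measurable_gaussianPDFReal m v, by fun_prop,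
    fun u => ?_, integrable_gaussianPDFReal m v, integral_gaussianPDFReal_eq_one m hv, ?_, ?_⟩
  · rw [gaussianPDFReal_def]
    have h : HasDerivAt (fun x => -(x - m) ^ 2 / (2 * (v : ℝ)))
        (-(2 * (u - m)) / (2 * (v : ℝ))) u := by
      have := (((hasDerivAt_id u).sub_const m).pow 2).neg.div_const (2 * (v : ℝ))
      simpa using! this
    refine (h.exp.const_mul _).congr_deriv ?_
    field_simp
  · refine (hint.mul_const ((v : ℝ) ^ 2)⁻¹).congr (ae_of_all _ fun u => ?_)
    simp only
    field_simp
  · have : (fun u => (-(u - m) / (v : ℝ)) ^ 2 * gaussianPDFReal m v u) =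
        fun u => ((v : ℝ) ^ 2)⁻¹ * (gaussianPDFReal m v u * (u - m) ^ 2) := by
      ext u; field_simp
    rw [this, integral_const_mul, hvar]
    field_simp

end RegularFamily

/-! ### Linear algebra of complex Gaussian densities -/

section Algebra

variable {ι κ : Type*} [Fintype ι] [DecidableEq ι] [Fintype κ] [DecidableEq κ]

theorem star_mulVec_dotProduct' (X : Matrix κ ι ℂ) (v : ι → ℂ) (w : κ → ℂ) :
    star (X *ᵥ v) ⬝ᵥ w = star v ⬝ᵥ (Xᴴ *ᵥ w) := by
  rw [Matrix.star_mulVec, Matrix.dotProduct_mulVec]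

theorem star_dotProduct_self_eq (x : ι → ℂ) : star x ⬝ᵥ x = ((∑ i, ‖x i‖ ^ 2 : ℝ) : ℂ) := by
  simp [dotProduct, Complex.conj_mul']

open scoped MatrixOrder in
theorem Matrix.PosDef.exists_factor {C : Matrix ι ι ℂ} (hC : C.PosDef) :
    ∃ L : Matrix ι ι ℂ, IsUnit L.det ∧ C = L * Lᴴ := by
  obtain ⟨B, hB⟩ := CStarAlgebra.nonneg_iff_eq_star_mul_self.mp hC.posSemidef.nonneg
  refine ⟨Bᴴ, ?_, by rw [Matrix.conjTranspose_conjTranspose]; exact hB⟩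
  have h := (Matrix.isUnit_iff_isUnit_det _).mp hC.isUnit
  rw [hB, Matrix.det_mul] at h
  exact isUnit_of_mul_isUnit_left h

/-- Whitening: in the coordinates of a factor `L`, the Gaussian exponent is a squared norm.
Integrals against `cnDensity` are reduced to the standard one in this way. -/
theorem quadForm_factor {C L : Matrix ι ι ℂ} (hL : IsUnit L.det) (h : C = L * Lᴴ) (x : ι → ℂ) :
    star (L *ᵥ x) ⬝ᵥ (C⁻¹ *ᵥ (L *ᵥ x)) = star x ⬝ᵥ x := by
  have hL' : IsUnit Lᴴ.det := by rw [Matrix.det_conjTranspose]; exact hL.star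
  rw [star_mulVec_dotProduct', h, Matrix.mul_inv_rev, Matrix.mulVec_mulVec, Matrix.mulVec_mulVec,
    ← Matrix.mul_assoc, Matrix.mul_assoc, Matrix.nonsing_inv_mul _ hL, Matrix.mul_one,
    Matrix.mul_nonsing_inv _ hL', Matrix.one_mulVec]

theorem Matrix.PosDef.exists_quadForm_ge {C : Matrix ι ι ℂ} (hC : C.PosDef) :
    ∃ c : ℝ, 0 < c ∧ ∀ x : ι → ℂ,
      c * ∑ i, ‖x i‖ ^ 2 ≤ (star x ⬝ᵥ (C⁻¹ *ᵥ x)).re := by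
  obtain ⟨L, hL, h⟩ := hC.exists_factor
  set F : ℝ := ∑ i, ∑ j, ‖L i j‖ ^ 2
  have hF : 0 ≤ F := by positivity
  -- With `x = L z` the form is `|z|²`, and `|L z|² ≤ F |z|²` for the Frobenius norm. Adding 1
  -- covers an empty index type, where `F = 0`.
  refine ⟨(F + 1)⁻¹, by positivity, fun x => ?_⟩
  obtain ⟨z, rfl⟩ : ∃ z, x = L *ᵥ z := ⟨L⁻¹ *ᵥ x, by
    rw [Matrix.mulVec_mulVec, Matrix.mul_nonsing_inv _ hL, Matrix.one_mulVec]⟩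
  rw [quadForm_factor hL h, star_dotProduct_self_eq, Complex.ofReal_re,
    inv_mul_le_iff₀ (by positivity)]
  have h1 : ∀ i, ‖(L *ᵥ z) i‖ ^ 2 ≤ (∑ j, ‖L i j‖ ^ 2) * ∑ j, ‖z j‖ ^ 2 := by
    intro i
    refine le_trans ?_ (Finset.sum_mul_sq_le_sq_mul_sq _ _ _)
    refine pow_le_pow_left₀ (norm_nonneg _) ?_ 2
    refine (norm_sum_le _ _).trans (le_of_eq ?_)
    simp
  calc ∑ i, ‖(L *ᵥ z) i‖ ^ 2 ≤ ∑ i, (∑ j, ‖L i j‖ ^ 2) * ∑ j, ‖z j‖ ^ 2 :=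
        Finset.sum_le_sum fun i _ => h1 i
    _ = F * ∑ j, ‖z j‖ ^ 2 := by rw [← Finset.sum_mul]
    _ ≤ _ := mul_le_mul_of_nonneg_right (by linarith) (by positivity)

theorem Matrix.PosDef.det_re_pos {C : Matrix ι ι ℂ} (hC : C.PosDef) : 0 < C.det.re :=
  (Complex.pos_iff.mp hC.det_pos).1

theorem Matrix.PosDef.det_eq_re {C : Matrix ι ι ℂ} (hC : C.PosDef) : C.det = (C.det.re : ℂ) :=
  Complex.ext (by simp) (by simpa using (Complex.pos_iff.mp hC.det_pos).2.symm)

theorem det_pi_smul_re {C : Matrix ι ι ℂ} :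
    ((Real.pi : ℂ) • C).det.re = Real.pi ^ Fintype.card ι * C.det.re := by
  rw [Matrix.det_smul, ← Complex.ofReal_pow, Complex.re_ofReal_mul]

theorem det_pi_smul_re_pos {C : Matrix ι ι ℂ} (hC : C.PosDef) :
    0 < ((Real.pi : ℂ) • C).det.re := by
  rw [det_pi_smul_re]
  have := hC.det_re_pos
  positivity

theorem cnDensity_pos {C : Matrix ι ι ℂ} (hC : C.PosDef) (m x : ι → ℂ) :
    0 < CFO.cnDensity m C x :=
  mul_pos (inv_pos.mpr (det_pi_smul_re_pos hC)) (Real.exp_pos _)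

theorem posDef_conj_add_one {Sig : Matrix ι ι ℂ} (hS : Sig.PosDef) (X : Matrix κ ι ℂ) :
    (X * Sig * Xᴴ + 1).PosDef :=
  Matrix.PosDef.posSemidef_add (hS.posSemidef.mul_mul_conjTranspose_same X) Matrix.PosDef.one

theorem posDef_inv_add {Sig : Matrix ι ι ℂ} (hS : Sig.PosDef) (X : Matrix κ ι ℂ) :
    (Sig⁻¹ + Xᴴ * X).PosDef :=
  hS.inv.add_posSemidef (Matrix.posSemidef_conjTranspose_mul_self X)

/-- Woodbury's identity moves the inversion from samples to channel coefficients, where `Xᴴ * X` is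
scalar for an orthogonal pilot. -/
theorem inv_conj_add_one {Sig : Matrix ι ι ℂ} (hS : Sig.PosDef) (X : Matrix κ ι ℂ) :
    (X * Sig * Xᴴ + 1)⁻¹ = 1 - X * (Sig⁻¹ + Xᴴ * X)⁻¹ * Xᴴ := by
  have h := Matrix.add_mul_mul_inv_eq_sub (A := (1 : Matrix κ κ ℂ)) (C := Sig) X Xᴴ
    isUnit_one hS.isUnit (by simpa using (posDef_inv_add hS X).isUnit)
  rw [add_comm, h]
  simp

/-- Sylvester's determinant identity. The right side sees `X` only through `Xᴴ * X`. -/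
theorem det_conj_add_one {Sig : Matrix ι ι ℂ} (hS : Sig.PosDef) (X : Matrix κ ι ℂ) :
    (X * Sig * Xᴴ + 1).det = Sig.det * (Sig⁻¹ + Xᴴ * X).det := by
  rw [← Matrix.det_mul, Matrix.mul_add,
    Matrix.mul_nonsing_inv _ ((Matrix.isUnit_iff_isUnit_det _).mp hS.isUnit), add_comm,
    Matrix.mul_assoc, Matrix.det_one_add_mul_comm, Matrix.mul_assoc]

/-- Completing the square. -/
theorem quadForm_add_sq {Sig : Matrix ι ι ℂ} (hS : Sig.PosDef) (X : Matrix κ ι ℂ)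
    (v : ι → ℂ) (z : κ → ℂ) :
    star v ⬝ᵥ (Sig⁻¹ *ᵥ v) + star (z - X *ᵥ v) ⬝ᵥ (z - X *ᵥ v) =
      star z ⬝ᵥ ((X * Sig * Xᴴ + 1)⁻¹ *ᵥ z) +
      star (v - (Sig⁻¹ + Xᴴ * X)⁻¹ *ᵥ (Xᴴ *ᵥ z)) ⬝ᵥ
        ((Sig⁻¹ + Xᴴ * X) *ᵥ (v - (Sig⁻¹ + Xᴴ * X)⁻¹ *ᵥ (Xᴴ *ᵥ z))) := by
  have hQ := posDef_inv_add hS X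
  set Q := Sig⁻¹ + Xᴴ * X with hQdef
  have hu : IsUnit Q.det := (Matrix.isUnit_iff_isUnit_det _).mp hQ.isUnit
  have hSv : Sig⁻¹ *ᵥ v = Q *ᵥ v - Xᴴ *ᵥ (X *ᵥ v) := by
    rw [hQdef, Matrix.add_mulVec, Matrix.mulVec_mulVec, add_sub_cancel_right]
  have hQi : (Q⁻¹)ᴴ = Q⁻¹ := hQ.inv.isHermitian
  rw [inv_conj_add_one hS X, ← hQdef, hSv]
  simp only [Matrix.sub_mulVec, Matrix.mulVec_sub, Matrix.one_mulVec, star_sub, sub_dotProduct,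
    dotProduct_sub, star_mulVec_dotProduct', Matrix.mulVec_mulVec, Matrix.conjTranspose_mul, hQi,
    Matrix.mul_nonsing_inv _ hu, Matrix.conjTranspose_conjTranspose, ← Matrix.mul_assoc,
    Matrix.one_mul]
  rw [Matrix.mul_assoc X Q⁻¹ Q, Matrix.nonsing_inv_mul _ hu, Matrix.mul_one]
  ring

/-- Bayes' rule for the linear Gaussian model: prior times noise is marginal times posterior. Only
the posterior factor contains `h`, so the channel can be integrated out. -/
theorem cnDensity_mul_cnDensity {Sig : Matrix ι ι ℂ} (hS : Sig.PosDef) (X : Matrix κ ι ℂ)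
    (μ h : ι → ℂ) (y : κ → ℂ) :
    CFO.cnDensity μ Sig h * CFO.cnDensity 0 1 (y - X *ᵥ h) =
      CFO.cnDensity (X *ᵥ μ) (X * Sig * Xᴴ + 1) y *
        CFO.cnDensity (μ + (Sig⁻¹ + Xᴴ * X)⁻¹ *ᵥ (Xᴴ *ᵥ (y - X *ᵥ μ))) (Sig⁻¹ + Xᴴ * X)⁻¹ h := by
  have hQ := posDef_inv_add hS X
  have hu : IsUnit (Sig⁻¹ + Xᴴ * X).det := (Matrix.isUnit_iff_isUnit_det _).mp hQ.isUnit
  have key := congrArg Complex.re (quadForm_add_sq hS X (h - μ) (y - X *ᵥ μ))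
  rw [Complex.add_re, Complex.add_re] at key
  have hz : y - X *ᵥ μ - X *ᵥ (h - μ) = y - X *ᵥ h := by
    rw [Matrix.mulVec_sub]; abel
  rw [hz] at key
  have hdet : (X * Sig * Xᴴ + 1).det.re * ((Sig⁻¹ + Xᴴ * X)⁻¹).det.re = Sig.det.re := by
    have h1 := det_conj_add_one hS X
    have h2 : (Sig⁻¹ + Xᴴ * X).det * ((Sig⁻¹ + Xᴴ * X)⁻¹).det = 1 := by
      rw [← Matrix.det_mul, Matrix.mul_nonsing_inv _ hu, Matrix.det_one]
    have h3 : (X * Sig * Xᴴ + 1).det * ((Sig⁻¹ + Xᴴ * X)⁻¹).det = Sig.det := by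
      rw [h1, mul_assoc, h2, mul_one]
    rw [(posDef_conj_add_one hS X).det_eq_re, hQ.inv.det_eq_re, ← Complex.ofReal_mul] at h3
    rw [← h3, Complex.ofReal_re]
  simp only [CFO.cnDensity, det_pi_smul_re, sub_zero, inv_one, Matrix.one_mulVec,
    Matrix.det_one, Complex.one_re, ← sub_sub, Matrix.nonsing_inv_nonsing_inv _ hu]
  rw [mul_mul_mul_comm, mul_mul_mul_comm (_ : ℝ)⁻¹ _ _⁻¹ _, ← Real.exp_add, ← Real.exp_add,
    ← neg_add, ← neg_add, key, ← hdet]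
  congr 1
  rw [← mul_inv, ← mul_inv]
  congr 1
  ring

end Algebra

/-! ### Complex Gaussian measures: integrals, moments, linear images -/

section Gaussian

variable {ι κ : Type*} [Fintype ι] [DecidableEq ι] [Fintype κ] [DecidableEq κ]

theorem Complex.integral_exp_neg_norm_sq : ∫ z : ℂ, Real.exp (-‖z‖ ^ 2) = Real.pi := by
  have := Complex.integral_exp_neg_rpow (p := 2) one_le_two
  rw [div_self two_ne_zero, Real.Gamma_add_one one_ne_zero, Real.Gamma_one] at this
  simpa using this

theorem Complex.integral_norm_sq_mul_exp :
    ∫ z : ℂ, ‖z‖ ^ 2 * Real.exp (-‖z‖ ^ 2) = Real.pi := by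
  have := Complex.integral_rpow_mul_exp_neg_rpow (p := 2) (q := 2) one_le_two (by norm_num)
  norm_num at this
  simpa using this

/-- A function that is not integrable has Bochner integral 0, so the nonzero closed form already
proves integrability. -/
theorem Complex.integrable_exp_neg_mul_norm_sq {b : ℝ} (hb : 0 < b) :
    Integrable fun z : ℂ => Real.exp (-b * ‖z‖ ^ 2) := by
  refine Integrable.of_integral_ne_zero ?_
  have := Complex.integral_exp_neg_mul_rpow (p := 2) one_le_two hb
  simp only [Real.rpow_two] at this
  rw [this]
  have := Real.Gamma_pos_of_pos (s := 2 / 2 + 1) (by norm_num)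
  positivity

theorem integrable_exp_neg_mul_sum_norm_sq {b : ℝ} (hb : 0 < b) :
    Integrable fun x : ι → ℂ => Real.exp (-b * ∑ i, ‖x i‖ ^ 2) := by
  have := Integrable.fintype_prod (ι := ι) (𝕜 := ℝ) (μ := fun _ => (volume : Measure ℂ))
    (f := fun _ z => Real.exp (-b * ‖z‖ ^ 2)) fun i => Complex.integrable_exp_neg_mul_norm_sq hb
  simpa only [← Real.exp_sum, ← Finset.mul_sum] using! this

theorem integral_exp_neg_sum_norm_sq :
    ∫ x : ι → ℂ, Real.exp (-∑ i, ‖x i‖ ^ 2) = Real.pi ^ Fintype.card ι := by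
  have := integral_fintype_prod_volume_eq_pow (ι := ι) (𝕜 := ℝ)
    (fun z : ℂ => Real.exp (-‖z‖ ^ 2))
  rw [Complex.integral_exp_neg_norm_sq] at this
  simpa only [← Real.exp_sum, Finset.sum_neg_distrib] using this

theorem integral_norm_sq_mul_exp_neg (i : ι) :
    ∫ x : ι → ℂ, ‖x i‖ ^ 2 * Real.exp (-∑ j, ‖x j‖ ^ 2) = Real.pi ^ Fintype.card ι := by
  have h := integral_fintype_prod_volume_eq_prod (ι := ι) (𝕜 := ℝ)
    (fun j (z : ℂ) => (if j = i then ‖z‖ ^ 2 else 1) * Real.exp (-‖z‖ ^ 2))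
  have h1 : ∀ j : ι, ∫ z : ℂ, (if j = i then ‖z‖ ^ 2 else 1) * Real.exp (-‖z‖ ^ 2)
      = Real.pi := by
    intro j
    split_ifs
    · exact Complex.integral_norm_sq_mul_exp
    · simpa using Complex.integral_exp_neg_norm_sq
  simp only [h1, Finset.prod_const, Finset.card_univ, Finset.prod_mul_distrib,
    Finset.prod_ite_eq', Finset.mem_univ, if_true, ← Real.exp_sum, Finset.sum_neg_distrib] at h
  exact h

/-- Linear change of variables for a complex matrix. -/
theorem map_mulVec_volume {L : Matrix ι ι ℂ} (hL : IsUnit L.det) :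
    Measure.map (fun x => L *ᵥ x) (volume : Measure (ι → ℂ)) =
      ENNReal.ofReal (‖L.det‖ ^ 2)⁻¹ • volume := by
  -- The real determinant of a complex linear map is the norm from ℂ to ℝ of its complex
  -- determinant.
  have hdet : LinearMap.det ((Matrix.toLin' L).restrictScalars ℝ) = ‖L.det‖ ^ 2 := by
    rw [LinearMap.det_restrictScalars, Algebra.norm_complex_apply, LinearMap.det_toLin',
      Complex.normSq_eq_norm_sq]
  have h0 : LinearMap.det ((Matrix.toLin' L).restrictScalars ℝ) ≠ 0 := by
    rw [hdet]; simpa using hL.ne_zero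
  have := Measure.map_linearMap_addHaar_eq_smul_addHaar (volume : Measure (ι → ℂ)) h0
  rw [hdet, abs_of_nonneg (by positivity)] at this
  exact this

theorem measurableEmbedding_mulVec {L : Matrix ι ι ℂ} (hL : IsUnit L.det) :
    MeasurableEmbedding fun x : ι → ℂ => L *ᵥ x :=
  Continuous.measurableEmbedding (by fun_prop) (Matrix.mulVec_injective_of_isUnit
    ((Matrix.isUnit_iff_isUnit_det _).mpr hL))

theorem integral_comp_mulVec {F : Type*} [NormedAddCommGroup F] [NormedSpace ℝ F]
    {L : Matrix ι ι ℂ} (hL : IsUnit L.det) (g : (ι → ℂ) → F) :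
    ‖L.det‖ ^ 2 • ∫ x, g (L *ᵥ x) = ∫ x, g x := by
  rw [← (measurableEmbedding_mulVec hL).integral_map, map_mulVec_volume hL, integral_smul_measure,
    ENNReal.toReal_ofReal (by positivity), smul_smul, mul_inv_cancel₀, one_smul]
  simpa using hL.ne_zero

theorem integrable_comp_mulVec_iff {F : Type*} [NormedAddCommGroup F]
    {L : Matrix ι ι ℂ} (hL : IsUnit L.det) {g : (ι → ℂ) → F} :
    Integrable (fun x => g (L *ᵥ x)) ↔ Integrable g := by
  have h := (measurableEmbedding_mulVec hL).integrable_map_iff (μ := volume) (g := g)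
  rw [map_mulVec_volume hL, integrable_smul_measure] at h
  · exact h.symm
  · simpa using hL.ne_zero
  · simp

theorem cnDensity_add_mulVec {C L : Matrix ι ι ℂ} (hL : IsUnit L.det) (h : C = L * Lᴴ)
    (m x : ι → ℂ) : CFO.cnDensity m C (m + L *ᵥ x) =
      (Real.pi ^ Fintype.card ι)⁻¹ * (‖L.det‖ ^ 2)⁻¹ * Real.exp (-∑ i, ‖x i‖ ^ 2) := by
  rw [CFO.cnDensity, add_sub_cancel_left, quadForm_factor hL h, star_dotProduct_self_eq,
    Complex.ofReal_re, det_pi_smul_re, ← mul_inv]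
  congr 4
  rw [h, Matrix.det_mul, Matrix.det_conjTranspose]
  change (L.det * (starRingEnd ℂ) L.det).re = _
  rw [Complex.mul_conj']
  norm_cast

theorem integrable_cnDensity {C : Matrix ι ι ℂ} (hC : C.PosDef) (m : ι → ℂ) :
    Integrable (CFO.cnDensity m C) := by
  obtain ⟨L, hL, h⟩ := hC.exists_factor
  have h1 := (integrable_exp_neg_mul_sum_norm_sq (ι := ι) one_pos).const_mul
    ((Real.pi ^ Fintype.card ι)⁻¹ * (‖L.det‖ ^ 2)⁻¹)
  simp only [neg_mul, one_mul, ← cnDensity_add_mulVec hL h m] at h1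
  have h2 := (integrable_comp_mulVec_iff hL (g := fun x => CFO.cnDensity m C (m + x))).mp h1
  simpa using h2.comp_add_left (-m)

/-- Substituting `m + L x` reduces to the standard Gaussian; the Jacobian `‖L.det‖ ^ 2` cancels the
determinant in the density. -/
theorem integral_mul_cnDensity {C L : Matrix ι ι ℂ} (hL : IsUnit L.det) (h : C = L * Lᴴ)
    (m : ι → ℂ) (g : (ι → ℂ) → ℂ) :
    ∫ x, g x * (CFO.cnDensity m C x : ℂ) = ((Real.pi : ℂ) ^ Fintype.card ι)⁻¹ *
      ∫ x, g (m + L *ᵥ x) * (Real.exp (-∑ i, ‖x i‖ ^ 2) : ℂ) := by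
  rw [← integral_add_left_eq_self _ m, ← integral_comp_mulVec hL, ← integral_const_mul,
    ← integral_smul]
  congr 1; ext x
  have hd : (‖L.det‖ : ℂ) ≠ 0 := by simpa using hL.ne_zero
  rw [cnDensity_add_mulVec hL h, Complex.real_smul]
  push_cast
  field_simp

theorem integral_cnDensity {C : Matrix ι ι ℂ} (hC : C.PosDef) (m : ι → ℂ) :
    ∫ x, CFO.cnDensity m C x = 1 := by
  obtain ⟨L, hL, h⟩ := hC.exists_factor
  have h1 := integral_mul_cnDensity hL h m fun _ => 1
  simp only [one_mul] at h1
  rw [integral_complex_ofReal, integral_complex_ofReal, integral_exp_neg_sum_norm_sq] at h1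
  have hpi : (Real.pi : ℂ) ≠ 0 := by exact_mod_cast Real.pi_ne_zero
  rw [Complex.ofReal_pow, inv_mul_cancel₀ (by positivity)] at h1
  exact_mod_cast h1

theorem lintegral_cnDensity {C : Matrix ι ι ℂ} (hC : C.PosDef) (m : ι → ℂ) :
    ∫⁻ x, ENNReal.ofReal (CFO.cnDensity m C x) = 1 := by
  rw [← ofReal_integral_eq_lintegral_ofReal (integrable_cnDensity hC m)
    (ae_of_all _ fun x => (cnDensity_pos hC m x).le), integral_cnDensity hC, ENNReal.ofReal_one]

theorem continuous_cnDensity (m : ι → ℂ) (C : Matrix ι ι ℂ) : Continuous (CFO.cnDensity m C) := by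
  unfold CFO.cnDensity
  fun_prop

theorem isProbabilityMeasure_cnMeasure {C : Matrix ι ι ℂ} (hC : C.PosDef) (m : ι → ℂ) :
    IsProbabilityMeasure (CFO.cnMeasure m C) :=
  ⟨by rw [CFO.cnMeasure, withDensity_apply _ MeasurableSet.univ, Measure.restrict_univ,
    lintegral_cnDensity hC]⟩

/-- Quadratic growth covers all the moments needed; it is absorbed by `1 + t ≤ 2 exp (t / 2)`. -/
theorem integrable_mul_exp_neg {g : (ι → ℂ) → ℂ} (hg : Continuous g)
    (hle : ∀ x, ‖g x‖ ≤ 1 + ∑ i, ‖x i‖ ^ 2) :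
    Integrable fun x : ι → ℂ => g x * (Real.exp (-∑ i, ‖x i‖ ^ 2) : ℂ) := by
  refine ((integrable_exp_neg_mul_sum_norm_sq (ι := ι) (b := 1 / 2) (by norm_num)).const_mul
    2).mono' (by fun_prop) (ae_of_all _ fun x => ?_)
  rw [norm_mul, Complex.norm_real, Real.norm_of_nonneg (Real.exp_pos _).le]
  set t := ∑ i, ‖x i‖ ^ 2
  have h1 := Real.add_one_le_exp (t / 2)
  have h2 : ‖g x‖ ≤ 2 * Real.exp (t / 2) := (hle x).trans (by linarith [Real.exp_pos (t / 2)])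
  calc ‖g x‖ * Real.exp (-t) ≤ 2 * Real.exp (t / 2) * Real.exp (-t) := by gcongr
    _ = _ := by rw [mul_assoc, ← Real.exp_add]; ring_nf

theorem norm_sq_le_sum (x : ι → ℂ) (i : ι) : ‖x i‖ ^ 2 ≤ ∑ j, ‖x j‖ ^ 2 :=
  Finset.single_le_sum (f := fun j => ‖x j‖ ^ 2) (fun _ _ => by positivity) (Finset.mem_univ i)

theorem norm_le_one_add_sum (x : ι → ℂ) (i : ι) : ‖x i‖ ≤ 1 + ∑ j, ‖x j‖ ^ 2 := by
  nlinarith [norm_sq_le_sum x i, sq_nonneg (‖x i‖ - 1)]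

theorem norm_mul_norm_le_sum (x : ι → ℂ) (i j : ι) : ‖x i‖ * ‖x j‖ ≤ ∑ k, ‖x k‖ ^ 2 := by
  nlinarith [norm_sq_le_sum x i, norm_sq_le_sum x j, sq_nonneg (‖x i‖ - ‖x j‖)]

theorem integrable_coord_mul_exp (i : ι) :
    Integrable fun x : ι → ℂ => x i * (Real.exp (-∑ i, ‖x i‖ ^ 2) : ℂ) :=
  integrable_mul_exp_neg (by fun_prop) fun x => norm_le_one_add_sum x i

theorem integrable_star_coord_mul_exp (i : ι) :
    Integrable fun x : ι → ℂ => star (x i) * (Real.exp (-∑ i, ‖x i‖ ^ 2) : ℂ) :=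
  integrable_mul_exp_neg (by fun_prop) fun x => by
    rw [norm_star]; exact norm_le_one_add_sum x i

theorem integrable_star_mul_coord_mul_exp (i j : ι) :
    Integrable fun x : ι → ℂ => star (x i) * x j * (Real.exp (-∑ i, ‖x i‖ ^ 2) : ℂ) :=
  integrable_mul_exp_neg (by fun_prop) fun x => by
    rw [norm_mul, norm_star]
    exact (norm_mul_norm_le_sum x i j).trans (by linarith)

theorem integral_coord_mul_exp (i : ι) :
    ∫ x : ι → ℂ, x i * (Real.exp (-∑ i, ‖x i‖ ^ 2) : ℂ) = 0 := by
  refine self_eq_neg.mp ?_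
  rw [← integral_neg]
  conv_lhs => rw [← integral_neg_eq_self]
  simp

theorem integral_star_coord_mul_exp (i : ι) :
    ∫ x : ι → ℂ, star (x i) * (Real.exp (-∑ i, ‖x i‖ ^ 2) : ℂ) = 0 := by
  refine self_eq_neg.mp ?_
  rw [← integral_neg]
  conv_lhs => rw [← integral_neg_eq_self]
  simp

theorem integral_star_mul_coord_mul_exp (i j : ι) :
    ∫ x : ι → ℂ, star (x i) * x j * (Real.exp (-∑ i, ‖x i‖ ^ 2) : ℂ) =
      if i = j then (Real.pi : ℂ) ^ Fintype.card ι else 0 := by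
  split_ifs with hij
  · subst hij
    have h := integral_norm_sq_mul_exp_neg i
    rw [← Complex.ofReal_pow, ← h, ← integral_complex_ofReal]
    congr 1; ext x
    rw [Complex.star_def, Complex.conj_mul']
    push_cast
    rfl
  -- Flipping the sign of coordinate `i` preserves volume and weight but negates the integrand.
  · let L : Matrix ι ι ℂ := Matrix.diagonal fun k => if k = i then -1 else 1
    have hdet : L.det = -1 := by
      simp [L, Matrix.det_diagonal, Finset.prod_ite_eq']
    have h := integral_comp_mulVec (L := L) (by rw [hdet]; exact isUnit_one.neg)
      fun x : ι → ℂ => star (x i) * x j * (Real.exp (-∑ i, ‖x i‖ ^ 2) : ℂ)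
    have hnorm : ∀ (x : ι → ℂ) k, ‖(L *ᵥ x) k‖ = ‖x k‖ := by
      intro x k
      simp only [L, Matrix.mulVec_diagonal]
      split_ifs <;> simp
    simp only [hdet, hnorm, norm_neg, norm_one, one_pow, one_smul] at h
    refine self_eq_neg.mp ?_
    rw [← integral_neg]
    conv_lhs => rw [← h]
    simp [L, Matrix.mulVec_diagonal, Ne.symm hij]

theorem integrable_exp_neg_sum_norm_sq :
    Integrable fun x : ι → ℂ => (Real.exp (-∑ i, ‖x i‖ ^ 2) : ℂ) := by
  simpa using integrable_mul_exp_neg (ι := ι) (g := fun _ => 1) continuous_const fun x => by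
    simpa using Finset.sum_nonneg fun i _ => sq_nonneg ‖x i‖

/-- First moments of the complex Gaussian distribution. -/
theorem integral_star_cnDensity {C : Matrix ι ι ℂ} (hC : C.PosDef) (m : ι → ℂ) (i : ι) :
    ∫ x, star (x i) * (CFO.cnDensity m C x : ℂ) = star (m i) := by
  obtain ⟨L, hL, h⟩ := hC.exists_factor
  rw [integral_mul_cnDensity hL h]
  have hexp : (fun x : ι → ℂ => star ((m + L *ᵥ x) i) * (Real.exp (-∑ i, ‖x i‖ ^ 2) : ℂ)) =
      fun x => star (m i) * (Real.exp (-∑ i, ‖x i‖ ^ 2) : ℂ) +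
        ∑ a, star (L i a) * (star (x a) * (Real.exp (-∑ i, ‖x i‖ ^ 2) : ℂ)) := by
    ext x
    simp only [Pi.add_apply, Matrix.mulVec, dotProduct, star_add, star_sum, star_mul', add_mul,
      Finset.sum_mul, mul_assoc]
  have i2 := fun a => (integrable_star_coord_mul_exp a).const_mul (star (L i a))
  rw [hexp, integral_add (integrable_exp_neg_sum_norm_sq.const_mul _)
    (integrable_finsetSum Finset.univ fun a _ => i2 a), integral_finsetSum _ fun a _ => i2 a]
  simp only [integral_const_mul, integral_star_coord_mul_exp, mul_zero,
    Finset.sum_const_zero, add_zero]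
  rw [integral_complex_ofReal, integral_exp_neg_sum_norm_sq]
  have hpi : (Real.pi : ℂ) ≠ 0 := by exact_mod_cast Real.pi_ne_zero
  push_cast
  field_simp

/-- Second moments of the complex Gaussian distribution. -/
theorem integral_star_mul_cnDensity {C : Matrix ι ι ℂ} (hC : C.PosDef) (m : ι → ℂ) (i j : ι) :
    ∫ x, star (x i) * x j * (CFO.cnDensity m C x : ℂ) = star (C i j) + star (m i) * m j := by
  obtain ⟨L, hL, h⟩ := hC.exists_factor
  rw [integral_mul_cnDensity hL h]
  have hexp : (fun x : ι → ℂ => star ((m + L *ᵥ x) i) * (m + L *ᵥ x) j *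
      (Real.exp (-∑ i, ‖x i‖ ^ 2) : ℂ)) = fun x =>
      (star (m i) * m j * (Real.exp (-∑ i, ‖x i‖ ^ 2) : ℂ) +
      ∑ b, star (m i) * L j b * (x b * (Real.exp (-∑ i, ‖x i‖ ^ 2) : ℂ))) +
      (∑ a, star (L i a) * m j * (star (x a) * (Real.exp (-∑ i, ‖x i‖ ^ 2) : ℂ)) +
      ∑ a, ∑ b, star (L i a) * L j b *
        (star (x a) * x b * (Real.exp (-∑ i, ‖x i‖ ^ 2) : ℂ))) := by
    ext x
    simp only [Pi.add_apply, Matrix.mulVec, dotProduct, star_add, star_sum, star_mul']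
    generalize (Real.exp (-∑ i, ‖x i‖ ^ 2) : ℂ) = e
    have h1 : ∑ b, star (m i) * L j b * (x b * e) = star (m i) * (∑ b, L j b * x b) * e := by
      rw [Finset.mul_sum, Finset.sum_mul]; exact Finset.sum_congr rfl fun _ _ => by ring
    have h2 : ∑ a, star (L i a) * m j * (star (x a) * e) =
        (∑ a, star (L i a) * star (x a)) * m j * e := by
      rw [Finset.sum_mul, Finset.sum_mul]; exact Finset.sum_congr rfl fun _ _ => by ring
    have h3 : ∑ a, ∑ b, star (L i a) * L j b * (star (x a) * x b * e) =
        (∑ a, star (L i a) * star (x a)) * (∑ b, L j b * x b) * e := by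
      rw [Finset.sum_mul_sum, Finset.sum_mul]
      refine Finset.sum_congr rfl fun _ _ => ?_
      rw [Finset.sum_mul]
      exact Finset.sum_congr rfl fun _ _ => by ring
    rw [h1, h2, h3]
    ring
  have i0 := integrable_exp_neg_sum_norm_sq (ι := ι)
  have i1 := fun b => (integrable_coord_mul_exp b).const_mul (star (m i) * L j b)
  have i2 := fun a => (integrable_star_coord_mul_exp a).const_mul (star (L i a) * m j)
  have i3 := fun a b => (integrable_star_mul_coord_mul_exp a b).const_mul (star (L i a) * L j b)
  have j1 := integrable_finsetSum Finset.univ fun b _ => i1 b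
  have j2 := integrable_finsetSum Finset.univ fun a _ => i2 a
  have j3' := fun a => integrable_finsetSum Finset.univ fun b _ => i3 a b
  have j3 := integrable_finsetSum Finset.univ fun a _ => j3' a
  have j0 := i0.const_mul (star (m i) * m j)
  rw [hexp, integral_add (by exact j0.add j1) (by exact j2.add j3), integral_add j0 j1,
    integral_add j2 j3, integral_finsetSum _ fun b _ => i1 b, integral_finsetSum _ fun a _ => i2 a,
    integral_finsetSum _ fun a _ => j3' a]
  simp only [integral_finsetSum _ fun b _ => i3 _ b, integral_const_mul, integral_coord_mul_exp,
    integral_star_coord_mul_exp, integral_star_mul_coord_mul_exp, mul_zero,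
    Finset.sum_const_zero, add_zero, zero_add, mul_ite, Finset.sum_ite_eq, Finset.mem_univ,
    if_true]
  rw [integral_complex_ofReal, integral_exp_neg_sum_norm_sq, ← Finset.sum_mul]
  have hpi : (Real.pi : ℂ) ≠ 0 := by exact_mod_cast Real.pi_ne_zero
  have hCij : star (C i j) = ∑ a, star (L i a) * L j a := by
    rw [h]
    simp [Matrix.mul_apply]
  rw [hCij]
  push_cast
  field_simp
  ring

/-- The image of a complex Gaussian vector under a linear map plus independent white noise. -/
theorem map_mulVec_add_cnMeasure {Ω : Type*} [MeasurableSpace Ω] {P : Measure Ω}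
    [IsProbabilityMeasure P] {Sig : Matrix ι ι ℂ} (hS : Sig.PosDef) (μ : ι → ℂ)
    (X : Matrix κ ι ℂ) {h : Ω → ι → ℂ} {w : Ω → κ → ℂ} (hh : Measurable h) (hw : Measurable w)
    (hhlaw : P.map h = CFO.cnMeasure μ Sig) (hwlaw : P.map w = CFO.cnMeasure 0 1)
    (hind : IndepFun h w P) :
    P.map (fun ω => X *ᵥ h ω + w ω) =
      CFO.cnMeasure (X *ᵥ μ) (X * Sig * Xᴴ + 1) := by
  have hK := posDef_conj_add_one hS X
  have := isProbabilityMeasure_cnMeasure hS μ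
  have := isProbabilityMeasure_cnMeasure (ι := κ) Matrix.PosDef.one 0
  have hjoint := (indepFun_iff_map_prod_eq_prod_map_map hh.aemeasurable hw.aemeasurable).mp hind
  rw [hhlaw, hwlaw] at hjoint
  have hX : Measurable fun v : ι → ℂ => X *ᵥ v := by fun_prop
  have hg : Measurable fun q : (ι → ℂ) × (κ → ℂ) => X *ᵥ q.1 + q.2 :=
    (hX.comp measurable_fst).add measurable_snd
  refine Measure.ext_of_lintegral _ fun F hF => ?_
  have hFg : Measurable fun q : (ι → ℂ) × (κ → ℂ) => F (X *ᵥ q.1 + q.2) := hF.comp hg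
  have hd : ∀ (m : ι → ℂ) C, Measurable fun x => ENNReal.ofReal (CFO.cnDensity m C x) :=
    fun m C => (continuous_cnDensity m C).measurable.ennreal_ofReal
  have hd' : ∀ (m : κ → ℂ) C, Measurable fun x => ENNReal.ofReal (CFO.cnDensity m C x) :=
    fun m C => (continuous_cnDensity m C).measurable.ennreal_ofReal
  rw [lintegral_map hF (by fun_prop), ← lintegral_map (μ := P) (g := fun ω => (h ω, w ω))
    (f := fun q : (ι → ℂ) × (κ → ℂ) => F (X *ᵥ q.1 + q.2)) hFg (by fun_prop), hjoint,
    lintegral_prod _ hFg.aemeasurable]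
  simp only [CFO.cnMeasure]
  rw [lintegral_withDensity_eq_lintegral_mul _ (hd _ _)
    hFg.lintegral_prod_right', lintegral_withDensity_eq_lintegral_mul _ (hd' _ _) hF]
  have hinner : ∀ v : ι → ℂ, ∫⁻ x, F (X *ᵥ v + x)
      ∂(volume.withDensity fun x => ENNReal.ofReal (CFO.cnDensity (0 : κ → ℂ) 1 x)) =
      ∫⁻ y, ENNReal.ofReal (CFO.cnDensity 0 1 (y - X *ᵥ v)) * F y := by
    intro v
    have hFv : Measurable fun x => F (X *ᵥ v + x) := hF.comp (measurable_const_add _)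
    rw [lintegral_withDensity_eq_lintegral_mul _ (hd' _ _) hFv]
    refine Eq.trans ?_ (lintegral_add_left_eq_self _ (X *ᵥ v))
    simp
  have hm2 : Measurable fun q : (ι → ℂ) × (κ → ℂ) =>
      ENNReal.ofReal (CFO.cnDensity μ Sig q.1) *
      (ENNReal.ofReal (CFO.cnDensity 0 1 (q.2 - X *ᵥ q.1)) * F q.2) :=
    ((hd _ _).comp measurable_fst).mul
      (((hd' _ _).comp (measurable_snd.sub (hX.comp measurable_fst))).mul
        (hF.comp measurable_snd))
  simp only [Pi.mul_apply, hinner]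
  have hpull : ∀ v : ι → ℂ, ENNReal.ofReal (CFO.cnDensity μ Sig v) *
      ∫⁻ y, ENNReal.ofReal (CFO.cnDensity 0 1 (y - X *ᵥ v)) * F y =
      ∫⁻ y, ENNReal.ofReal (CFO.cnDensity μ Sig v) *
        (ENNReal.ofReal (CFO.cnDensity 0 1 (y - X *ᵥ v)) * F y) := fun v =>
    (lintegral_const_mul _ (((hd' _ _).comp (measurable_id.sub_const _)).mul hF)).symm
  simp only [hpull]
  rw [lintegral_lintegral_swap hm2.aemeasurable]
  congr 1; ext y
  -- With the integrals exchanged, the channel variable occurs only in a posterior density, whose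
  -- integral is 1.
  have hsq : ∀ v, ENNReal.ofReal (CFO.cnDensity μ Sig v) *
      (ENNReal.ofReal (CFO.cnDensity 0 1 (y - X *ᵥ v)) * F y) =
      ENNReal.ofReal (CFO.cnDensity (X *ᵥ μ) (X * Sig * Xᴴ + 1) y) * F y *
        ENNReal.ofReal (CFO.cnDensity (μ + (Sig⁻¹ + Xᴴ * X)⁻¹ *ᵥ (Xᴴ *ᵥ (y - X *ᵥ μ)))
          (Sig⁻¹ + Xᴴ * X)⁻¹ v) := by
    intro v
    rw [← mul_assoc, ← ENNReal.ofReal_mul (cnDensity_pos hS _ _).le, cnDensity_mul_cnDensity hS,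
      ENNReal.ofReal_mul (cnDensity_pos hK _ _).le]
    ring
  simp only [hsq]
  rw [lintegral_const_mul _ (hd _ _), lintegral_cnDensity (posDef_inv_add hS X).inv, mul_one]

end Gaussian

/-! ### Trigonometric polynomials in the offset -/

section Trig

variable {κ : Type*} [Fintype κ]

/-- The `d`-th derivative in `u` of
`Re (∑ conj (y i) G i j y j e(u (τ i - τ j)) + 2 ∑ conj (y i) v i e(u τ i))`, `e(x) = exp (2πix)`. -/
noncomputable def trigForm (τ : κ → ℝ) (G : Matrix κ κ ℂ) (v : κ → ℂ) (d : ℕ) (y : κ → ℂ)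
    (u : ℝ) : ℝ :=
  (∑ i, ∑ j, (2 * Real.pi * Complex.I * (τ i - τ j)) ^ d *
      Complex.exp (2 * Real.pi * Complex.I * (τ i - τ j) * u) * (star (y i) * G i j * y j) +
    2 * ∑ i, (2 * Real.pi * Complex.I * τ i) ^ d *
      Complex.exp (2 * Real.pi * Complex.I * τ i * u) * (star (y i) * v i)).re

theorem hasDerivAt_exp_mul (a : ℂ) (u : ℝ) (d : ℕ) (b : ℂ) :
    HasDerivAt (fun u : ℝ => a ^ d * Complex.exp (a * u) * b)
      (a ^ (d + 1) * Complex.exp (a * u) * b) u := by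
  have h1 : HasDerivAt (fun u : ℝ => a * (u : ℂ)) a u := by
    simpa using (Complex.ofRealCLM.hasDerivAt (x := u)).const_mul a
  refine ((h1.cexp.const_mul (a ^ d)).mul_const b).congr_deriv ?_
  ring

theorem hasDerivAt_trigForm (τ : κ → ℝ) (G : Matrix κ κ ℂ) (v : κ → ℂ) (d : ℕ) (y : κ → ℂ)
    (u : ℝ) : HasDerivAt (trigForm τ G v d y) (trigForm τ G v (d + 1) y u) u := by
  refine Complex.reCLM.hasFDerivAt.comp_hasDerivAt u (HasDerivAt.add ?_ (HasDerivAt.const_mul _ ?_))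
  · exact HasDerivAt.fun_sum fun i _ => HasDerivAt.fun_sum fun j _ => hasDerivAt_exp_mul _ _ _ _
  · exact HasDerivAt.fun_sum fun i _ => hasDerivAt_exp_mul _ _ _ _

theorem continuous_trigForm (τ : κ → ℝ) (G : Matrix κ κ ℂ) (v : κ → ℂ) (d : ℕ) :
    Continuous fun x : ℝ × (κ → ℂ) => trigForm τ G v d x.2 x.1 := by
  unfold trigForm
  fun_prop

theorem contDiff_trigForm (τ : κ → ℝ) (G : Matrix κ κ ℂ) (v : κ → ℂ) (d : ℕ) (y : κ → ℂ) (k : ℕ) :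
    ContDiff ℝ k (trigForm τ G v d y) := by
  induction k generalizing d with
  | zero =>
    exact contDiff_zero.mpr
      (continuous_iff_continuousAt.mpr fun u => (hasDerivAt_trigForm τ G v d y u).continuousAt)
  | succ k ih =>
    have hd : deriv (trigForm τ G v d y) = trigForm τ G v (d + 1) y :=
      funext fun u => (hasDerivAt_trigForm τ G v d y u).deriv
    push_cast
    rw [contDiff_succ_iff_deriv, hd]
    exact ⟨fun u => (hasDerivAt_trigForm τ G v d y u).differentiableAt, by simp, ih _⟩

theorem norm_exp_two_pi_I_mul (a u : ℝ) :
    ‖Complex.exp (2 * Real.pi * Complex.I * a * u)‖ = 1 := by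
  rw [show (2 * Real.pi * Complex.I * a * u : ℂ) = ((2 * Real.pi * a * u : ℝ) : ℂ) * Complex.I by
    push_cast; ring]
  exact Complex.norm_exp_ofReal_mul_I _

/-- The exponentials have modulus 1, so the bound is uniform in `u`, and the dependence on `y` is at
most quadratic. -/
theorem exists_abs_trigForm_le [DecidableEq κ] (τ : κ → ℝ) (G : Matrix κ κ ℂ) (v : κ → ℂ) (d : ℕ) :
    ∃ K : ℝ, 0 ≤ K ∧ ∀ y u, |trigForm τ G v d y u| ≤ K * (1 + ∑ i, ‖y i‖ ^ 2) := by
  refine ⟨∑ i, ∑ j, ‖(2 * Real.pi * Complex.I * (τ i - τ j) : ℂ) ^ d‖ * ‖G i j‖ +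
    2 * ∑ i, ‖(2 * Real.pi * Complex.I * τ i : ℂ) ^ d‖ * ‖v i‖, by positivity, fun y u => ?_⟩
  refine (Complex.abs_re_le_norm _).trans ((norm_add_le _ _).trans ?_)
  rw [add_mul]
  refine add_le_add ?_ ?_
  · simp only [Finset.sum_mul]
    refine norm_sum_le_of_le _ fun i _ => norm_sum_le_of_le _ fun j _ => ?_
    have := norm_exp_two_pi_I_mul (τ i - τ j) u
    push_cast at this
    have h1 : ‖y i‖ * ‖y j‖ ≤ 1 + ∑ k, ‖y k‖ ^ 2 :=
      (norm_mul_norm_le_sum y i j).trans (le_add_of_nonneg_left zero_le_one)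
    rw [norm_mul, norm_mul, this, norm_mul, norm_mul, norm_star]
    refine le_trans (le_of_eq ?_) (mul_le_mul_of_nonneg_left h1 (by positivity))
    ring
  · rw [norm_mul, Complex.norm_ofNat, mul_assoc (2 : ℝ), Finset.sum_mul]
    refine mul_le_mul_of_nonneg_left (norm_sum_le_of_le _ fun i _ => ?_) zero_le_two
    rw [norm_mul, norm_mul, norm_exp_two_pi_I_mul, norm_mul, norm_star]
    refine le_trans (le_of_eq ?_)
      (mul_le_mul_of_nonneg_left (norm_le_one_add_sum y i) (by positivity))
    ring

end Trig

/-! ### The likelihood as a function of the offset -/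

noncomputable section

namespace CFO

variable {n lt lr : ℕ}

/-- The phase of the sample with index `k` under the offset `f`. -/
def phase (f : ℝ) (k : ℕ) : ℂ := Complex.exp (2 * Real.pi * Complex.I * f * (k : ℂ))

theorem phase_eq (f : ℝ) (k : ℕ) :
    phase f k = Complex.exp (2 * Real.pi * Complex.I * ((k : ℝ) : ℂ) * f) := by
  rw [phase]; congr 1; push_cast; ring

theorem norm_phase (f : ℝ) (k : ℕ) : ‖phase f k‖ = 1 := by
  rw [phase_eq]; exact norm_exp_two_pi_I_mul k f

theorem star_phase (f : ℝ) (k : ℕ) :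
    star (phase f k) = Complex.exp (-(2 * Real.pi * Complex.I * ((k : ℝ) : ℂ) * f)) := by
  rw [phase_eq, Complex.star_def, ← Complex.exp_conj]
  congr 1
  simp [Complex.conj_ofNat]

theorem star_phase_mul_phase (f : ℝ) (k : ℕ) : star (phase f k) * phase f k = 1 := by
  rw [star_phase, phase_eq, ← Complex.exp_add, neg_add_cancel, Complex.exp_zero]

theorem phase_mul_star_phase (f : ℝ) (k l : ℕ) : phase f k * star (phase f l) =
    Complex.exp (2 * Real.pi * Complex.I * (((k : ℝ) : ℂ) - ((l : ℝ) : ℂ)) * f) := by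
  rw [star_phase, phase_eq, ← Complex.exp_add]
  congr 1
  ring

/-- The diagonal phase rotation of the whole received signal. -/
def rot (n lr : ℕ) (f : ℝ) : Matrix (Fin lr × Fin n) (Fin lr × Fin n) ℂ :=
  Matrix.diagonal fun i => phase f i.2

theorem bigX_apply (S : Matrix (Fin n) (Fin lt) ℂ) (f : ℝ) (i : Fin lr × Fin n)
    (j : Fin lr × Fin lt) :
    bigX lr S f i j = phase f i.2 * (if i.1 = j.1 then S i.2 j.2 else 0) := by
  rw [bigX, Matrix.kroneckerMap_apply, phaseMatrix, Matrix.diagonal_mul, Matrix.one_apply]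
  split_ifs <;> simp [phase]

theorem phase_zero (k : ℕ) : phase 0 k = 1 := by simp [phase]

/-- The offset enters only through a unitary factor on the left; the cancellations of `f` below rest
on this. -/
theorem bigX_eq_rot_mul (S : Matrix (Fin n) (Fin lt) ℂ) (f : ℝ) :
    bigX lr S f = rot n lr f * bigX lr S 0 := by
  ext i j
  rw [rot, Matrix.diagonal_mul, bigX_apply, bigX_apply, phase_zero, one_mul]

theorem rot_conjTranspose_mul_self (f : ℝ) : (rot n lr f)ᴴ * rot n lr f = 1 := by
  rw [rot, Matrix.diagonal_conjTranspose, Matrix.diagonal_mul_diagonal, ← Matrix.diagonal_one]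
  congr 1; ext i
  exact star_phase_mul_phase f _

theorem rot_mul_conjTranspose_self (f : ℝ) : rot n lr f * (rot n lr f)ᴴ = 1 :=
  mul_eq_one_comm.mp (rot_conjTranspose_mul_self f)

/-- The rotation cancels, leaving `lr` copies of the pilot's orthogonality relation. Hence neither
`matA` nor the covariance determinant depends on the offset. -/
theorem bigX_conjTranspose_mul_self {S : Matrix (Fin n) (Fin lt) ℂ} {ρ : ℝ}
    (hS : Sᴴ * S = ((n * ρ / lt : ℝ) : ℂ) • (1 : Matrix (Fin lt) (Fin lt) ℂ)) (f : ℝ) :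
    (bigX lr S f)ᴴ * bigX lr S f =
      ((n * ρ / lt : ℝ) : ℂ) • (1 : Matrix (Fin lr × Fin lt) (Fin lr × Fin lt) ℂ) := by
  rw [bigX_eq_rot_mul, Matrix.conjTranspose_mul, Matrix.mul_assoc,
    ← Matrix.mul_assoc _ (rot n lr f), rot_conjTranspose_mul_self, Matrix.one_mul]
  have h0 : phaseMatrix n 0 = 1 := by
    rw [phaseMatrix, ← Matrix.diagonal_one]; simp
  rw [bigX, h0, Matrix.one_mul, Matrix.conjTranspose_kronecker, ← Matrix.mul_kronecker_mul, hS,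
    Matrix.kronecker_smul, Matrix.conjTranspose_one, Matrix.one_mul, Matrix.one_kronecker_one]

/-- The matrix of the quadratic part of the log-likelihood. -/
def quadG (S : Matrix (Fin n) (Fin lt) ℂ) (ρ : ℝ)
    (Sig : Matrix (Fin lr × Fin lt) (Fin lr × Fin lt) ℂ) :
    Matrix (Fin lr × Fin n) (Fin lr × Fin n) ℂ :=
  bigX lr S 0 * matA n ρ Sig * (bigX lr S 0)ᴴ

/-- The vector of the linear part of the log-likelihood. -/
def linV (S : Matrix (Fin n) (Fin lt) ℂ) (ρ : ℝ) (μ : Fin lr × Fin lt → ℂ)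
    (Sig : Matrix (Fin lr × Fin lt) (Fin lr × Fin lt) ℂ) : Fin lr × Fin n → ℂ :=
  bigX lr S 0 *ᵥ vecB n ρ μ Sig

theorem cov_inv {S : Matrix (Fin n) (Fin lt) ℂ} {ρ : ℝ}
    (hS : Sᴴ * S = ((n * ρ / lt : ℝ) : ℂ) • (1 : Matrix (Fin lt) (Fin lt) ℂ))
    {Sig : Matrix (Fin lr × Fin lt) (Fin lr × Fin lt) ℂ} (hSig : Sig.PosDef) (f : ℝ) :
    (bigX lr S f * Sig * (bigX lr S f)ᴴ + 1)⁻¹ =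
    1 - bigX lr S f * matA n ρ Sig * (bigX lr S f)ᴴ := by
  rw [inv_conj_add_one hSig, bigX_conjTranspose_mul_self hS, matA]

theorem cov_inv_eq_rot {S : Matrix (Fin n) (Fin lt) ℂ} {ρ : ℝ}
    (hS : Sᴴ * S = ((n * ρ / lt : ℝ) : ℂ) • (1 : Matrix (Fin lt) (Fin lt) ℂ))
    {Sig : Matrix (Fin lr × Fin lt) (Fin lr × Fin lt) ℂ} (hSig : Sig.PosDef) (f : ℝ) :
    (bigX lr S f * Sig * (bigX lr S f)ᴴ + 1)⁻¹ =
    rot n lr f * (bigX lr S 0 * Sig * (bigX lr S 0)ᴴ + 1)⁻¹ * (rot n lr f)ᴴ := by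
  rw [cov_inv hS hSig, cov_inv hS hSig, bigX_eq_rot_mul S f, Matrix.mul_sub, Matrix.sub_mul,
    Matrix.mul_one, rot_mul_conjTranspose_self]
  simp only [Matrix.conjTranspose_mul, Matrix.mul_assoc]

/-- This is the origin of `vecB`: if `Xᴴ X = c`, then `(1 - X A Xᴴ) X = X (1 - c A)`. -/
theorem cov_inv_mulVec_mean {S : Matrix (Fin n) (Fin lt) ℂ} {ρ : ℝ}
    (hS : Sᴴ * S = ((n * ρ / lt : ℝ) : ℂ) • (1 : Matrix (Fin lt) (Fin lt) ℂ))
    {Sig : Matrix (Fin lr × Fin lt) (Fin lr × Fin lt) ℂ} (hSig : Sig.PosDef)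
    (μ : Fin lr × Fin lt → ℂ) (f : ℝ) :
    (bigX lr S f * Sig * (bigX lr S f)ᴴ + 1)⁻¹ *ᵥ (bigX lr S f *ᵥ μ) =
      bigX lr S f *ᵥ vecB n ρ μ Sig := by
  rw [cov_inv hS hSig, Matrix.mulVec_mulVec, Matrix.sub_mul, Matrix.one_mul, Matrix.mul_assoc,
    bigX_conjTranspose_mul_self hS, vecB, Matrix.mulVec_mulVec, Matrix.mul_sub, Matrix.mul_one,
    Matrix.mul_smul, Matrix.mul_smul, Matrix.mul_one]

/-- The time index of a received sample. -/
def time (i : Fin lr × Fin n) : ℝ := ((i.2 : ℕ) : ℝ)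

theorem quadG_rot (S : Matrix (Fin n) (Fin lt) ℂ) (ρ : ℝ)
    (Sig : Matrix (Fin lr × Fin lt) (Fin lr × Fin lt) ℂ) (f : ℝ) :
    bigX lr S f * matA n ρ Sig * (bigX lr S f)ᴴ =
      rot n lr f * quadG S ρ Sig * (rot n lr f)ᴴ := by
  rw [bigX_eq_rot_mul S f, quadG]
  simp only [Matrix.conjTranspose_mul, Matrix.mul_assoc]

theorem rot_mul_mul_apply (f : ℝ) (G : Matrix (Fin lr × Fin n) (Fin lr × Fin n) ℂ)
    (i j : Fin lr × Fin n) : (rot n lr f * G * (rot n lr f)ᴴ) i j =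
      phase f i.2 * star (phase f j.2) * G i j := by
  rw [rot, Matrix.diagonal_conjTranspose, Matrix.mul_diagonal, Matrix.diagonal_mul, Pi.star_apply]
  ring

theorem trigForm_zero_eq (S : Matrix (Fin n) (Fin lt) ℂ) (ρ : ℝ)
    (μ : Fin lr × Fin lt → ℂ) (Sig : Matrix (Fin lr × Fin lt) (Fin lr × Fin lt) ℂ)
    (y : Fin lr × Fin n → ℂ) (f : ℝ) :
    trigForm time (quadG S ρ Sig) (linV S ρ μ Sig) 0 y f =
      (star y ⬝ᵥ ((bigX lr S f * matA n ρ Sig * (bigX lr S f)ᴴ) *ᵥ y)).re +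
        2 * (star y ⬝ᵥ (bigX lr S f *ᵥ vecB n ρ μ Sig)).re := by
  rw [trigForm, Complex.add_re, ← Complex.re_ofReal_mul]
  congr 2
  · simp only [quadG_rot, dotProduct, Matrix.mulVec, rot_mul_mul_apply, phase_mul_star_phase,
      Finset.mul_sum, pow_zero, one_mul, time, Pi.star_apply]
    exact Finset.sum_congr rfl fun i _ => Finset.sum_congr rfl fun j _ => by ring
  · rw [bigX_eq_rot_mul S f, ← Matrix.mulVec_mulVec, ← linV, rot]
    simp only [dotProduct, Matrix.mulVec_diagonal, pow_zero, one_mul, time, Pi.star_apply,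
      phase_eq, Complex.ofReal_ofNat]
    congr 1
    exact Finset.sum_congr rfl fun i _ => by ring

/-- Expand the form: the cross terms are conjugate and give twice a real part, and the mean-mean
term is free of `f`. The offset survives only in `trigForm`. -/
theorem re_quadForm_cov {S : Matrix (Fin n) (Fin lt) ℂ} {ρ : ℝ}
    (hS : Sᴴ * S = ((n * ρ / lt : ℝ) : ℂ) • (1 : Matrix (Fin lt) (Fin lt) ℂ))
    {Sig : Matrix (Fin lr × Fin lt) (Fin lr × Fin lt) ℂ} (hSig : Sig.PosDef)
    (μ : Fin lr × Fin lt → ℂ) (y : Fin lr × Fin n → ℂ) (f : ℝ) :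
    (star (y - bigX lr S f *ᵥ μ) ⬝ᵥ ((bigX lr S f * Sig * (bigX lr S f)ᴴ + 1)⁻¹ *ᵥ
      (y - bigX lr S f *ᵥ μ))).re =
      ∑ i, ‖y i‖ ^ 2 - trigForm time (quadG S ρ Sig) (linV S ρ μ Sig) 0 y f +
        (star μ ⬝ᵥ (((n * ρ / lt : ℝ) : ℂ) • vecB n ρ μ Sig)).re := by
  have hK := (posDef_conj_add_one hSig (bigX lr S f)).inv.isHermitian
  have h1 : star (bigX lr S f *ᵥ μ) ⬝ᵥ
      ((bigX lr S f * Sig * (bigX lr S f)ᴴ + 1)⁻¹ *ᵥ y) =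
      star (bigX lr S f *ᵥ vecB n ρ μ Sig) ⬝ᵥ y := by
    rw [← cov_inv_mulVec_mean hS hSig, star_mulVec_dotProduct' (_⁻¹), hK]
  have h2 : star (bigX lr S f *ᵥ vecB n ρ μ Sig) ⬝ᵥ y =
      star (star y ⬝ᵥ (bigX lr S f *ᵥ vecB n ρ μ Sig)) := by
    rw [Matrix.star_dotProduct]
  have h3 : star (bigX lr S f *ᵥ μ) ⬝ᵥ (bigX lr S f *ᵥ vecB n ρ μ Sig) =
      star μ ⬝ᵥ (((n * ρ / lt : ℝ) : ℂ) • vecB n ρ μ Sig) := by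
    rw [star_mulVec_dotProduct', Matrix.mulVec_mulVec, bigX_conjTranspose_mul_self hS,
      Matrix.smul_mulVec, Matrix.one_mulVec]
  have h4 : star y ⬝ᵥ ((bigX lr S f * Sig * (bigX lr S f)ᴴ + 1)⁻¹ *ᵥ y) =
      ((∑ i, ‖y i‖ ^ 2 : ℝ) : ℂ) -
        star y ⬝ᵥ ((bigX lr S f * matA n ρ Sig * (bigX lr S f)ᴴ) *ᵥ y) := by
    rw [cov_inv hS hSig, Matrix.sub_mulVec, Matrix.one_mulVec, dotProduct_sub,
      star_dotProduct_self_eq]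
  rw [Matrix.mulVec_sub, star_sub, sub_dotProduct, dotProduct_sub, dotProduct_sub, h1,
    cov_inv_mulVec_mean hS hSig, h2, h3, h4, trigForm_zero_eq]
  simp only [Complex.sub_re, Complex.ofReal_re, Complex.star_def, Complex.conj_re]
  ring

theorem det_cov {S : Matrix (Fin n) (Fin lt) ℂ} {ρ : ℝ}
    (hS : Sᴴ * S = ((n * ρ / lt : ℝ) : ℂ) • (1 : Matrix (Fin lt) (Fin lt) ℂ))
    {Sig : Matrix (Fin lr × Fin lt) (Fin lr × Fin lt) ℂ} (hSig : Sig.PosDef) (f : ℝ) :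
    (bigX lr S f * Sig * (bigX lr S f)ᴴ + 1).det =
      (bigX lr S 0 * Sig * (bigX lr S 0)ᴴ + 1).det := by
  rw [det_conj_add_one hSig, det_conj_add_one hSig, bigX_conjTranspose_mul_self hS,
    bigX_conjTranspose_mul_self hS]

theorem exists_likelihood_eq {S : Matrix (Fin n) (Fin lt) ℂ} {ρ : ℝ}
    (hS : Sᴴ * S = ((n * ρ / lt : ℝ) : ℂ) • (1 : Matrix (Fin lt) (Fin lt) ℂ))
    {Sig : Matrix (Fin lr × Fin lt) (Fin lr × Fin lt) ℂ} (hSig : Sig.PosDef)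
    (μ : Fin lr × Fin lt → ℂ) : ∃ c : ℝ, 0 < c ∧ ∀ y f, likelihood S μ Sig y f =
      c * Real.exp (-∑ i, ‖y i‖ ^ 2) *
        Real.exp (trigForm time (quadG S ρ Sig) (linV S ρ μ Sig) 0 y f) := by
  refine ⟨(((Real.pi : ℂ) • (bigX lr S 0 * Sig * (bigX lr S 0)ᴴ + 1)).det.re)⁻¹ *
    Real.exp (-(star μ ⬝ᵥ (((n * ρ / lt : ℝ) : ℂ) • vecB n ρ μ Sig)).re),
    mul_pos (inv_pos.mpr (det_pi_smul_re_pos (posDef_conj_add_one hSig _))) (Real.exp_pos _),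
    fun y f => ?_⟩
  rw [likelihood, cnDensity, re_quadForm_cov hS hSig, det_pi_smul_re, det_cov hS hSig,
    ← det_pi_smul_re, mul_assoc, mul_assoc, ← Real.exp_add, ← Real.exp_add]
  congr 2
  ring

theorem likelihood_pos (S : Matrix (Fin n) (Fin lt) ℂ)
    {Sig : Matrix (Fin lr × Fin lt) (Fin lr × Fin lt) ℂ} (hSig : Sig.PosDef)
    (μ : Fin lr × Fin lt → ℂ) (y : Fin lr × Fin n → ℂ) (f : ℝ) :
    0 < likelihood S μ Sig y f :=
  cnDensity_pos (posDef_conj_add_one hSig _) _ _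

theorem contDiff_likelihood {S : Matrix (Fin n) (Fin lt) ℂ} {ρ : ℝ}
    (hS : Sᴴ * S = ((n * ρ / lt : ℝ) : ℂ) • (1 : Matrix (Fin lt) (Fin lt) ℂ))
    {Sig : Matrix (Fin lr × Fin lt) (Fin lr × Fin lt) ℂ} (hSig : Sig.PosDef)
    (μ : Fin lr × Fin lt → ℂ) (y : Fin lr × Fin n → ℂ) :
    ContDiff ℝ 2 fun f => likelihood S μ Sig y f := by
  obtain ⟨c, -, hc⟩ := exists_likelihood_eq hS hSig μ
  simp only [hc]
  exact contDiff_const.mul (contDiff_trigForm _ _ _ _ _ 2).exp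

/-- The form at offset `f` is the form at `0` after undoing the rotation, which preserves moduli, so
one coercivity constant serves all offsets. -/
theorem exists_likelihood_le {S : Matrix (Fin n) (Fin lt) ℂ} {ρ : ℝ}
    (hS : Sᴴ * S = ((n * ρ / lt : ℝ) : ℂ) • (1 : Matrix (Fin lt) (Fin lt) ℂ))
    {Sig : Matrix (Fin lr × Fin lt) (Fin lr × Fin lt) ℂ} (hSig : Sig.PosDef)
    (μ : Fin lr × Fin lt → ℂ) : ∃ M lam : ℝ, 0 < lam ∧ ∀ y f, likelihood S μ Sig y f ≤
      M * Real.exp (-lam * (1 + ∑ i, ‖y i‖ ^ 2)) := by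
  obtain ⟨c, hc, hq⟩ := (posDef_conj_add_one hSig (bigX lr S 0)).exists_quadForm_ge
  set d := (((Real.pi : ℂ) • (bigX lr S 0 * Sig * (bigX lr S 0)ᴴ + 1)).det.re)⁻¹
  have hd : 0 < d := inv_pos.mpr (det_pi_smul_re_pos (posDef_conj_add_one hSig _))
  set m : ℝ := ∑ i, ‖(bigX lr S 0 *ᵥ μ) i‖ ^ 2
  -- The constants come from `‖a - b‖² ≥ ‖a‖² / 2 - ‖b‖²` in each coordinate; the extra `1 / 2`
  -- compensates the `1` in `1 + ∑ i, ‖y i‖ ^ 2`.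
  refine ⟨d * Real.exp (c * (m + 1 / 2)), c / 2, by positivity, fun y f => ?_⟩
  rw [likelihood, cnDensity, det_pi_smul_re, det_cov hS hSig, ← det_pi_smul_re, mul_assoc,
    ← Real.exp_add]
  refine mul_le_mul_of_nonneg_left (Real.exp_le_exp.mpr ?_) hd.le
  have h1 := hq ((rot n lr f)ᴴ *ᵥ (y - bigX lr S f *ᵥ μ))
  rw [star_mulVec_dotProduct', Matrix.conjTranspose_conjTranspose, Matrix.mulVec_mulVec,
    Matrix.mulVec_mulVec, ← cov_inv_eq_rot hS hSig] at h1
  have h2 : ∀ i, ‖y i‖ ^ 2 / 2 - ‖(bigX lr S 0 *ᵥ μ) i‖ ^ 2 ≤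
      ‖((rot n lr f)ᴴ *ᵥ (y - bigX lr S f *ᵥ μ)) i‖ ^ 2 := by
    intro i
    rw [rot, Matrix.diagonal_conjTranspose, Matrix.mulVec_diagonal, norm_mul, Pi.star_apply,
      norm_star, norm_phase, one_mul, Pi.sub_apply]
    have h3 : ‖(bigX lr S f *ᵥ μ) i‖ = ‖(bigX lr S 0 *ᵥ μ) i‖ := by
      rw [bigX_eq_rot_mul S f, ← Matrix.mulVec_mulVec, rot, Matrix.mulVec_diagonal, norm_mul,
        norm_phase, one_mul]
    have h4 := norm_sub_norm_le (y i) ((bigX lr S f *ᵥ μ) i)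
    rw [h3] at h4
    nlinarith [norm_nonneg (y i - (bigX lr S f *ᵥ μ) i), norm_nonneg (y i),
      norm_nonneg ((bigX lr S 0 *ᵥ μ) i),
      sq_nonneg (‖y i - (bigX lr S f *ᵥ μ) i‖ - ‖(bigX lr S 0 *ᵥ μ) i‖)]
  have h5 := Finset.sum_le_sum fun i (_ : i ∈ Finset.univ) => h2 i
  rw [Finset.sum_sub_distrib, ← Finset.sum_div] at h5
  have h6 := (mul_le_mul_of_nonneg_left h5 hc.le).trans h1
  linarith

/-- The likelihood family is regular. -/
theorem exists_regularFamily {S : Matrix (Fin n) (Fin lt) ℂ} {ρ : ℝ}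
    (hS : Sᴴ * S = ((n * ρ / lt : ℝ) : ℂ) • (1 : Matrix (Fin lt) (Fin lt) ℂ))
    {Sig : Matrix (Fin lr × Fin lt) (Fin lr × Fin lt) ℂ} (hSig : Sig.PosDef)
    (μ : Fin lr × Fin lt → ℂ) : ∃ C M lam : ℝ,
      RegularFamily (volume : Measure (Fin lr × Fin n → ℂ)) (likelihood S μ Sig)
        (trigForm time (quadG S ρ Sig) (linV S ρ μ Sig) 1)
        (trigForm time (quadG S ρ Sig) (linV S ρ μ Sig) 2)
        (fun y => 1 + ∑ i, ‖y i‖ ^ 2) C M lam := by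
  obtain ⟨c, -, hc⟩ := exists_likelihood_eq hS hSig μ
  obtain ⟨M, lam, hlam, hM⟩ := exists_likelihood_le hS hSig μ
  obtain ⟨K₁, hK₁, h1⟩ := exists_abs_trigForm_le time (quadG S ρ Sig) (linV S ρ μ Sig) 1
  obtain ⟨K₂, hK₂, h2⟩ := exists_abs_trigForm_le time (quadG S ρ Sig) (linV S ρ μ Sig) 2
  have hN : ∀ y : Fin lr × Fin n → ℂ, 1 ≤ 1 + ∑ i, ‖y i‖ ^ 2 := fun y =>
    le_add_of_nonneg_right (by positivity)
  -- One constant has to bound both the score and its derivative; the `1` makes it positive.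
  refine ⟨K₁ + K₂ + 1, M, lam,
    { pos := fun y u => likelihood_pos S hSig μ y u
      one_le := hN
      measN := by fun_prop
      meas_p := ?_
      meas_s := (continuous_trigForm _ _ _ _).measurable
      meas_s' := (continuous_trigForm _ _ _ _).measurable
      deriv_p := fun y u => ?_
      deriv_s := fun y u => hasDerivAt_trigForm _ _ _ _ _ _
      C_pos := by positivity
      bound_s := fun y u => (h1 y u).trans ?_
      bound_s' := fun y u => (h2 y u).trans ?_
      lam_pos := hlam
      bound_p := hM
      int_exp := fun ε hε => ?_
      mass := fun u => integral_cnDensity (posDef_conj_add_one hSig _) _ }⟩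
  · simp only [hc]
    exact ((by fun_prop : Continuous fun x : ℝ × (Fin lr × Fin n → ℂ) =>
      c * Real.exp (-∑ i, ‖x.2 i‖ ^ 2)).mul (continuous_trigForm _ _ _ _).rexp).measurable
  · rw [hc, (funext fun f => hc y f : likelihood S μ Sig y = _)]
    refine ((hasDerivAt_trigForm _ _ _ _ _ _).exp.const_mul _).congr_deriv ?_
    ring
  · have := hN y
    gcongr
    linarith
  · have := hN y
    gcongr
    linarith
  · simp only [mul_add, Real.exp_add]
    exact (integrable_exp_neg_mul_sum_norm_sq hε).const_mul _

theorem deriv_log_likelihood {S : Matrix (Fin n) (Fin lt) ℂ} {ρ : ℝ}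
    (hS : Sᴴ * S = ((n * ρ / lt : ℝ) : ℂ) • (1 : Matrix (Fin lt) (Fin lt) ℂ))
    {Sig : Matrix (Fin lr × Fin lt) (Fin lr × Fin lt) ℂ} (hSig : Sig.PosDef)
    (μ : Fin lr × Fin lt → ℂ) (y : Fin lr × Fin n → ℂ) (f : ℝ) :
    HasDerivAt (fun u => Real.log (likelihood S μ Sig y u))
      (trigForm time (quadG S ρ Sig) (linV S ρ μ Sig) 1 y f) f := by
  obtain ⟨C, M, lam, R⟩ := exists_regularFamily hS hSig μ
  refine ((R.deriv_p y f).log (R.pos y f).ne').congr_deriv ?_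
  rw [mul_div_cancel_left₀ _ (R.pos y f).ne']

theorem condLogD2_eq {S : Matrix (Fin n) (Fin lt) ℂ} {ρ : ℝ}
    (hS : Sᴴ * S = ((n * ρ / lt : ℝ) : ℂ) • (1 : Matrix (Fin lt) (Fin lt) ℂ))
    {Sig : Matrix (Fin lr × Fin lt) (Fin lr × Fin lt) ℂ} (hSig : Sig.PosDef)
    (μ : Fin lr × Fin lt → ℂ) (y : Fin lr × Fin n → ℂ) (f : ℝ) :
    condLogD2 S μ Sig y f = trigForm time (quadG S ρ Sig) (linV S ρ μ Sig) 2 y f := by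
  rw [condLogD2, iteratedDeriv_succ, iteratedDeriv_one,
    funext fun u => (deriv_log_likelihood hS hSig μ y u).deriv]
  exact (hasDerivAt_trigForm _ _ _ _ _ _).deriv

theorem jointLogD2_eq {S : Matrix (Fin n) (Fin lt) ℂ} {ρ : ℝ}
    (hS : Sᴴ * S = ((n * ρ / lt : ℝ) : ℂ) • (1 : Matrix (Fin lt) (Fin lt) ℂ))
    {Sig : Matrix (Fin lr × Fin lt) (Fin lr × Fin lt) ℂ} (hSig : Sig.PosDef)
    (μ : Fin lr × Fin lt → ℂ) (μf : ℝ) {vf : ℝ≥0} (hvf : vf ≠ 0)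
    (y : Fin lr × Fin n → ℂ) (f : ℝ) :
    jointLogD2 S μ Sig μf vf y f =
      trigForm time (quadG S ρ Sig) (linV S ρ μ Sig) 2 y f - (vf : ℝ)⁻¹ := by
  have G := RegularFamily.regularPrior_gaussian μf hvf
  have h1 : ∀ u, HasDerivAt (fun u => Real.log (likelihood S μ Sig y u * gaussianPDFReal μf vf u))
      (trigForm time (quadG S ρ Sig) (linV S ρ μ Sig) 1 y u + -(u - μf) / vf) u := by
    intro u
    have h2 := (G.deriv_g u).log (G.pos u).ne'
    rw [mul_div_cancel_left₀ _ (G.pos u).ne'] at h2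
    refine ((deriv_log_likelihood hS hSig μ y u).add h2).congr_of_eventuallyEq
      (Eventually.of_forall fun x => ?_)
    exact Real.log_mul (likelihood_pos S hSig μ y x).ne' (G.pos x).ne'
  rw [jointLogD2, iteratedDeriv_succ, iteratedDeriv_one, funext fun u => (h1 u).deriv]
  refine HasDerivAt.deriv (((hasDerivAt_trigForm _ _ _ _ _ _).add
    (((hasDerivAt_id f).sub_const μf).neg.div_const (vf : ℝ))).congr_deriv ?_)
  ring

end CFO

end

/-! ### Fisher information in closed form -/

/-- Regrouping a double sum by the difference of its indices. -/
theorem sum_sum_sq_sub_mul (w : ℕ → ℕ → ℝ) (hw : ∀ i j, w i j = w j i) (n : ℕ) :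
    ∑ i ∈ Finset.range n, ∑ j ∈ Finset.range n, ((i : ℝ) - j) ^ 2 * w (i + 1) (j + 1) =
      2 * ∑ k ∈ Finset.Icc 1 (n - 1), (k : ℝ) ^ 2 * ∑ k₁ ∈ Finset.Icc (k + 1) n, w k₁ (k₁ - k) := by
  induction n with
  | zero => simp
  | succ n ih =>
    -- The summand `k = n` has an empty inner sum, so the range may be extended to match that of `n
    -- + 1`.
    have h1 : ∑ k ∈ Finset.Icc 1 (n - 1), (k : ℝ) ^ 2 *
        ∑ k₁ ∈ Finset.Icc (k + 1) n, w k₁ (k₁ - k) =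
        ∑ k ∈ Finset.Icc 1 n, (k : ℝ) ^ 2 * ∑ k₁ ∈ Finset.Icc (k + 1) n, w k₁ (k₁ - k) := by
      refine Finset.sum_subset (Finset.Icc_subset_Icc_right (Nat.sub_le n 1)) fun k hk hk' => ?_
      rw [Finset.mem_Icc] at hk hk'
      rw [Finset.Icc_eq_empty (by omega), Finset.sum_empty, mul_zero]
    have h2 : ∑ k ∈ Finset.Icc 1 n, (k : ℝ) ^ 2 * w (n + 1) (n + 1 - k) =
        ∑ j ∈ Finset.range n, ((n : ℝ) - j) ^ 2 * w (n + 1) (j + 1) := by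
      refine Finset.sum_nbij' (fun k => n - k) (fun j => n - j) ?_ ?_ ?_ ?_ ?_
      · intro k hk; rw [Finset.mem_Icc] at hk; rw [Finset.mem_range]; omega
      · intro j hj; rw [Finset.mem_range] at hj; rw [Finset.mem_Icc]; omega
      · intro k hk; rw [Finset.mem_Icc] at hk; omega
      · intro j hj; rw [Finset.mem_range] at hj; omega
      · intro k hk
        rw [Finset.mem_Icc] at hk
        rw [Nat.cast_sub hk.2, sub_sub_cancel, Nat.sub_add_comm hk.2]
    have h3 : ∑ k ∈ Finset.Icc 1 n, (k : ℝ) ^ 2 *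
        ∑ k₁ ∈ Finset.Icc (k + 1) (n + 1), w k₁ (k₁ - k) =
        ∑ k ∈ Finset.Icc 1 n, ((k : ℝ) ^ 2 * ∑ k₁ ∈ Finset.Icc (k + 1) n, w k₁ (k₁ - k) +
          (k : ℝ) ^ 2 * w (n + 1) (n + 1 - k)) := by
      refine Finset.sum_congr rfl fun k hk => ?_
      rw [Finset.mem_Icc] at hk
      rw [Finset.sum_Icc_succ_top (by omega), mul_add]
    have h4 : ∑ i ∈ Finset.range n, ((i : ℝ) - n) ^ 2 * w (i + 1) (n + 1) =
        ∑ j ∈ Finset.range n, ((n : ℝ) - j) ^ 2 * w (n + 1) (j + 1) :=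
      Finset.sum_congr rfl fun i _ => by rw [hw]; ring
    rw [Nat.add_sub_cancel, h3, Finset.sum_add_distrib, ← h1, h2, mul_add, ← ih,
      Finset.sum_range_succ]
    simp only [Finset.sum_range_succ, Finset.sum_add_distrib, h4]
    ring

theorem sum_range_sq_mul (g : ℕ → ℂ) (n : ℕ) :
    ∑ k ∈ Finset.range n, (k : ℂ) ^ 2 * g k = ∑ k ∈ Finset.Icc 1 (n - 1), (k : ℂ) ^ 2 * g k := by
  symm
  refine Finset.sum_subset (fun k hk => ?_) fun k hk hk' => ?_
  · rw [Finset.mem_Icc] at hk; rw [Finset.mem_range]; omega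
  · rw [Finset.mem_range] at hk
    rw [Finset.mem_Icc] at hk'
    obtain rfl : k = 0 := by omega
    simp

noncomputable section

namespace CFO

variable {n lt lr : ℕ}

theorem sym_succ (S : Matrix (Fin n) (Fin lt) ℂ) (t : Fin lt) (k : Fin n) :
    sym S t (k + 1) = S k t := by
  have : 1 ≤ (k : ℕ) + 1 ∧ (k : ℕ) + 1 ≤ n := ⟨by omega, k.2⟩
  rw [sym, dif_pos this]
  rfl

/-- The entries of `X M X†` in terms of the pilot symbols. -/
def gram (S : Matrix (Fin n) (Fin lt) ℂ) (M : Matrix (Fin lr × Fin lt) (Fin lr × Fin lt) ℂ)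
    (r₁ : Fin lr) (k₁ : ℕ) (r₂ : Fin lr) (k₂ : ℕ) : ℂ :=
  ∑ t₁, ∑ t₂, sym S t₁ k₁ * M (r₁, t₁) (r₂, t₂) * star (sym S t₂ k₂)

theorem star_gram (S : Matrix (Fin n) (Fin lt) ℂ)
    {M : Matrix (Fin lr × Fin lt) (Fin lr × Fin lt) ℂ} (hM : M.IsHermitian)
    (r₁ : Fin lr) (k₁ : ℕ) (r₂ : Fin lr) (k₂ : ℕ) :
    star (gram S M r₁ k₁ r₂ k₂) = gram S M r₂ k₂ r₁ k₁ := by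
  simp only [gram, star_sum, star_mul', star_star]
  rw [Finset.sum_comm]
  refine Finset.sum_congr rfl fun t₁ _ => Finset.sum_congr rfl fun t₂ _ => ?_
  rw [hM.apply]
  ring

theorem bigX_zero_mulVec (S : Matrix (Fin n) (Fin lt) ℂ) (x : Fin lr × Fin lt → ℂ)
    (i : Fin lr × Fin n) : (bigX lr S 0 *ᵥ x) i = ∑ t, sym S t (i.2 + 1) * x (i.1, t) := by
  simp only [Matrix.mulVec, dotProduct, bigX_apply, phase_zero, one_mul, Fintype.sum_prod_type,
    ite_mul, zero_mul, Finset.sum_ite_irrel, Finset.sum_const_zero, Finset.sum_ite_eq,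
    Finset.mem_univ, if_true, sym_succ]

theorem bigX_zero_conj_apply (S : Matrix (Fin n) (Fin lt) ℂ)
    (M : Matrix (Fin lr × Fin lt) (Fin lr × Fin lt) ℂ) (i j : Fin lr × Fin n) :
    (bigX lr S 0 * M * (bigX lr S 0)ᴴ) i j = gram S M i.1 (i.2 + 1) j.1 (j.2 + 1) := by
  have h : ∀ (x : Fin lr × Fin n) (g : Fin lr × Fin lt → ℂ),
      ∑ q, bigX lr S 0 x q * g q = ∑ t, sym S t (x.2 + 1) * g (x.1, t) := fun x g =>
    bigX_zero_mulVec S g x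
  rw [Matrix.mul_assoc, Matrix.mul_apply, h, gram]
  refine Finset.sum_congr rfl fun t₁ _ => ?_
  rw [Matrix.mul_apply]
  have h2 := congrArg star (h j fun q => star (M (i.1, t₁) q))
  simp only [star_sum, star_mul', star_star] at h2
  simp only [Matrix.conjTranspose_apply]
  simp only [mul_comm (M (i.1, t₁) _)]
  rw [h2, Finset.mul_sum]
  exact Finset.sum_congr rfl fun t₂ _ => by ring

/-- The second moment matrix of the channel. -/
def secondMoment (μ : Fin lr × Fin lt → ℂ)
    (Sig : Matrix (Fin lr × Fin lt) (Fin lr × Fin lt) ℂ) :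
    Matrix (Fin lr × Fin lt) (Fin lr × Fin lt) ℂ :=
  Sig + Matrix.vecMulVec μ (star μ)

theorem secondMoment_isHermitian (μ : Fin lr × Fin lt → ℂ)
    {Sig : Matrix (Fin lr × Fin lt) (Fin lr × Fin lt) ℂ} (hSig : Sig.PosDef) :
    (secondMoment μ Sig).IsHermitian :=
  hSig.isHermitian.add (Matrix.posSemidef_vecMulVec_self_star μ).isHermitian

theorem matA_isHermitian {S : Matrix (Fin n) (Fin lt) ℂ} {ρ : ℝ}
    (hS : Sᴴ * S = ((n * ρ / lt : ℝ) : ℂ) • (1 : Matrix (Fin lt) (Fin lt) ℂ))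
    {Sig : Matrix (Fin lr × Fin lt) (Fin lr × Fin lt) ℂ} (hSig : Sig.PosDef) :
    (matA n ρ Sig).IsHermitian := by
  have h := (posDef_inv_add hSig (bigX lr S 0)).inv.isHermitian
  rwa [bigX_conjTranspose_mul_self hS] at h

/-- The conditional second moment of the received signal. -/
theorem integral_star_mul_likelihood (S : Matrix (Fin n) (Fin lt) ℂ)
    {Sig : Matrix (Fin lr × Fin lt) (Fin lr × Fin lt) ℂ} (hSig : Sig.PosDef)
    (μ : Fin lr × Fin lt → ℂ) (f : ℝ) (i j : Fin lr × Fin n) :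
    ∫ y, star (y i) * y j * (likelihood S μ Sig y f : ℂ) =
      (if i = j then 1 else 0) + star (phase f i.2) * phase f j.2 *
        star (gram S (secondMoment μ Sig) i.1 (i.2 + 1) j.1 (j.2 + 1)) := by
  simp only [likelihood]
  rw [integral_star_mul_cnDensity (posDef_conj_add_one hSig _)]
  have h1 : (bigX lr S f * secondMoment μ Sig * (bigX lr S f)ᴴ) i j =
      phase f i.2 * star (phase f j.2) * gram S (secondMoment μ Sig) i.1 (i.2 + 1) j.1 (j.2 + 1) := by
    rw [← bigX_zero_conj_apply, ← rot_mul_mul_apply, bigX_eq_rot_mul S f]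
    simp only [Matrix.conjTranspose_mul, Matrix.mul_assoc]
  have h2 : bigX lr S f * secondMoment μ Sig * (bigX lr S f)ᴴ =
      bigX lr S f * Sig * (bigX lr S f)ᴴ +
        Matrix.vecMulVec (bigX lr S f *ᵥ μ) (star (bigX lr S f *ᵥ μ)) := by
    rw [secondMoment, Matrix.mul_add, Matrix.add_mul, Matrix.mul_vecMulVec, Matrix.vecMulVec_mul,
      Matrix.star_mulVec]
  have h3 := congrArg star h1
  rw [h2] at h3
  simp only [Matrix.add_apply, Matrix.vecMulVec_apply, star_add, star_mul', star_star,
    Pi.star_apply] at h3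
  rw [← h3, Matrix.add_apply, Matrix.one_apply, star_add]
  split_ifs <;> simp
  ring

theorem integral_star_likelihood (S : Matrix (Fin n) (Fin lt) ℂ)
    {Sig : Matrix (Fin lr × Fin lt) (Fin lr × Fin lt) ℂ} (hSig : Sig.PosDef)
    (μ : Fin lr × Fin lt → ℂ) (f : ℝ) (i : Fin lr × Fin n) :
    ∫ y, star (y i) * (likelihood S μ Sig y f : ℂ) =
      star (phase f i.2) * star ((bigX lr S 0 *ᵥ μ) i) := by
  simp only [likelihood]
  rw [integral_star_cnDensity (posDef_conj_add_one hSig _), bigX_eq_rot_mul S f,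
    ← Matrix.mulVec_mulVec, rot, Matrix.mulVec_diagonal, star_mul']

theorem integrable_mul_likelihood {S : Matrix (Fin n) (Fin lt) ℂ} {ρ : ℝ}
    (hS : Sᴴ * S = ((n * ρ / lt : ℝ) : ℂ) • (1 : Matrix (Fin lt) (Fin lt) ℂ))
    {Sig : Matrix (Fin lr × Fin lt) (Fin lr × Fin lt) ℂ} (hSig : Sig.PosDef)
    (μ : Fin lr × Fin lt → ℂ) (f : ℝ) {g : (Fin lr × Fin n → ℂ) → ℂ} (hg : Continuous g)
    (hle : ∀ y, ‖g y‖ ≤ 1 + ∑ i, ‖y i‖ ^ 2) :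
    Integrable fun y => g y * (likelihood S μ Sig y f : ℂ) := by
  obtain ⟨C, M, lam, R⟩ := exists_regularFamily hS hSig μ
  refine (R.integrable_mul_of_le (g := fun y => 1 + ∑ i, ‖y i‖ ^ 2) R.measN (K := 1) 1
    (fun y => ?_) f).mono' (hg.measurable.mul
      (R.measurable_p f).complex_ofReal).aestronglyMeasurable (ae_of_all _ fun y => ?_)
  · rw [abs_of_pos (zero_lt_one.trans_le (R.one_le y)), one_mul, pow_one]
  · rw [norm_mul, Complex.norm_real, Real.norm_of_nonneg (R.pos y f).le]
    exact mul_le_mul_of_nonneg_right (hle y) (R.pos y f).le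

/-- The expected second derivative of the log-likelihood, before regrouping. -/
theorem integral_trigForm_two {S : Matrix (Fin n) (Fin lt) ℂ} {ρ : ℝ}
    (hS : Sᴴ * S = ((n * ρ / lt : ℝ) : ℂ) • (1 : Matrix (Fin lt) (Fin lt) ℂ))
    {Sig : Matrix (Fin lr × Fin lt) (Fin lr × Fin lt) ℂ} (hSig : Sig.PosDef)
    (μ : Fin lr × Fin lt → ℂ) (f : ℝ) :
    ∫ y, trigForm time (quadG S ρ Sig) (linV S ρ μ Sig) 2 y f * likelihood S μ Sig y f =
      -(4 * Real.pi ^ 2 * (∑ i : Fin lr × Fin n, ∑ j : Fin lr × Fin n,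
          (((i.2 : ℕ) : ℝ) - ((j.2 : ℕ) : ℝ)) ^ 2 *
          (gram S (matA n ρ Sig) i.1 (i.2 + 1) j.1 (j.2 + 1) *
            star (gram S (secondMoment μ Sig) i.1 (i.2 + 1) j.1 (j.2 + 1))).re +
        2 * (∑ i : Fin lr × Fin n, ((i.2 : ℕ) : ℂ) ^ 2 *
          ((bigX lr S 0 *ᵥ vecB n ρ μ Sig) i * star ((bigX lr S 0 *ᵥ μ) i))).re)) := by
  set G := quadG S ρ Sig
  set v := linV S ρ μ Sig
  set a : Fin lr × Fin n → Fin lr × Fin n → ℂ := fun i j =>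
    (2 * Real.pi * Complex.I * (time i - time j)) ^ 2 *
      Complex.exp (2 * Real.pi * Complex.I * (time i - time j) * f) * G i j with ha
  set b : Fin lr × Fin n → ℂ := fun i => (2 * Real.pi * Complex.I * time i) ^ 2 *
      Complex.exp (2 * Real.pi * Complex.I * time i * f) * v i with hb
  have i2 := fun i j : Fin lr × Fin n => (integrable_mul_likelihood hS hSig μ f
    (g := fun y => star (y i) * y j) (by fun_prop) fun y => by
      rw [norm_mul, norm_star]
      exact (norm_mul_norm_le_sum y i j).trans (le_add_of_nonneg_left zero_le_one)).const_mul (a i j)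
  have i1 := fun i : Fin lr × Fin n => (integrable_mul_likelihood hS hSig μ f
    (g := fun y => star (y i)) (by fun_prop) fun y => by
      rw [norm_star]; exact norm_le_one_add_sum y i).const_mul (2 * b i)
  have i2' := fun i => integrable_finsetSum Finset.univ fun j _ => i2 i j
  have i2'' := integrable_finsetSum Finset.univ fun i _ => i2' i
  have i1' := integrable_finsetSum Finset.univ fun i _ => i1 i
  have hre : (fun y => trigForm time G v 2 y f * likelihood S μ Sig y f) = fun y =>
      Complex.reCLM (∑ i, ∑ j, a i j * (star (y i) * y j * (likelihood S μ Sig y f : ℂ)) +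
        ∑ i, 2 * b i * (star (y i) * (likelihood S μ Sig y f : ℂ))) := by
    ext y
    rw [Complex.reCLM_apply, trigForm, ← Complex.re_mul_ofReal, add_mul]
    congr 2
    · simp only [Finset.sum_mul, ha]
      exact Finset.sum_congr rfl fun i _ => Finset.sum_congr rfl fun j _ => by ring
    · simp only [Finset.sum_mul, Finset.mul_sum, hb]
      exact Finset.sum_congr rfl fun i _ => by ring
  rw [hre, Complex.reCLM.integral_comp_comm (by exact i2''.add i1'), integral_add i2'' i1',
    integral_finsetSum _ fun i _ => i2' i, integral_finsetSum _ fun i _ => i1 i]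
  simp only [integral_finsetSum _ fun j _ => i2 _ j, integral_const_mul,
    integral_star_mul_likelihood S hSig, integral_star_likelihood S hSig]
  have hI : Complex.I ^ 2 = -1 := Complex.I_sq
  -- The phase in `a` is conjugate to that of the second moment, so `f` disappears; the square of
  -- `I` gives the sign.
  have e2 : ∀ i j : Fin lr × Fin n, a i j * ((if i = j then 1 else 0) +
      star (phase f i.2) * phase f j.2 *
        star (gram S (secondMoment μ Sig) i.1 (i.2 + 1) j.1 (j.2 + 1))) =
      ((-(4 * Real.pi ^ 2 * (((i.2 : ℕ) : ℝ) - ((j.2 : ℕ) : ℝ)) ^ 2) : ℝ) : ℂ) *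
      (gram S (matA n ρ Sig) i.1 (i.2 + 1) j.1 (j.2 + 1) *
            star (gram S (secondMoment μ Sig) i.1 (i.2 + 1) j.1 (j.2 + 1))) := by
    intro i j
    -- The white noise contributes only for `i = j`, where the time difference vanishes.
    have hz : (2 * Real.pi * Complex.I * (time i - time j) : ℂ) ^ 2 * (if i = j then 1 else 0) = 0 := by
      split_ifs with h
      · simp [h]
      · simp
    have hG : G i j = gram S (matA n ρ Sig) i.1 (i.2 + 1) j.1 (j.2 + 1) :=
      bigX_zero_conj_apply S _ i j
    have hph := phase_mul_star_phase f i.2 j.2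
    have hi := star_phase_mul_phase f i.2
    have hj := star_phase_mul_phase f j.2
    simp only [ha, time] at hz ⊢
    rw [← hph, hG]
    push_cast at hz ⊢
    linear_combination (phase f i.2 * star (phase f j.2) *
      gram S (matA n ρ Sig) i.1 (i.2 + 1) j.1 (j.2 + 1)) * hz +
      (2 * Real.pi * Complex.I * (((i.2 : ℕ) : ℂ) - ((j.2 : ℕ) : ℂ))) ^ 2 *
      (gram S (matA n ρ Sig) i.1 (i.2 + 1) j.1 (j.2 + 1) *
            star (gram S (secondMoment μ Sig) i.1 (i.2 + 1) j.1 (j.2 + 1))) *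
      (star (phase f j.2) * phase f j.2 * hi + hj) +
      4 * Real.pi ^ 2 * (((i.2 : ℕ) : ℂ) - ((j.2 : ℕ) : ℂ)) ^ 2 *
      (gram S (matA n ρ Sig) i.1 (i.2 + 1) j.1 (j.2 + 1) *
            star (gram S (secondMoment μ Sig) i.1 (i.2 + 1) j.1 (j.2 + 1))) * hI
  have e1 : ∀ i : Fin lr × Fin n, 2 * b i *
      (star (phase f i.2) * star ((bigX lr S 0 *ᵥ μ) i)) =
      ((-(4 * Real.pi ^ 2) * 2 : ℝ) : ℂ) * (((i.2 : ℕ) : ℂ) ^ 2 *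
          ((bigX lr S 0 *ᵥ vecB n ρ μ Sig) i * star ((bigX lr S 0 *ᵥ μ) i))) := by
    intro i
    have hph := phase_eq f i.2
    have hi := star_phase_mul_phase f i.2
    have hv : v i = (bigX lr S 0 *ᵥ vecB n ρ μ Sig) i := rfl
    simp only [hb, time]
    rw [← hph, hv]
    push_cast
    linear_combination 2 * (2 * Real.pi * Complex.I * ((i.2 : ℕ) : ℂ)) ^ 2 *
      ((bigX lr S 0 *ᵥ vecB n ρ μ Sig) i * star ((bigX lr S 0 *ᵥ μ) i)) * hi +
      8 * Real.pi ^ 2 * ((i.2 : ℕ) : ℂ) ^ 2 *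
      ((bigX lr S 0 *ᵥ vecB n ρ μ Sig) i * star ((bigX lr S 0 *ᵥ μ) i)) * hI
  simp only [e1, e2, ← Finset.mul_sum]
  rw [Complex.reCLM_apply, Complex.add_re, Complex.re_ofReal_mul]
  simp only [Complex.re_sum, Complex.re_ofReal_mul]
  simp only [neg_mul, mul_assoc, Finset.sum_neg_distrib, ← Finset.mul_sum]
  ring

/-- The correlation of the samples `k₁` and `k₂`, summed over the receive antennas. -/
def corr (S : Matrix (Fin n) (Fin lt) ℂ) (A R : Matrix (Fin lr × Fin lt) (Fin lr × Fin lt) ℂ)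
    (k₁ k₂ : ℕ) : ℂ :=
  ∑ r₁, ∑ r₂, gram S A r₁ k₁ r₂ k₂ * star (gram S R r₁ k₁ r₂ k₂)

/-- Exchanging the samples conjugates both Gram factors. This symmetry folds the sum over all pairs
onto `k₁ > k₂`. -/
theorem corr_re_comm (S : Matrix (Fin n) (Fin lt) ℂ)
    {A R : Matrix (Fin lr × Fin lt) (Fin lr × Fin lt) ℂ} (hA : A.IsHermitian)
    (hR : R.IsHermitian) (k₁ k₂ : ℕ) : (corr S A R k₁ k₂).re = (corr S A R k₂ k₁).re := by
  have h : star (corr S A R k₁ k₂) = corr S A R k₂ k₁ := by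
    simp only [corr, star_sum, star_mul', star_star]
    rw [Finset.sum_comm]
    refine Finset.sum_congr rfl fun r₁ _ => Finset.sum_congr rfl fun r₂ _ => ?_
    rw [star_gram S hA, star_gram S hR]
  rw [← h, Complex.star_def, Complex.conj_re]

/-- The sums over `t₁'` and `t₂'` form a conjugated Gram entry of the channel's second moment. -/
theorem corr_secondMoment (S : Matrix (Fin n) (Fin lt) ℂ)
    (A Sig : Matrix (Fin lr × Fin lt) (Fin lr × Fin lt) ℂ) (μ : Fin lr × Fin lt → ℂ) (k₁ k₂ : ℕ) :
    ∑ r₁ : Fin lr, ∑ t₁ : Fin lt, ∑ r₂ : Fin lr, ∑ t₂ : Fin lt,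
      A (r₁, t₁) (r₂, t₂) * sym S t₁ k₁ * star (sym S t₂ k₂) *
        ∑ t₂' : Fin lt, sym S t₂' k₂ * ∑ t₁' : Fin lt, star (sym S t₁' k₁) *
          (star (Sig (r₁, t₁') (r₂, t₂')) + μ (r₂, t₂') * star (μ (r₁, t₁'))) =
      corr S A (secondMoment μ Sig) k₁ k₂ := by
  have h : ∀ r₁ r₂ : Fin lr, ∑ t₂' : Fin lt, sym S t₂' k₂ * ∑ t₁' : Fin lt,
      star (sym S t₁' k₁) *
        (star (Sig (r₁, t₁') (r₂, t₂')) + μ (r₂, t₂') * star (μ (r₁, t₁'))) =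
      star (gram S (secondMoment μ Sig) r₁ k₁ r₂ k₂) := by
    intro r₁ r₂
    simp only [gram, star_sum, star_mul', star_star, Finset.mul_sum]
    rw [Finset.sum_comm]
    refine Finset.sum_congr rfl fun t₁ _ => Finset.sum_congr rfl fun t₂ _ => ?_
    simp only [secondMoment, Matrix.add_apply, Matrix.vecMulVec_apply, star_add, star_mul',
      Pi.star_apply, star_star]
    ring
  simp only [h, corr]
  refine Finset.sum_congr rfl fun r₁ _ => ?_
  rw [Finset.sum_comm]
  refine Finset.sum_congr rfl fun r₂ _ => ?_
  generalize star (gram S (secondMoment μ Sig) r₁ k₁ r₂ k₂) = z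
  rw [gram, Finset.sum_mul]
  refine Finset.sum_congr rfl fun t₁ _ => ?_
  rw [Finset.sum_mul]
  exact Finset.sum_congr rfl fun t₂ _ => by ring

/-- The pairs `(i, j)` and `(j, i)` contribute equally, which turns `4 π²` into `8 π²`; the linear
part carries its factor 2 already. -/
theorem beta_eq {S : Matrix (Fin n) (Fin lt) ℂ} {ρ : ℝ}
    (hS : Sᴴ * S = ((n * ρ / lt : ℝ) : ℂ) • (1 : Matrix (Fin lt) (Fin lt) ℂ))
    {Sig : Matrix (Fin lr × Fin lt) (Fin lr × Fin lt) ℂ} (hSig : Sig.PosDef)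
    (μ : Fin lr × Fin lt → ℂ) :
    beta S ρ μ Sig = 4 * Real.pi ^ 2 * (∑ i : Fin lr × Fin n, ∑ j : Fin lr × Fin n,
          (((i.2 : ℕ) : ℝ) - ((j.2 : ℕ) : ℝ)) ^ 2 *
          (gram S (matA n ρ Sig) i.1 (i.2 + 1) j.1 (j.2 + 1) *
            star (gram S (secondMoment μ Sig) i.1 (i.2 + 1) j.1 (j.2 + 1))).re +
        2 * (∑ i : Fin lr × Fin n, ((i.2 : ℕ) : ℂ) ^ 2 *
          ((bigX lr S 0 *ᵥ vecB n ρ μ Sig) i * star ((bigX lr S 0 *ᵥ μ) i))).re) := by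
  have h1 : ∑ i : Fin lr × Fin n, ∑ j : Fin lr × Fin n,
      (((i.2 : ℕ) : ℝ) - ((j.2 : ℕ) : ℝ)) ^ 2 *
        (gram S (matA n ρ Sig) i.1 (i.2 + 1) j.1 (j.2 + 1) *
          star (gram S (secondMoment μ Sig) i.1 (i.2 + 1) j.1 (j.2 + 1))).re =
      2 * ∑ k ∈ Finset.Icc 1 (n - 1), (k : ℝ) ^ 2 * ∑ k₁ ∈ Finset.Icc (k + 1) n,
        (corr S (matA n ρ Sig) (secondMoment μ Sig) k₁ (k₁ - k)).re := by
    rw [← sum_sum_sq_sub_mul _ (corr_re_comm S (matA_isHermitian hS hSig)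
      (secondMoment_isHermitian μ hSig)), Finset.sum_range, Fintype.sum_prod_type_right]
    refine Finset.sum_congr rfl fun k₁ _ => ?_
    rw [Finset.sum_range]
    simp only [Fintype.sum_prod_type_right]
    rw [Finset.sum_comm]
    refine Finset.sum_congr rfl fun k₂ _ => ?_
    simp only [corr, Complex.re_sum, Finset.mul_sum]
  have h2 : ∑ i : Fin lr × Fin n, ((i.2 : ℕ) : ℂ) ^ 2 *
      ((bigX lr S 0 *ᵥ vecB n ρ μ Sig) i * star ((bigX lr S 0 *ᵥ μ) i)) =
      ∑ k ∈ Finset.Icc 1 (n - 1), (k : ℂ) ^ 2 * ∑ r : Fin lr, ∑ t : Fin lt, ∑ t' : Fin lt,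
        sym S t (k + 1) * star (sym S t' (k + 1)) * star (μ (r, t')) * vecB n ρ μ Sig (r, t) := by
    rw [← sum_range_sq_mul (fun k => ∑ r : Fin lr, ∑ t : Fin lt, ∑ t' : Fin lt,
      sym S t (k + 1) * star (sym S t' (k + 1)) * star (μ (r, t')) * vecB n ρ μ Sig (r, t)),
      Finset.sum_range, Fintype.sum_prod_type_right]
    refine Finset.sum_congr rfl fun k _ => ?_
    rw [Finset.mul_sum]
    refine Finset.sum_congr rfl fun r _ => ?_
    simp only
    congr 1
    rw [bigX_zero_mulVec, bigX_zero_mulVec, star_sum, Finset.sum_mul_sum]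
    refine Finset.sum_congr rfl fun t _ => Finset.sum_congr rfl fun t' _ => ?_
    rw [star_mul']
    ring
  have h3 : (∑ k ∈ Finset.Icc 1 (n - 1), (k : ℂ) ^ 2 * ∑ k₁ ∈ Finset.Icc (k + 1) n,
      corr S (matA n ρ Sig) (secondMoment μ Sig) k₁ (k₁ - k)).re =
      ∑ k ∈ Finset.Icc 1 (n - 1), (k : ℝ) ^ 2 * ∑ k₁ ∈ Finset.Icc (k + 1) n,
        (corr S (matA n ρ Sig) (secondMoment μ Sig) k₁ (k₁ - k)).re := by
    rw [Complex.re_sum]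
    refine Finset.sum_congr rfl fun k _ => ?_
    rw [← Complex.re_sum, ← Complex.re_ofReal_mul]
    push_cast
    rfl
  rw [h1, h2, beta]
  simp only [corr_secondMoment]
  simp only [mul_add, Finset.sum_add_distrib, Complex.add_re, h3]
  ring

/-- The Fisher information of the offset is `beta`. -/
theorem integral_trigForm_two_eq_neg_beta {S : Matrix (Fin n) (Fin lt) ℂ} {ρ : ℝ}
    (hS : Sᴴ * S = ((n * ρ / lt : ℝ) : ℂ) • (1 : Matrix (Fin lt) (Fin lt) ℂ))
    {Sig : Matrix (Fin lr × Fin lt) (Fin lr × Fin lt) ℂ} (hSig : Sig.PosDef)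
    (μ : Fin lr × Fin lt → ℂ) (f : ℝ) :
    ∫ y, trigForm time (quadG S ρ Sig) (linV S ρ μ Sig) 2 y f * likelihood S μ Sig y f =
      -beta S ρ μ Sig := by
  rw [integral_trigForm_two hS hSig, beta_eq hS hSig]

/-- The value is the second moment of the score, here read off at offset 0. -/
theorem beta_nonneg {S : Matrix (Fin n) (Fin lt) ℂ} {ρ : ℝ}
    (hS : Sᴴ * S = ((n * ρ / lt : ℝ) : ℂ) • (1 : Matrix (Fin lt) (Fin lt) ℂ))
    {Sig : Matrix (Fin lr × Fin lt) (Fin lr × Fin lt) ℂ} (hSig : Sig.PosDef)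
    (μ : Fin lr × Fin lt → ℂ) : 0 ≤ beta S ρ μ Sig := by
  obtain ⟨C, M, lam, R⟩ := exists_regularFamily hS hSig μ
  have h := R.integral_sq_mul 0
  rw [integral_trigForm_two_eq_neg_beta hS hSig, neg_neg] at h
  rw [← h]
  exact integral_nonneg fun y => mul_nonneg (sq_nonneg _) (R.pos y 0).le

/-! ### Independent identically distributed channel -/

theorem sDD_mul_star (S : Matrix (Fin n) (Fin lt) ℂ) (k₁ k₂ : ℕ) :
    sDD S k₁ k₂ * star (sDD S k₁ k₂) = ((‖sDD S k₁ k₂‖ ^ 2 : ℝ) : ℂ) := by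
  rw [Complex.star_def, Complex.mul_conj']
  push_cast
  rfl

theorem gram_smul_one (S : Matrix (Fin n) (Fin lt) ℂ) (c : ℂ) (r₁ r₂ : Fin lr) (k₁ k₂ : ℕ) :
    gram S (c • (1 : Matrix (Fin lr × Fin lt) (Fin lr × Fin lt) ℂ)) r₁ k₁ r₂ k₂ =
      if r₁ = r₂ then c * sDD S k₁ k₂ else 0 := by
  simp only [gram, Matrix.smul_apply, Matrix.one_apply, Prod.mk.injEq, smul_eq_mul, sDD]
  split_ifs with h
  · rw [Finset.mul_sum]
    refine Finset.sum_congr rfl fun t _ => ?_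
    rw [Finset.sum_eq_single t]
    · simp only [h, and_self, if_true]; ring
    · intro t' _ ht
      simp [Ne.symm ht]
    · simp
  · simp [h]

theorem beta_iid (S : Matrix (Fin n) (Fin lt) ℂ) (ρ σh : ℝ) :
    beta S ρ (0 : Fin lr × Fin lt → ℂ)
      (((σh ^ 2 : ℝ) : ℂ) • (1 : Matrix (Fin lr × Fin lt) (Fin lr × Fin lt) ℂ)) =
      8 * Real.pi ^ 2 * lr * ((σh ^ 2)⁻¹ + n * ρ / lt)⁻¹ * σh ^ 2 *
        ∑ k ∈ Finset.Icc 1 (n - 1), (k : ℝ) ^ 2 *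
          ∑ k₁ ∈ Finset.Icc (k + 1) n, ‖sDD S k₁ (k₁ - k)‖ ^ 2 := by
  have hinv : ∀ c : ℂ, (c • (1 : Matrix (Fin lr × Fin lt) (Fin lr × Fin lt) ℂ))⁻¹ = c⁻¹ • 1 := by
    intro c
    -- Both inverses are 0 at `c = 0`, so the formula needs no positivity of the channel variance.
    by_cases hc : c = 0
    · simp [hc]
    · refine Matrix.inv_eq_left_inv ?_
      rw [Matrix.smul_mul, Matrix.mul_smul, smul_smul, inv_mul_cancel₀ hc, one_smul, Matrix.one_mul]
  have hA : matA n ρ (((σh ^ 2 : ℝ) : ℂ) •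
      (1 : Matrix (Fin lr × Fin lt) (Fin lr × Fin lt) ℂ)) =
      ((((σh ^ 2)⁻¹ + n * ρ / lt)⁻¹ : ℝ) : ℂ) • 1 := by
    rw [matA, hinv, ← add_smul, hinv]
    push_cast
    rfl
  have hsm : secondMoment (0 : Fin lr × Fin lt → ℂ) (((σh ^ 2 : ℝ) : ℂ) •
      (1 : Matrix (Fin lr × Fin lt) (Fin lr × Fin lt) ℂ)) = ((σh ^ 2 : ℝ) : ℂ) • 1 := by
    simp [secondMoment]
  have hcorr : ∀ k₁ k₂, corr S (((((σh ^ 2)⁻¹ + n * ρ / lt)⁻¹ : ℝ) : ℂ) •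
      (1 : Matrix (Fin lr × Fin lt) (Fin lr × Fin lt) ℂ)) (((σh ^ 2 : ℝ) : ℂ) • 1) k₁ k₂ =
      ((lr * ((σh ^ 2)⁻¹ + n * ρ / lt)⁻¹ * σh ^ 2 * ‖sDD S k₁ k₂‖ ^ 2 : ℝ) : ℂ) := by
    intro k₁ k₂
    simp only [corr, gram_smul_one, ite_mul, zero_mul, Finset.sum_ite_eq, Finset.mem_univ,
      if_true, star_mul', Finset.sum_const, Finset.card_univ, Fintype.card_fin, nsmul_eq_mul]
    have h := sDD_mul_star S k₁ k₂
    rw [Complex.star_def, Complex.conj_ofReal, ← Complex.star_def]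
    push_cast at h ⊢
    linear_combination (lr * ((σh ^ 2 : ℂ)⁻¹ + n * ρ / lt)⁻¹ * σh ^ 2) * h
  rw [beta]
  simp only [corr_secondMoment]
  rw [hA, hsm]
  simp only [hcorr, Pi.zero_apply, star_zero, mul_zero, zero_mul,
    Finset.sum_const_zero, zero_add]
  have hcast : (∑ k ∈ Finset.Icc 1 (n - 1), (k : ℂ) ^ 2 * ∑ k₁ ∈ Finset.Icc (k + 1) n,
      ((lr * ((σh ^ 2)⁻¹ + n * ρ / lt)⁻¹ * σh ^ 2 * ‖sDD S k₁ (k₁ - k)‖ ^ 2 : ℝ) : ℂ)).re =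
      ∑ k ∈ Finset.Icc 1 (n - 1), (k : ℝ) ^ 2 * ∑ k₁ ∈ Finset.Icc (k + 1) n,
        (lr * ((σh ^ 2)⁻¹ + n * ρ / lt)⁻¹ * σh ^ 2 * ‖sDD S k₁ (k₁ - k)‖ ^ 2) := by
    rw [← Complex.ofReal_re (∑ k ∈ Finset.Icc 1 (n - 1), (k : ℝ) ^ 2 * _)]
    push_cast
    rfl
  rw [hcast]
  simp only [Finset.mul_sum]
  refine Finset.sum_congr rfl fun k _ => Finset.sum_congr rfl fun k₁ _ => by ring

theorem norm_sDD_comm (S : Matrix (Fin n) (Fin lt) ℂ) (k₁ k₂ : ℕ) :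
    ‖sDD S k₁ k₂‖ ^ 2 = ‖sDD S k₂ k₁‖ ^ 2 := by
  have h : star (sDD S k₁ k₂) = sDD S k₂ k₁ := by
    simp only [sDD, star_sum, star_mul', star_star]
    exact Finset.sum_congr rfl fun t _ => mul_comm _ _
  rw [← h, norm_star]

theorem sum_Icc_norm_sDD (S : Matrix (Fin n) (Fin lt) ℂ) :
    ∑ k ∈ Finset.Icc 1 (n - 1), (k : ℝ) ^ 2 *
      ∑ k₁ ∈ Finset.Icc (k + 1) n, ‖sDD S k₁ (k₁ - k)‖ ^ 2 =
      (∑ i : Fin n, ∑ j : Fin n, (((i : ℕ) : ℝ) - (j : ℕ)) ^ 2 *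
        ‖sDD S ((i : ℕ) + 1) ((j : ℕ) + 1)‖ ^ 2) / 2 := by
  have h := sum_sum_sq_sub_mul (fun a b => ‖sDD S a b‖ ^ 2) (norm_sDD_comm S) n
  rw [Finset.sum_range] at h
  simp only [Finset.sum_range] at h
  rw [h]
  ring

theorem sum_fin_sub_sq (m : ℕ) : ∑ i : Fin m, ∑ j : Fin m, (((i : ℕ) : ℝ) - (j : ℕ)) ^ 2 =
    (m : ℝ) ^ 2 * ((m : ℝ) ^ 2 - 1) / 6 := by
  have h1 : ∑ i : Fin m, ((i : ℕ) : ℝ) = m * (m - 1) / 2 := by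
    induction m with
    | zero => simp
    | succ m ih => rw [Fin.sum_univ_castSucc]; simp only [Fin.val_castSucc, Fin.val_last, ih]
                   push_cast; ring
  have h2 : ∑ i : Fin m, ((i : ℕ) : ℝ) ^ 2 = m * (m - 1) * (2 * m - 1) / 6 := by
    clear h1
    induction m with
    | zero => simp
    | succ m ih => rw [Fin.sum_univ_castSucc]; simp only [Fin.val_castSucc, Fin.val_last, ih]
                   push_cast; ring
  simp only [sub_sq, Finset.sum_add_distrib, Finset.sum_sub_distrib, Finset.sum_const,
    Finset.card_univ, Fintype.card_fin, nsmul_eq_mul, mul_assoc, ← Finset.mul_sum,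
    ← Finset.sum_mul, h1, h2]
  ring

theorem norm_scrambled_sq {ρ : ℝ} (hρ : 0 < ρ) {c₁ c₂ z : ℂ} (h₁ : ‖c₁‖ = 1) (h₂ : ‖c₂‖ = 1) :
    ‖(Real.sqrt ρ : ℂ) * c₁ * star ((Real.sqrt ρ : ℂ) * c₂) * z‖ ^ 2 = ρ ^ 2 * ‖z‖ ^ 2 := by
  rw [norm_mul, norm_mul, norm_mul, norm_star, norm_mul, h₁, h₂, Complex.norm_real,
    Real.norm_of_nonneg (Real.sqrt_nonneg ρ), mul_one, Real.mul_self_sqrt hρ.le, mul_pow]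

/-- Rows of a unitary matrix are orthonormal, so only equal residues modulo `lt` correlate;
scrambling changes phases only. -/
theorem norm_sDD_periodic {S : Matrix (Fin n) (Fin lt) ℂ} {ρ : ℝ} (hρ : 0 < ρ) {c : Fin n → ℂ}
    (hc : ∀ k, ‖c k‖ = 1) {O : Matrix (Fin lt) (Fin lt) ℂ}
    (hO : O ∈ Matrix.unitaryGroup (Fin lt) ℂ)
    (hS : ∀ (k : Fin n) (i t : Fin lt), (i : ℕ) = (k : ℕ) % lt →
      S k t = (Real.sqrt ρ : ℂ) * c k * O i t) (k₁ k₂ : Fin n) {i₁ i₂ : Fin lt}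
    (h₁ : (i₁ : ℕ) = (k₁ : ℕ) % lt) (h₂ : (i₂ : ℕ) = (k₂ : ℕ) % lt) :
    ‖sDD S ((k₁ : ℕ) + 1) ((k₂ : ℕ) + 1)‖ ^ 2 = if i₁ = i₂ then ρ ^ 2 else 0 := by
  have h : sDD S ((k₁ : ℕ) + 1) ((k₂ : ℕ) + 1) = (Real.sqrt ρ : ℂ) * c k₁ *
      star ((Real.sqrt ρ : ℂ) * c k₂) * (if i₁ = i₂ then 1 else 0) := by
    rw [← Matrix.one_apply, ← Matrix.mem_unitaryGroup_iff.mp hO, Matrix.mul_apply, sDD,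
      Finset.mul_sum]
    refine Finset.sum_congr rfl fun t _ => ?_
    rw [sym_succ, sym_succ, hS k₁ i₁ t h₁, hS k₂ i₂ t h₂, Matrix.star_apply, star_mul' _ (O i₂ t)]
    ring
  rw [h, norm_scrambled_sq hρ (hc _) (hc _)]
  split_ifs <;> simp

/-- Each sample has a single active antenna, so only samples of the same block correlate. -/
theorem norm_sDD_timeDivision {S : Matrix (Fin n) (Fin lt) ℂ} {ρ : ℝ} (hρ : 0 < ρ)
    {c : Fin n → ℂ} (hc : ∀ k, ‖c k‖ = 1) {m : ℕ}
    (hS : ∀ (k : Fin n) (t : Fin lt),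
      S k t = (Real.sqrt ρ : ℂ) * c k * (if (k : ℕ) / m = (t : ℕ) then 1 else 0))
    (k₁ k₂ : Fin n) {i₁ i₂ : Fin lt} (h₁ : (k₁ : ℕ) / m = (i₁ : ℕ)) (h₂ : (k₂ : ℕ) / m = (i₂ : ℕ)) :
    ‖sDD S ((k₁ : ℕ) + 1) ((k₂ : ℕ) + 1)‖ ^ 2 = if i₁ = i₂ then ρ ^ 2 else 0 := by
  have h : sDD S ((k₁ : ℕ) + 1) ((k₂ : ℕ) + 1) = (Real.sqrt ρ : ℂ) * c k₁ *
      star ((Real.sqrt ρ : ℂ) * c k₂) * (if i₁ = i₂ then 1 else 0) := by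
    rw [sDD, Finset.sum_eq_single i₁]
    · rw [sym_succ, sym_succ, hS, hS, h₁, h₂, if_pos rfl, mul_one, star_mul' _ (ite _ _ _)]
      simp only [Fin.val_inj, eq_comm (a := i₂)]
      split_ifs <;> simp
    · intro t _ ht
      rw [sym_succ, hS, h₁, if_neg (by rw [Fin.val_inj]; exact ht.symm)]
      simp
    · simp
  rw [h, norm_scrambled_sq hρ (hc _) (hc _)]
  split_ifs <;> simp

/-- Contributing pairs lie at distances divisible by `lt`: the squared distance gives `lt ^ 2` and
the number of residues another `lt`. -/
theorem sum_norm_sDD_periodic {S : Matrix (Fin n) (Fin lt) ℂ} {ρ : ℝ} (hρ : 0 < ρ)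
    (hP : IsPeriodicPilot S ρ) :
    ∃ m : ℕ, 0 < m ∧ n = m * lt ∧ ∑ i : Fin n, ∑ j : Fin n, (((i : ℕ) : ℝ) - (j : ℕ)) ^ 2 *
      ‖sDD S ((i : ℕ) + 1) ((j : ℕ) + 1)‖ ^ 2 =
        ρ ^ 2 * (lt : ℝ) ^ 3 * ((m : ℝ) ^ 2 * ((m : ℝ) ^ 2 - 1) / 6) := by
  obtain ⟨m, hm, rfl, c, hc, O, hO, hS⟩ := hP
  refine ⟨m, hm, rfl, ?_⟩
  have hmod : ∀ x : Fin m × Fin lt, (x.2 : ℕ) = (finProdFinEquiv x : ℕ) % lt := by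
    intro x
    rw [finProdFinEquiv_apply_val, Nat.add_mul_mod_self_left, Nat.mod_eq_of_lt x.2.2]
  have hterm : ∀ x y : Fin m × Fin lt,
      (((finProdFinEquiv x : Fin (m * lt)) : ℕ) - ((finProdFinEquiv y : Fin (m * lt)) : ℕ) : ℝ) ^ 2 *
      ‖sDD S ((finProdFinEquiv x : ℕ) + 1) ((finProdFinEquiv y : ℕ) + 1)‖ ^ 2 =
      if x.2 = y.2 then ρ ^ 2 * (lt : ℝ) ^ 2 * (((x.1 : ℕ) : ℝ) - (y.1 : ℕ)) ^ 2 else 0 := by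
    intro x y
    rw [norm_sDD_periodic hρ hc hO hS _ _ (hmod x) (hmod y)]
    split_ifs with h
    · rw [finProdFinEquiv_apply_val, finProdFinEquiv_apply_val, h]
      push_cast
      ring
    · rw [mul_zero]
  rw [← Equiv.sum_comp finProdFinEquiv]
  simp only [← Equiv.sum_comp (finProdFinEquiv (m := m) (n := lt)), hterm]
  simp only [Fintype.sum_prod_type, Finset.sum_ite_eq, Finset.mem_univ, if_true, Finset.sum_const,
    Finset.card_univ, Fintype.card_fin, nsmul_eq_mul, ← Finset.mul_sum, sum_fin_sub_sq]
  ring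

/-- Distances inside a block are not stretched, so only the number `lt` of blocks enters. The
missing `lt ^ 2` is the loss against the periodic pilot. -/
theorem sum_norm_sDD_timeDivision {S : Matrix (Fin n) (Fin lt) ℂ} {ρ : ℝ} (hρ : 0 < ρ)
    (hT : IsTimeDivisionPilot S ρ) :
    ∃ m : ℕ, 0 < m ∧ n = m * lt ∧ ∑ i : Fin n, ∑ j : Fin n, (((i : ℕ) : ℝ) - (j : ℕ)) ^ 2 *
      ‖sDD S ((i : ℕ) + 1) ((j : ℕ) + 1)‖ ^ 2 =
        ρ ^ 2 * lt * ((m : ℝ) ^ 2 * ((m : ℝ) ^ 2 - 1) / 6) := by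
  obtain ⟨m, hm, hn, c, hc, hS⟩ := hT
  refine ⟨m, hm, hn, ?_⟩
  obtain rfl : n = lt * m := by rw [hn, mul_comm]
  have hdiv : ∀ x : Fin lt × Fin m, (finProdFinEquiv x : ℕ) / m = (x.1 : ℕ) := by
    intro x
    rw [finProdFinEquiv_apply_val, Nat.add_mul_div_left _ _ hm, Nat.div_eq_of_lt x.2.2, zero_add]
  have hterm : ∀ x y : Fin lt × Fin m,
      (((finProdFinEquiv x : Fin (lt * m)) : ℕ) - ((finProdFinEquiv y : Fin (lt * m)) : ℕ) : ℝ) ^ 2 *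
      ‖sDD S ((finProdFinEquiv x : ℕ) + 1) ((finProdFinEquiv y : ℕ) + 1)‖ ^ 2 =
      if x.1 = y.1 then ρ ^ 2 * (((x.2 : ℕ) : ℝ) - (y.2 : ℕ)) ^ 2 else 0 := by
    intro x y
    rw [norm_sDD_timeDivision hρ hc hS _ _ (hdiv x) (hdiv y)]
    split_ifs with h
    · rw [finProdFinEquiv_apply_val, finProdFinEquiv_apply_val, h]
      push_cast
      ring
    · rw [mul_zero]
  rw [← Equiv.sum_comp finProdFinEquiv]
  simp only [← Equiv.sum_comp (finProdFinEquiv (m := lt) (n := m)), hterm]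
  simp only [Fintype.sum_prod_type_right, Finset.sum_ite_eq, Finset.mem_univ, if_true,
    Finset.sum_const, Finset.card_univ, Fintype.card_fin, nsmul_eq_mul, ← Finset.mul_sum,
    sum_fin_sub_sq]
  ring

theorem beta_periodic (hlt : 0 < lt) {S : Matrix (Fin n) (Fin lt) ℂ} {ρ σh : ℝ} (hσ : 0 < σh ^ 2)
    (hρ : 0 < ρ) (hP : IsPeriodicPilot S ρ) :
    beta S ρ (0 : Fin lr × Fin lt → ℂ)
      (((σh ^ 2 : ℝ) : ℂ) • (1 : Matrix (Fin lr × Fin lt) (Fin lr × Fin lt) ℂ)) =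
      betaP n lt lr ρ (σh ^ 2) := by
  obtain ⟨m, hm, hn, h⟩ := sum_norm_sDD_periodic hρ hP
  have hlt' : (0 : ℝ) < lt := by exact_mod_cast hlt
  have hm' : (0 : ℝ) < m := by exact_mod_cast hm
  rw [beta_iid, sum_Icc_norm_sDD, h, betaP, hn]
  generalize σh ^ 2 = v at hσ ⊢
  have h1 : 0 < 1 + m * ρ * v := by positivity
  push_cast
  field_simp
  ring

theorem beta_timeDivision (hlt : 0 < lt) {S : Matrix (Fin n) (Fin lt) ℂ} {ρ σh : ℝ}
    (hσ : 0 < σh ^ 2) (hρ : 0 < ρ) (hT : IsTimeDivisionPilot S ρ) :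
    beta S ρ (0 : Fin lr × Fin lt → ℂ)
      (((σh ^ 2 : ℝ) : ℂ) • (1 : Matrix (Fin lr × Fin lt) (Fin lr × Fin lt) ℂ)) =
      ((lt : ℝ) ^ 2)⁻¹ * betaP n lt lr ρ (σh ^ 2) := by
  obtain ⟨m, hm, hn, h⟩ := sum_norm_sDD_timeDivision hρ hT
  have hlt' : (0 : ℝ) < lt := by exact_mod_cast hlt
  have hm' : (0 : ℝ) < m := by exact_mod_cast hm
  rw [beta_iid, sum_Icc_norm_sDD, h, betaP, hn]
  generalize σh ^ 2 = v at hσ ⊢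
  have h1 : 0 < 1 + m * ρ * v := by positivity
  push_cast
  field_simp
  ring

theorem received_apply (S : Matrix (Fin n) (Fin lt) ℂ) (f : ℝ) (h : Fin lr × Fin lt → ℂ)
    (w : Fin lr × Fin n → ℂ) (i : Fin lr × Fin n) :
    received S f h w i = phase f i.2 * (bigX lr S 0 *ᵥ h) i + w i := by
  rw [received, bigX_eq_rot_mul S f, ← Matrix.mulVec_mulVec, Pi.add_apply, rot,
    Matrix.mulVec_diagonal]

theorem continuous_received (S : Matrix (Fin n) (Fin lt) ℂ) :
    Continuous fun x : ℝ × (Fin lr × Fin lt → ℂ) × (Fin lr × Fin n → ℂ) =>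
      received S x.1 x.2.1 x.2.2 := by
  refine continuous_pi fun i => ?_
  simp only [received_apply, phase, Matrix.mulVec, dotProduct]
  fun_prop

/-! ### Laws of the received signal -/

section Law

variable {Ω : Type*} [MeasurableSpace Ω] {P : Measure Ω} [IsProbabilityMeasure P]
  {S : Matrix (Fin n) (Fin lt) ℂ} {μ : Fin lr × Fin lt → ℂ}
  {Sig : Matrix (Fin lr × Fin lt) (Fin lr × Fin lt) ℂ}
  {h : Ω → Fin lr × Fin lt → ℂ} {w : Ω → Fin lr × Fin n → ℂ}

theorem measurable_received (hh : Measurable h) (hw : Measurable w) (f : ℝ) :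
    Measurable fun ω => received S f (h ω) (w ω) :=
  Measurable.comp (g := fun x : ℝ × (Fin lr × Fin lt → ℂ) × (Fin lr × Fin n → ℂ) =>
    received S x.1 x.2.1 x.2.2) (f := fun ω => (f, h ω, w ω))
    (continuous_received S).measurable (measurable_const.prodMk (hh.prodMk hw))

theorem measurable_offset_received {fδ : Ω → ℝ} (hf : Measurable fδ) (hh : Measurable h)
    (hw : Measurable w) : Measurable fun ω => (fδ ω, received S (fδ ω) (h ω) (w ω)) :=
  hf.prodMk (Measurable.comp (g := fun x : ℝ × (Fin lr × Fin lt → ℂ) × (Fin lr × Fin n → ℂ) =>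
    received S x.1 x.2.1 x.2.2) (f := fun ω => (fδ ω, h ω, w ω))
    (continuous_received S).measurable (hf.prodMk (hh.prodMk hw)))

/-- The conditional law of the received signal. -/
theorem map_received (hSig : Sig.PosDef) (hh : Measurable h) (hw : Measurable w)
    (hhlaw : P.map h = cnMeasure μ Sig) (hwlaw : P.map w = cnMeasure 0 1)
    (hind : IndepFun h w P) (f : ℝ) :
    P.map (fun ω => received S f (h ω) (w ω)) =
      RegularFamily.law volume (likelihood S μ Sig) f := by
  have h1 := map_mulVec_add_cnMeasure hSig μ (bigX lr S f) hh hw hhlaw hwlaw hind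
  simp only [received]
  rw [h1]
  rfl

/-- The joint law of the offset and the received signal. -/
theorem map_offset_received (hSig : Sig.PosDef) (hh : Measurable h) (hw : Measurable w)
    (hhlaw : P.map h = cnMeasure μ Sig) (hwlaw : P.map w = cnMeasure 0 1)
    (hind : IndepFun h w P) {fδ : Ω → ℝ} (hf : Measurable fδ) {μf : ℝ} {vf : ℝ≥0} (hvf : vf ≠ 0)
    (hflaw : P.map fδ = gaussianReal μf vf) (hindf : IndepFun fδ (fun ω => (h ω, w ω)) P)
    (hlik : Measurable fun x : ℝ × (Fin lr × Fin n → ℂ) => likelihood S μ Sig x.2 x.1) :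
    P.map (fun ω => (fδ ω, received S (fδ ω) (h ω) (w ω))) =
      RegularFamily.jointLaw volume (likelihood S μ Sig) (gaussianPDFReal μf vf) := by
  have hhw : Measurable fun ω => (h ω, w ω) := hh.prodMk hw
  have hrec := (continuous_received (lr := lr) S).measurable
  have hjoint := (indepFun_iff_map_prod_eq_prod_map_map hf.aemeasurable hhw.aemeasurable).mp hindf
  rw [hflaw] at hjoint
  have : IsProbabilityMeasure (P.map fun ω => (h ω, w ω)) :=
    Measure.isProbabilityMeasure_map hhw.aemeasurable
  have hg : Measurable fun x : ℝ × (Fin lr × Fin lt → ℂ) × (Fin lr × Fin n → ℂ) =>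
      (x.1, received S x.1 x.2.1 x.2.2) := measurable_fst.prodMk hrec
  refine Measure.ext_of_lintegral _ fun F hF => ?_
  have hFg : Measurable fun x : ℝ × (Fin lr × Fin lt → ℂ) × (Fin lr × Fin n → ℂ) =>
      F (x.1, received S x.1 x.2.1 x.2.2) := hF.comp hg
  have hFf : ∀ f : ℝ, Measurable fun y => F (f, y) := fun f => hF.comp measurable_prodMk_left
  have hl : ∀ f, Measurable fun y => ENNReal.ofReal (likelihood S μ Sig y f) := fun f =>
    (hlik.comp (measurable_prodMk_left (x := f))).ennreal_ofReal
  have hq : Measurable fun x : ℝ × (Fin lr × Fin n → ℂ) =>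
      ENNReal.ofReal (likelihood S μ Sig x.2 x.1 * gaussianPDFReal μf vf x.1) :=
    (hlik.mul ((measurable_gaussianPDFReal μf vf).comp measurable_fst)).ennreal_ofReal
  -- By independence the offset can be frozen, and for a frozen offset the inner integral is the one
  -- of `map_received`.
  have hinner : ∀ f : ℝ, ∫⁻ x, F (f, received S f x.1 x.2) ∂(P.map fun ω => (h ω, w ω)) =
      ∫⁻ y, ENNReal.ofReal (likelihood S μ Sig y f) * F (f, y) := by
    intro f
    have hFfg : Measurable fun x : (Fin lr × Fin lt → ℂ) × (Fin lr × Fin n → ℂ) =>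
        F (f, received S f x.1 x.2) := hFg.comp measurable_prodMk_left
    rw [lintegral_map hFfg hhw, ← lintegral_map (hFf f) (measurable_received hh hw f),
      map_received hSig hh hw hhlaw hwlaw hind, RegularFamily.law,
      lintegral_withDensity_eq_lintegral_mul _ (hl f) (hFf f)]
    rfl
  rw [lintegral_map hF (measurable_offset_received hf hh hw), ← lintegral_map hFg (hf.prodMk hhw), hjoint,
    lintegral_prod _ hFg.aemeasurable]
  simp only [hinner]
  rw [gaussianReal_of_var_ne_zero _ hvf, lintegral_withDensity_eq_lintegral_mul _
    (measurable_gaussianPDF μf vf) (Measurable.lintegral_prod_right'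
      (f := fun x : ℝ × (Fin lr × Fin n → ℂ) =>
        ENNReal.ofReal (likelihood S μ Sig x.2 x.1) * F x) (hlik.ennreal_ofReal.mul hF)),
    RegularFamily.jointLaw, lintegral_withDensity_eq_lintegral_mul _ hq hF,
    lintegral_prod _ (hq.mul hF).aemeasurable]
  refine lintegral_congr fun f => ?_
  have hlF : Measurable fun y => ENNReal.ofReal (likelihood S μ Sig y f) * F (f, y) :=
    (hl f).mul (hFf f)
  rw [Pi.mul_apply, ← lintegral_const_mul _ hlF]
  refine lintegral_congr fun y => ?_
  rw [Pi.mul_apply, ENNReal.ofReal_mul (likelihood_pos S hSig μ y f).le, ← mul_assoc,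
    mul_comm (gaussianPDF μf vf f)]
  rfl

end Law

end CFO

end

/-! ### Transfer to the probability space -/

theorem mainTheorem4 {Ω : Type*} [MeasurableSpace Ω] (P : Measure Ω) [IsProbabilityMeasure P]
    (n lt lr : ℕ) (hn : 0 < n) (hlt : 0 < lt) (hlr : 0 < lr)
    -- orthogonal pilot
    (S : Matrix (Fin n) (Fin lt) ℂ) (ρ : ℝ)
    (hS : Sᴴ * S = ((n * ρ / lt : ℝ) : ℂ) • (1 : Matrix (Fin lt) (Fin lt) ℂ))
    -- channel mean and covariance, prior mean and prior variance of the offset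
    (μ : Fin lr × Fin lt → ℂ) (Sig : Matrix (Fin lr × Fin lt) (Fin lr × Fin lt) ℂ)
    (hSig : Sig.PosDef) (μf : ℝ) (vf : ℝ≥0) (hvf : vf ≠ 0)
    -- offset, channel and noise, mutually independent
    (fδ : Ω → ℝ) (h : Ω → Fin lr × Fin lt → ℂ) (w : Ω → Fin lr × Fin n → ℂ)
    (hfm : Measurable fδ) (hhm : Measurable h) (hwm : Measurable w)
    (hflaw : P.map fδ = gaussianReal μf vf)
    (hhlaw : P.map h = CFO.cnMeasure μ Sig)
    (hwlaw : P.map w = CFO.cnMeasure 0 1)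
    (hind : IndepFun h w P) (hindf : IndepFun fδ (fun ω => (h ω, w ω)) P) :
    -- `likelihood` is the conditional density of the received signal, and it is smooth enough
    (∀ f : ℝ, P.map (fun ω => CFO.received S f (h ω) (w ω)) =
        (volume : Measure (Fin lr × Fin n → ℂ)).withDensity
          (fun y => ENNReal.ofReal (CFO.likelihood S μ Sig y f))) ∧
    (∀ (y : Fin lr × Fin n → ℂ) (f : ℝ), 0 < CFO.likelihood S μ Sig y f) ∧
    (∀ y : Fin lr × Fin n → ℂ, ContDiff ℝ 2 (fun f => CFO.likelihood S μ Sig y f)) ∧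
    0 ≤ CFO.beta S ρ μ Sig ∧
    -- Bayesian CRLB
    (Integrable (fun ω =>
        CFO.jointLogD2 S μ Sig μf vf (CFO.received S (fδ ω) (h ω) (w ω)) (fδ ω)) P ∧
      -(∫ ω, CFO.jointLogD2 S μ Sig μf vf (CFO.received S (fδ ω) (h ω) (w ω)) (fδ ω) ∂P) =
        CFO.beta S ρ μ Sig + (vf : ℝ)⁻¹ ∧
      ∀ est : (Fin lr × Fin n → ℂ) → ℝ, Measurable est →
        Tendsto (fun f => CFO.condBias P S h w est f * gaussianPDFReal μf vf f) atTop (𝓝 0) →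
        Tendsto (fun f => CFO.condBias P S h w est f * gaussianPDFReal μf vf f) atBot (𝓝 0) →
        ENNReal.ofReal (1 / (CFO.beta S ρ μ Sig + (vf : ℝ)⁻¹)) ≤
          CFO.bayesMSE P S fδ h w est) ∧
    -- conditional CRLB at an offset `f`, for estimators whose bias has zero derivative at `f`
    (∀ f : ℝ,
      Integrable (fun ω => CFO.condLogD2 S μ Sig (CFO.received S f (h ω) (w ω)) f) P ∧
      -(∫ ω, CFO.condLogD2 S μ Sig (CFO.received S f (h ω) (w ω)) f ∂P) = CFO.beta S ρ μ Sig ∧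
      ∀ est : (Fin lr × Fin n → ℂ) → ℝ, Measurable est →
        HasDerivAt (fun u => CFO.condBias P S h w est u) 0 f →
        (ENNReal.ofReal (CFO.beta S ρ μ Sig))⁻¹ ≤ CFO.condMSE P S h w est f) ∧
    -- independent identically distributed zero-mean channel
    (∀ σh : ℝ, μ = 0 →
      Sig = ((σh ^ 2 : ℝ) : ℂ) • (1 : Matrix (Fin lr × Fin lt) (Fin lr × Fin lt) ℂ) →
      CFO.beta S ρ μ Sig =
          8 * Real.pi ^ 2 * lr * ((σh ^ 2)⁻¹ + n * ρ / lt)⁻¹ * σh ^ 2 *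
            ∑ k ∈ Finset.Icc 1 (n - 1), (k : ℝ) ^ 2 *
              ∑ k₁ ∈ Finset.Icc (k + 1) n, ‖CFO.sDD S k₁ (k₁ - k)‖ ^ 2 ∧
      (0 < ρ → CFO.IsPeriodicPilot S ρ →
        CFO.beta S ρ μ Sig = CFO.betaP n lt lr ρ (σh ^ 2)) ∧
      (0 < ρ → CFO.IsTimeDivisionPilot S ρ →
        CFO.beta S ρ μ Sig = ((lt : ℝ) ^ 2)⁻¹ * CFO.betaP n lt lr ρ (σh ^ 2)))
    := by
  obtain ⟨C, M, lam, R⟩ := CFO.exists_regularFamily hS hSig μ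
  have G := RegularFamily.regularPrior_gaussian μf hvf
  have hlaw := CFO.map_received (S := S) hSig hhm hwm hhlaw hwlaw hind
  have hjoint := CFO.map_offset_received hSig hhm hwm hhlaw hwlaw hind hfm hvf hflaw hindf R.meas_p
  have hrm := CFO.measurable_received (S := S) hhm hwm
  have hjm := CFO.measurable_offset_received (S := S) hfm hhm hwm
  have hJ := CFO.integral_trigForm_two_eq_neg_beta hS hSig μ
  have hβ := CFO.beta_nonneg hS hSig μ
  have hv : (0 : ℝ) < (vf : ℝ)⁻¹ := inv_pos.mpr (by exact_mod_cast pos_iff_ne_zero.mpr hvf)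
  have hbias : ∀ est : (Fin lr × Fin n → ℂ) → ℝ, Measurable est → ∀ f,
      CFO.condBias P S h w est f =
        ∫ y, est y - f ∂(RegularFamily.law volume (CFO.likelihood S μ Sig) f) := by
    intro est he f
    rw [← hlaw f, integral_map (hrm f).aemeasurable (he.sub_const f).aestronglyMeasurable]
    rfl
  refine ⟨hlaw, CFO.likelihood_pos S hSig μ, CFO.contDiff_likelihood hS hSig μ, hβ,
    ⟨?_, ?_, fun est he htop hbot => ?_⟩, fun f => ⟨?_, ?_, fun est he hb => ?_⟩,
    fun σh hμ hI => ?_⟩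
  · simp only [CFO.jointLogD2_eq hS hSig μ μf hvf]
    have := R.integrable_joint_s' G
    rw [← hjoint, integrable_map_measure R.meas_s'.aestronglyMeasurable hjm.aemeasurable] at this
    exact this.sub (integrable_const _)
  · simp only [CFO.jointLogD2_eq hS hSig μ μf hvf]
    have hi := R.integrable_joint_s' G
    have hval := R.integral_joint_s' G hJ
    rw [← hjoint, integrable_map_measure R.meas_s'.aestronglyMeasurable hjm.aemeasurable] at hi
    rw [← hjoint, integral_map hjm.aemeasurable R.meas_s'.aestronglyMeasurable] at hval
    rw [integral_sub (by exact hi) (integrable_const _), hval]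
    simp
    ring
  · simp only [hbias est he] at htop hbot
    have hmain := R.bayesianCramerRao G hJ he htop hbot
    have hm : Measurable fun x : ℝ × (Fin lr × Fin n → ℂ) =>
        ENNReal.ofReal ((est x.2 - x.1) ^ 2) :=
      (((he.comp measurable_snd).sub measurable_fst).pow_const 2).ennreal_ofReal
    rw [← hjoint, lintegral_map hm hjm] at hmain
    -- The prior makes the total information positive, so real and extended inverses agree. In the
    -- conditional bound `beta` may vanish, and the extended inverse stays.
    rwa [one_div, ENNReal.ofReal_inv_of_pos (by linarith)]
  · simp only [CFO.condLogD2_eq hS hSig μ]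
    have := (R.integrable_law_iff f).mpr (R.integrable_s'_mul f)
    rwa [← hlaw f, integrable_map_measure (R.measurable_s' f).aestronglyMeasurable
      (hrm f).aemeasurable] at this
  · simp only [CFO.condLogD2_eq hS hSig μ]
    have := R.integral_law f fun y => trigForm CFO.time (CFO.quadG S ρ Sig)
      (CFO.linV S ρ μ Sig) 2 y f
    rw [← hlaw f, integral_map (hrm f).aemeasurable (R.measurable_s' f).aestronglyMeasurable,
      hJ f] at this
    rw [this, neg_neg]
  · simp only [hbias est he] at hb
    have hmain := R.cramerRao he hb
    rw [R.integral_law, hJ f, neg_neg, ← hlaw f,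
      lintegral_map ((he.sub_const f).pow_const 2).ennreal_ofReal (hrm f)] at hmain
    exact hmain
  · subst hμ hI
    have hσ : 0 < σh ^ 2 := by
      -- Positive definiteness yields the positive variance through a diagonal entry, which exists
      -- since `lr` and `lt` are positive.
      have h0 := hSig.diag_pos (i := ((⟨0, hlr⟩, ⟨0, hlt⟩) : Fin lr × Fin lt))
      rw [Matrix.smul_apply, Matrix.one_apply_eq, smul_eq_mul, mul_one] at h0
      exact_mod_cast h0
    exact ⟨CFO.beta_iid S ρ σh, CFO.beta_periodic hlt hσ, CFO.beta_timeDivision hlt hσ⟩
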